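/- Conventions. For possibly undefined terms, $x\simeq y$ means that both are undefined or both are defined and equal, and $x\lesssim y$ means that if $x$ is defined then so is $y$ and they are equal; $x\!\downarrow$ means that $x$ is defined. A *paracategory* is a directed graph with a partial operation $[f_1,\dots,f_n]$ on finite paths (including the empty path $\epsilon_A$ at each object $A$) such that $1_A:=[\epsilon_A]$ is defined, $[f]=f$, and $[\vec r,[\vec f],\vec s]\simeq[\vec r,\vec f,\vec s]$ whenever $[\vec f]\!\downarrow$. A *functor* of paracategories is a graph homomorphism $F$ with $F[\vec p]\lesssim[F\vec p]$. A category is a paracategory in which composition is total. A *(strict) symmetric monoidal paracategory* has a functor of paracategories $\otimes$ and an object $I$, strictly associative and unital on objects and arrows, and arrows $\sigma_{A,B}:A\otimes B\to B\otimes A$ such that $[1_X\otimes\sigma_{A,B},f]$ and $[g,1_X\otimes\sigma_{A,B}]$ are always defined, $\sigma$ is natural in both variables, $[\sigma_{A,B},\sigma_{B,A}]=1$, and $\sigma_{A,B\otimes C}=[\sigma_{A,B}\otimes1_C,1_B\otimes\sigma_{A,C}]$. It is *compact closed* if each object $A$ has a given object $A^*$ and given arrows $\eta_A:I\to A^*\otimes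 A$, $\varepsilon_A:A\otimes A^*\to I$ such that $[1_A\otimes\eta_C,f\otimes1_C]$, $[g\otimes1_{C^*},1_B\otimes\varepsilon_C]$, $[\eta_A\otimes1_B,1_{A^*}\otimes h]$, $[1_A\otimes k,\varepsilon_A\otimes1_C]$ are defined for all $f:A\otimes C^*\to B$, $g:A\to B\otimes C$, $h:A\otimes B\to C$, $k:B\to A^*\otimes C$, and $[1_A\otimes\eta_A,\varepsilon_A\otimes1_A]=1_A$, $[\eta_A\otimes1_{A^*},1_{A^*}\otimes\varepsilon_A]=1_{A^*}$. Its partial trace is $\mathrm{Tr}^U(f)\simeq[1_A\otimes\eta_U,1_A\otimes\sigma_{U^*,U},f\otimes1_{U^*},1_B\otimes\varepsilon_U]$ for $f:A\otimes U\to B\otimes U$. An isomorphism $m:A\to B$ (with inverse $m^{-1}$) is *total* if $[1_C\otimes m,f]$, $[g,1_C\otimes m]$, $[1_C\otimes m^{-1},h]$, $[k,1_C\otimes m^{-1}]$ are always defined. A *functor of symmetric monoidal paracategories* is a functor $F$ with total natural isomorphisms $m_{A,B}:FA\otimes FB\to F(A\otimes B)$, $m_I:I\to FI$ satisfying the usual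 associativity, unit and symmetry conditions (it is strict if these are identities); a *functor of compact closed paracategories* has in addition total natural isomorphisms $m_*:(FA)^*\to F(A^*)$ compatible with $\eta$ and $\varepsilon$. An isomorphism of such functors is a natural family of total isomorphisms compatible with $m_{A,B}$, $m_I$ (and $m_*$). A *partial trace* on a symmetric monoidal category $\mathcal C$ is a family of partial functions $\mathrm{Tr}^U_{A,B}:\mathcal C(A\otimes U,B\otimes U)\rightharpoonup\mathcal C(A,B)$ such that (up to associators and unitors): $h\circ\mathrm{Tr}^U(f)\circ g\lesssim\mathrm{Tr}^U((h\otimes1)\circ f\circ(g\otimes1))$; $\mathrm{Tr}^U((1\otimes g)\circ f)\simeq\mathrm{Tr}^{U'}(f\circ(1\otimes g))$ for $f:A\otimes U\to B\otimes U'$, $g:U'\to U$; $g\otimes\mathrm{Tr}^U(f)\lesssim\mathrm{Tr}^U(g\otimes f)$; $\mathrm{Tr}^I(f)\simeq f$; if $\mathrm{Tr}^V(f)\!\downarrow$ then $\mathrm{Tr}^U(\mathrm{Tr}^V(f))\simeq\mathrm{Tr}^{U\otimes V}(f)$; and $\mathrm{Tr}^A(\sigma_{A,A})\simeq1_A$.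 For a partially traced strict symmetric monoidal category $\mathcal C$, $\mathrm{Int}^p(\mathcal C)$ has as objects the pairs $(A^+,A^-)$ of objects of $\mathcal C$, and as arrows $(A^+,A^-)\to(B^+,B^-)$ the arrows $A^+\otimes B^-\to B^+\otimes A^-$ of $\mathcal C$. For a path $p_1,\dots,p_n$ with $p_i:(A_{i-1}^+,A_{i-1}^-)\to(A_i^+,A_i^-)$ put $\vec A_n=A_0^-\otimes\dots\otimes A_{n-1}^-$ and define $s_n:A_0^+\otimes\vec A_n\otimes A_n^-\to A_n^+\otimes A_0^-\otimes\vec A_n$ by $s_0=1$ and $s_{n+1}=(1_{A_{n+1}^+}\otimes\sigma_{A_n^-,A_0^-\otimes\vec A_n})\circ(p_{n+1}\otimes1)\circ(1_{A_n^+}\otimes\sigma_{A_0^-\otimes\vec A_n,A_{n+1}^-})\circ(s_n\otimes1_{A_{n+1}^-})$; then $[p_1,\dots,p_n]:\simeq\mathrm{Tr}^{\vec A_n}(s_n\circ(1_{A_0^+}\otimes\sigma_{A_n^-,\vec A_n}))$. Its tensor is $(A^+,A^-)\otimes(B^+,B^-)=(A^+\otimes B^+,B^-\otimes A^-)$ on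 objects and $f\otimes g$ conjugated with the evident symmetries on arrows, its unit is $(I,I)$, its symmetry is $\sigma_{A^+,B^+}\otimes\sigma_{A^-,B^-}$, $(A,B)^*=(B,A)$, and $\eta_{(A,B)}=1_{B\otimes A}$, $\varepsilon_{(A,B)}=1_{A\otimes B}$ in $\mathcal C$. Let $N:\mathcal C\to\mathrm{Int}^p(\mathcal C)$, $N(A)=(A,I)$, $N(f)=f$. **Theorem.** Let $\mathcal C$ be a partially traced strict symmetric monoidal category. Then $\mathrm{Int}^p(\mathcal C)$ is the free compact closed paracategory on $\mathcal C$, that is: 1. $\mathrm{Int}^p(\mathcal C)$ is a compact closed paracategory, and $N$ is a strict functor of symmetric monoidal paracategories that preserves the trace ($\mathrm{Tr}^U(f)=g$ implies $\mathrm{Tr}^{NU}(Nf)=Ng$). 2. Let $\mathcal D$ be a compact closed paracategory and let $G:\mathcal C\to\mathcal D$ be a functor of symmetric monoidal paracategories that preserves the trace: $\mathrm{Tr}^U(f)=g$ implies $\mathrm{Tr}^{GU}([m_{A,U},Gf,m_{B,U}^{-1}])=Gg$ for $f:A\otimes U\to B\otimes U$. Then there are a (non-strict) functor of compact closed paracategories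 $K:\mathrm{Int}^p(\mathcal C)\to\mathcal D$ and an isomorphism $\theta:K\circ N\cong G$ of functors of symmetric monoidal paracategories. 3. The pair $(K,\theta)$ is essentially unique: for any two such pairs $(K,\theta)$ and $(L,\psi)$ there is exactly one isomorphism $\varphi:K\cong L$ of functors of compact closed paracategories with $[\varphi_{NA},\psi_A]=\theta_A$ for all objects $A$ of $\mathcal C$. -/

import Mathlib

open CategoryTheory MonoidalCategory Quiver

universe v v' u u'

-- arrows of a category are to be read through `CategoryStruct.toQuiver`
attribute [-instance] catToReflQuiver

/-! Kleene equality of partially defined terms is equality in `Part`; directed Kleene equality is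
the order `≤` of `Part`: `x ≤ y` says that if `x` is defined, then `y` is defined and equal to it.

For each notion the data (`...Struct`, `...Data`) are separated from the axioms (`Is...`), so that
the axioms for the partial Int-construction can be part of a conclusion. -/

/-- Appending an arrow to a path: the path `f, g, h` is `Path.nil ▹ f ▹ g ▹ h`. -/
infixl:60 " ▹ " => Quiver.Path.cons

namespace Para

/-! ### Paracategories -/

/-- A directed graph with a partial composition `[f₁, …, fₙ]` of paths and an arrow
`1_A : A ⟶ A` for each object (the axioms say that `1_A = [ε_A]`). -/
class ParacategoryStruct (C : Type u) extends Quiver.{v} C where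
  /-- the partial composition of paths -/
  comp : ∀ {A B : C}, Path A B → Part (A ⟶ B)
  /-- the identity arrows -/
  one : ∀ A : C, A ⟶ A

attribute [instance 50] ParacategoryStruct.toQuiver

open ParacategoryStruct

class IsParacategory (C : Type u) [ParacategoryStruct.{v} C] : Prop where
  comp_nil : ∀ A : C, comp (Path.nil : Path A A) = Part.some (one A)
  comp_single : ∀ {A B : C} (f : A ⟶ B), comp (Path.nil ▹ f) = Part.some f
  comp_subpath : ∀ {A B B' A' : C} (r : Path A B) (p : Path B B') (s : Path B' A') (f : B ⟶ B'),
    f ∈ comp p → comp ((r ▹ f).comp s) = comp ((r.comp p).comp s)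

/-- The identity arrow regarded as an arrow between two equal objects. Since `[r, 1, s] = [r, s]`,
inserting such arrows in a path is how equal objects are identified in composites. -/
def eqArrow {C : Type u} [ParacategoryStruct.{v} C] {A B : C} (h : A = B) : A ⟶ B :=
  h ▸ one A

/-- Functors of paracategories: graph homomorphisms with `F[p] ≤ [F p]` for all paths `p`. -/
def IsParaFunctor {C : Type u} [ParacategoryStruct.{v} C] {D : Type u'}
    [ParacategoryStruct.{v'} D] (F : C ⥤q D) : Prop :=
  ∀ {A B : C} (p : Path A B), (comp p).map F.map ≤ comp (F.mapPath p)

/-- Objects of the product of two paracategories. -/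
structure ProdPara (C : Type u) (D : Type u') where
  fst : C
  snd : D

instance ProdPara.quiver (C : Type u) [Quiver.{v} C] (D : Type u') [Quiver.{v'} D] :
    Quiver.{max v v'} (ProdPara C D) where
  Hom X Y := (X.fst ⟶ Y.fst) × (X.snd ⟶ Y.snd)

def ProdPara.fstPre (C : Type u) [Quiver.{v} C] (D : Type u') [Quiver.{v'} D] :
    ProdPara C D ⥤q C where
  obj X := X.fst
  map f := f.1

def ProdPara.sndPre (C : Type u) [Quiver.{v} C] (D : Type u') [Quiver.{v'} D] :
    ProdPara C D ⥤q D where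
  obj X := X.snd
  map f := f.2

/-- The product of two paracategories, with componentwise partial composition. -/
instance ProdPara.paracategoryStruct (C : Type u) [ParacategoryStruct.{v} C] (D : Type u')
    [ParacategoryStruct.{v'} D] : ParacategoryStruct.{max v v'} (ProdPara C D) where
  comp p := (comp ((ProdPara.fstPre C D).mapPath p)).bind fun f =>
    (comp ((ProdPara.sndPre C D).mapPath p)).map fun g => (f, g)
  one X := (one X.fst, one X.snd)

/-! ### Strict symmetric monoidal paracategories -/

/-- The data of a strict symmetric monoidal paracategory, with strictness on objects. -/
class MonoidalParaStruct (C : Type u) extends ParacategoryStruct.{v} C where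
  tObj : C → C → C
  tHom : ∀ {A B A' B' : C}, (A ⟶ B) → (A' ⟶ B') → (tObj A A' ⟶ tObj B B')
  unit : C
  symm : ∀ A B : C, tObj A B ⟶ tObj B A
  tObj_assoc : ∀ A B E : C, tObj (tObj A B) E = tObj A (tObj B E)
  unit_tObj : ∀ A : C, tObj unit A = A
  tObj_unit : ∀ A : C, tObj A unit = A

open MonoidalParaStruct

/-- tensor product of objects of a monoidal paracategory -/
infixr:70 " ⊠ " => MonoidalParaStruct.tObj

/-- tensor product of arrows of a monoidal paracategory -/
infixr:70 " ⊠ₘ " => MonoidalParaStruct.tHom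

section structural

variable {C : Type u} [MonoidalParaStruct.{v} C]

/-- identity arrow `(A ⊗ B) ⊗ E = A ⊗ (B ⊗ E)` -/
def asc (A B E : C) : (A ⊠ B) ⊠ E ⟶ A ⊠ (B ⊠ E) := eqArrow (tObj_assoc A B E)

/-- identity arrow `A ⊗ (B ⊗ E) = (A ⊗ B) ⊗ E` -/
def ascInv (A B E : C) : A ⊠ (B ⊠ E) ⟶ (A ⊠ B) ⊠ E := eqArrow (tObj_assoc A B E).symm

/-- identity arrow `I ⊗ A = A` -/
def lun (A : C) : unit ⊠ A ⟶ A := eqArrow (unit_tObj A)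

/-- identity arrow `A = I ⊗ A` -/
def lunInv (A : C) : A ⟶ unit ⊠ A := eqArrow (unit_tObj A).symm

/-- identity arrow `A ⊗ I = A` -/
def run (A : C) : A ⊠ unit ⟶ A := eqArrow (tObj_unit A)

/-- identity arrow `A = A ⊗ I` -/
def runInv (A : C) : A ⟶ A ⊠ unit := eqArrow (tObj_unit A).symm

/-- The tensor product as a graph homomorphism from the product paracategory. -/
def tensorPre (C : Type u) [MonoidalParaStruct.{v} C] : ProdPara C C ⥤q C where
  obj X := X.fst ⊠ X.snd
  map f := f.1 ⊠ₘ f.2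

end structural

class IsSymmMonoidalParacategory (C : Type u) [MonoidalParaStruct.{v} C] : Prop
    extends IsParacategory C where
  tensor_functor : IsParaFunctor (tensorPre C)
  tHom_assoc : ∀ {A A' B B' E E' : C} (f : A ⟶ A') (g : B ⟶ B') (h : E ⟶ E'),
    HEq ((f ⊠ₘ g) ⊠ₘ h) (f ⊠ₘ (g ⊠ₘ h))
  tHom_unit : ∀ {A B : C} (f : A ⟶ B), HEq (f ⊠ₘ one (unit : C)) f
  unit_tHom : ∀ {A B : C} (f : A ⟶ B), HEq (one (unit : C) ⊠ₘ f) f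
  symm_total_left : ∀ {X A B Y : C} (f : X ⊠ (B ⊠ A) ⟶ Y),
    (comp (Path.nil ▹ (one X ⊠ₘ symm A B) ▹ f)).Dom
  symm_total_right : ∀ {X A B Y : C} (g : Y ⟶ X ⊠ (A ⊠ B)),
    (comp (Path.nil ▹ g ▹ (one X ⊠ₘ symm A B))).Dom
  symm_natural_left : ∀ {A A' : C} (f : A ⟶ A') (B : C),
    comp (Path.nil ▹ (f ⊠ₘ one B) ▹ symm A' B) = comp (Path.nil ▹ symm A B ▹ (one B ⊠ₘ f))
  symm_natural_right : ∀ (A : C) {B B' : C} (g : B ⟶ B'),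
    comp (Path.nil ▹ (one A ⊠ₘ g) ▹ symm A B') = comp (Path.nil ▹ symm A B ▹ (g ⊠ₘ one A))
  symm_symm : ∀ A B : C, comp (Path.nil ▹ symm A B ▹ symm B A) = Part.some (one (A ⊠ B))
  hexagon : ∀ A B E : C,
    comp (Path.nil ▹ ascInv A B E ▹ (symm A B ⊠ₘ one E) ▹ asc B A E ▹ (one B ⊠ₘ symm A E) ▹
      ascInv B E A) = Part.some (symm A (B ⊠ E))

/-! ### Compact closed paracategories -/

class CompactClosedParaStruct (C : Type u) extends MonoidalParaStruct.{v} C where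
  dual : C → C
  eta : ∀ A : C, unit ⟶ dual A ⊠ A
  eps : ∀ A : C, A ⊠ dual A ⟶ unit

open CompactClosedParaStruct

class IsCompactClosedParacategory (C : Type u) [CompactClosedParaStruct.{v} C] : Prop
    extends IsSymmMonoidalParacategory C where
  eta_total_right : ∀ {A B E : C} (f : A ⊠ dual E ⟶ B),
    (comp (Path.nil ▹ (one A ⊠ₘ eta E) ▹ ascInv A (dual E) E ▹ (f ⊠ₘ one E))).Dom
  eps_total_right : ∀ {A B E : C} (g : A ⟶ B ⊠ E),
    (comp (Path.nil ▹ (g ⊠ₘ one (dual E)) ▹ asc B E (dual E) ▹ (one B ⊠ₘ eps E))).Dom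
  eta_total_left : ∀ {A B E : C} (h : A ⊠ B ⟶ E),
    (comp (Path.nil ▹ (eta A ⊠ₘ one B) ▹ asc (dual A) A B ▹ (one (dual A) ⊠ₘ h))).Dom
  eps_total_left : ∀ {A B E : C} (k : B ⟶ dual A ⊠ E),
    (comp (Path.nil ▹ (one A ⊠ₘ k) ▹ ascInv A (dual A) E ▹ (eps A ⊠ₘ one E))).Dom
  zigzag : ∀ A : C,
    comp (Path.nil ▹ runInv A ▹ (one A ⊠ₘ eta A) ▹ ascInv A (dual A) A ▹ (eps A ⊠ₘ one A) ▹
      lun A) = Part.some (one A)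
  zigzag_dual : ∀ A : C,
    comp (Path.nil ▹ lunInv (dual A) ▹ (eta A ⊠ₘ one (dual A)) ▹ asc (dual A) A (dual A) ▹
      (one (dual A) ⊠ₘ eps A) ▹ run (dual A)) = Part.some (one (dual A))

/-- The partial trace of a compact closed paracategory:
`Tr f = [1 ⊗ η_U, 1 ⊗ σ, f ⊗ 1, 1 ⊗ ε_U]`. -/
def ccTrace {C : Type u} [CompactClosedParaStruct.{v} C] {A B U : C} (f : A ⊠ U ⟶ B ⊠ U) :
    Part (A ⟶ B) :=
  comp (Path.nil ▹ runInv A ▹ (one A ⊠ₘ eta U) ▹ (one A ⊠ₘ symm (dual U) U) ▹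
    ascInv A U (dual U) ▹ (f ⊠ₘ one (dual U)) ▹ asc B U (dual U) ▹ (one B ⊠ₘ eps U) ▹ run B)

/-- The dual (transpose) `f* = [η_A ⊗ 1, 1 ⊗ f ⊗ 1, 1 ⊗ ε_B] : B* ⟶ A*` of `f : A ⟶ B`. -/
def dualArrow {C : Type u} [CompactClosedParaStruct.{v} C] {A B : C} (f : A ⟶ B) :
    Part (dual B ⟶ dual A) :=
  comp (Path.nil ▹ lunInv (dual B) ▹ (eta A ⊠ₘ one (dual B)) ▹ asc (dual A) A (dual B) ▹
    (one (dual A) ⊠ₘ (f ⊠ₘ one (dual B))) ▹ (one (dual A) ⊠ₘ eps B) ▹ run (dual A))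

/-! ### Total isomorphisms and non-strict functors -/

/-- `m` is a total isomorphism with inverse `n`. -/
structure IsTotalIso {C : Type u} [MonoidalParaStruct.{v} C] {A B : C} (m : A ⟶ B) (n : B ⟶ A) :
    Prop where
  hom_inv : comp (Path.nil ▹ m ▹ n) = Part.some (one A)
  inv_hom : comp (Path.nil ▹ n ▹ m) = Part.some (one B)
  hom_total_left : ∀ {E X : C} (f : E ⊠ B ⟶ X), (comp (Path.nil ▹ (one E ⊠ₘ m) ▹ f)).Dom
  hom_total_right : ∀ {E X : C} (g : X ⟶ E ⊠ A), (comp (Path.nil ▹ g ▹ (one E ⊠ₘ m))).Dom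
  inv_total_left : ∀ {E X : C} (h : E ⊠ A ⟶ X), (comp (Path.nil ▹ (one E ⊠ₘ n) ▹ h)).Dom
  inv_total_right : ∀ {E X : C} (k : X ⟶ E ⊠ B), (comp (Path.nil ▹ k ▹ (one E ⊠ₘ n))).Dom

/-- The data of a non-strict functor of symmetric monoidal paracategories: a graph homomorphism
with structure arrows `m_{A,B} : FA ⊗ FB ⟶ F(A ⊗ B)`, `m_I : I ⟶ FI` and their inverses. -/
structure MonoidalFunctorData (C : Type u) [MonoidalParaStruct.{v} C] (D : Type u')
    [MonoidalParaStruct.{v'} D] extends C ⥤q D where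
  m : ∀ A B : C, obj A ⊠ obj B ⟶ obj (A ⊠ B)
  mInv : ∀ A B : C, obj (A ⊠ B) ⟶ obj A ⊠ obj B
  mI : (unit : D) ⟶ obj (unit : C)
  mIInv : obj (unit : C) ⟶ (unit : D)

/-- Functors of symmetric monoidal paracategories. -/
structure MonoidalFunctorData.IsSymmMonoidal {C : Type u} [MonoidalParaStruct.{v} C] {D : Type u'}
    [MonoidalParaStruct.{v'} D] (F : MonoidalFunctorData C D) : Prop where
  functor : IsParaFunctor F.toPrefunctor
  m_total : ∀ A B : C, IsTotalIso (F.m A B) (F.mInv A B)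
  mI_total : IsTotalIso F.mI F.mIInv
  m_natural : ∀ {A A' B B' : C} (f : A ⟶ A') (g : B ⟶ B'),
    comp (Path.nil ▹ (F.map f ⊠ₘ F.map g) ▹ F.m A' B') =
      comp (Path.nil ▹ F.m A B ▹ F.map (f ⊠ₘ g))
  m_assoc : ∀ A B E : C,
    comp (Path.nil ▹ (F.m A B ⊠ₘ one (F.obj E)) ▹ F.m (A ⊠ B) E ▹ F.map (asc A B E)) =
      comp (Path.nil ▹ asc (F.obj A) (F.obj B) (F.obj E) ▹ (one (F.obj A) ⊠ₘ F.m B E) ▹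
        F.m A (B ⊠ E))
  m_left_unit : ∀ A : C,
    comp (Path.nil ▹ (F.mI ⊠ₘ one (F.obj A)) ▹ F.m unit A ▹ F.map (lun A)) =
      Part.some (lun (F.obj A))
  m_right_unit : ∀ A : C,
    comp (Path.nil ▹ (one (F.obj A) ⊠ₘ F.mI) ▹ F.m A unit ▹ F.map (run A)) =
      Part.some (run (F.obj A))
  m_symm : ∀ A B : C,
    comp (Path.nil ▹ F.m A B ▹ F.map (symm A B)) =
      comp (Path.nil ▹ symm (F.obj A) (F.obj B) ▹ F.m B A)

/-- The data of a non-strict functor of compact closed paracategories: in addition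
`m_* : (FA)* ⟶ F(A*)` and its inverse. -/
structure CompactClosedFunctorData (C : Type u) [CompactClosedParaStruct.{v} C] (D : Type u')
    [CompactClosedParaStruct.{v'} D] extends MonoidalFunctorData C D where
  mD : ∀ A : C, dual (obj A) ⟶ obj (dual A)
  mDInv : ∀ A : C, obj (dual A) ⟶ dual (obj A)

/-- (Non-strict) functors of compact closed paracategories. -/
structure CompactClosedFunctorData.IsCompactClosed {C : Type u} [CompactClosedParaStruct.{v} C]
    {D : Type u'} [CompactClosedParaStruct.{v'} D] (F : CompactClosedFunctorData C D) : Prop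
    extends F.toMonoidalFunctorData.IsSymmMonoidal where
  mD_total : ∀ A : C, IsTotalIso (F.mD A) (F.mDInv A)
  mD_natural : ∀ {A B : C} (f : A ⟶ B),
    ((dualArrow (F.map f)).bind fun d => comp (Path.nil ▹ d ▹ F.mD A)) =
      (dualArrow f).bind fun d => comp (Path.nil ▹ F.mD B ▹ F.map d)
  mD_eta : ∀ A : C,
    comp (Path.nil ▹ F.mI ▹ F.map (eta A)) =
      comp (Path.nil ▹ eta (F.obj A) ▹ (F.mD A ⊠ₘ one (F.obj A)) ▹ F.m (dual A) A)
  mD_eps : ∀ A : C,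
    comp (Path.nil ▹ (one (F.obj A) ⊠ₘ F.mD A) ▹ F.m A (dual A) ▹ F.map (eps A)) =
      comp (Path.nil ▹ eps (F.obj A) ▹ F.mI)

/-- `θ` is a total monoidal natural isomorphism from the composite `K ∘ N` to `G`; the structure
arrows of `K ∘ N` are `[m^K, K(m^N)]`. -/
structure IsCompIso {C : Type u} [MonoidalParaStruct.{v} C] {E : Type u} [MonoidalParaStruct.{v} E]
    {D : Type u'} [MonoidalParaStruct.{v'} D] (N : MonoidalFunctorData C E)
    (K : MonoidalFunctorData E D) (G : MonoidalFunctorData C D)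
    (θ : ∀ A : C, K.obj (N.obj A) ⟶ G.obj A) : Prop where
  total : ∀ A : C, ∃ θ' : G.obj A ⟶ K.obj (N.obj A), IsTotalIso (θ A) θ'
  natural : ∀ {A B : C} (f : A ⟶ B),
    comp (Path.nil ▹ K.map (N.map f) ▹ θ B) = comp (Path.nil ▹ θ A ▹ G.map f)
  monoidal : ∀ A B : C,
    comp (Path.nil ▹ (θ A ⊠ₘ θ B) ▹ G.m A B) =
      comp (Path.nil ▹ K.m (N.obj A) (N.obj B) ▹ K.map (N.m A B) ▹ θ (A ⊠ B))
  monoidal_unit :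
    comp (Path.nil ▹ K.mI ▹ K.map N.mI ▹ θ unit) = Part.some G.mI

/-- `φ` is an isomorphism between functors of compact closed paracategories: a total natural
isomorphism compatible with all structure arrows. -/
structure IsFunctorIso {E : Type u} [CompactClosedParaStruct.{v} E] {D : Type u'}
    [CompactClosedParaStruct.{v'} D] (K L : CompactClosedFunctorData E D)
    (φ : ∀ X : E, K.obj X ⟶ L.obj X) : Prop where
  total : ∀ X : E, ∃ φ' : L.obj X ⟶ K.obj X, IsTotalIso (φ X) φ'
  natural : ∀ {X Y : E} (f : X ⟶ Y),
    comp (Path.nil ▹ K.map f ▹ φ Y) = comp (Path.nil ▹ φ X ▹ L.map f)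
  monoidal : ∀ X Y : E,
    comp (Path.nil ▹ (φ X ⊠ₘ φ Y) ▹ L.m X Y) = comp (Path.nil ▹ K.m X Y ▹ φ (X ⊠ Y))
  monoidal_unit : comp (Path.nil ▹ K.mI ▹ φ unit) = Part.some L.mI
  dual : ∀ X : E,
    ((dualArrow (φ X)).bind fun d => comp (Path.nil ▹ d ▹ K.mD X ▹ φ (dual X))) =
      Part.some (L.mD X)

/-! ### Partially traced strict symmetric monoidal categories -/

/-- A monoidal category is strict if its associators and unitors are identities. -/
class IsStrictMonoidal (C : Type u) [Category.{v} C] [MonoidalCategory C] : Prop where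
  tensor_assoc : ∀ X Y Z : C, (X ⊗ Y) ⊗ Z = X ⊗ (Y ⊗ Z)
  unit_tensor : ∀ X : C, 𝟙_ C ⊗ X = X
  tensor_unit : ∀ X : C, X ⊗ 𝟙_ C = X
  associator_eq : ∀ X Y Z : C, (α_ X Y Z).hom = eqToHom (tensor_assoc X Y Z)
  leftUnitor_eq : ∀ X : C, (λ_ X).hom = eqToHom (unit_tensor X)
  rightUnitor_eq : ∀ X : C, (ρ_ X).hom = eqToHom (tensor_unit X)

/-- A partial trace on a symmetric monoidal category. -/
class PartialTrace (C : Type u) [Category.{v} C] [MonoidalCategory C] [SymmetricCategory C] where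
  tr : ∀ {A B U : C}, (A ⊗ U ⟶ B ⊗ U) → Part (A ⟶ B)
  naturality : ∀ {A A' B B' U : C} (f : A ⊗ U ⟶ B ⊗ U) (g : A' ⟶ A) (h : B ⟶ B'),
    (tr f).map (fun t => g ≫ t ≫ h) ≤ tr (g ▷ U ≫ f ≫ h ▷ U)
  dinaturality : ∀ {A B U U' : C} (f : A ⊗ U ⟶ B ⊗ U') (g : U' ⟶ U),
    tr (f ≫ B ◁ g) = tr (A ◁ g ≫ f)
  strength : ∀ {A B U X Y : C} (f : A ⊗ U ⟶ B ⊗ U) (g : X ⟶ Y),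
    (tr f).map (fun t => g ⊗ₘ t) ≤ tr ((α_ X A U).hom ≫ (g ⊗ₘ f) ≫ (α_ Y B U).inv)
  vanishing_unit : ∀ {A B : C} (f : A ⊗ 𝟙_ C ⟶ B ⊗ 𝟙_ C),
    tr f = Part.some ((ρ_ A).inv ≫ f ≫ (ρ_ B).hom)
  vanishing_tensor : ∀ {A B U V : C} (f : (A ⊗ U) ⊗ V ⟶ (B ⊗ U) ⊗ V) (t : A ⊗ U ⟶ B ⊗ U),
    t ∈ tr f → tr t = tr ((α_ A U V).inv ≫ f ≫ (α_ B U V).hom)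
  yanking : ∀ A : C, tr (β_ A A).hom = Part.some (𝟙 A)

/-- A strict symmetric monoidal category as a (total) symmetric monoidal paracategory. -/
instance ofCategory (C : Type u) [Category.{v} C] [MonoidalCategory C] [SymmetricCategory C]
    [IsStrictMonoidal C] : MonoidalParaStruct.{v} C where
  comp p := Part.some (composePath p)
  one A := 𝟙 A
  tObj A B := A ⊗ B
  tHom f g := f ⊗ₘ g
  unit := 𝟙_ C
  symm A B := (β_ A B).hom
  tObj_assoc := IsStrictMonoidal.tensor_assoc
  unit_tObj := IsStrictMonoidal.unit_tensor
  tObj_unit := IsStrictMonoidal.tensor_unit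

/-- A functor `G` from a partially traced category to a compact closed paracategory is
trace-preserving if `Tr f = g` implies `Tr [m, G f, m⁻¹] = G g`. -/
def IsTracePreserving {C : Type u} [Category.{v} C] [MonoidalCategory C] [SymmetricCategory C]
    [IsStrictMonoidal C] [PartialTrace C] {D : Type u'} [CompactClosedParaStruct.{v'} D]
    (G : MonoidalFunctorData C D) : Prop :=
  ∀ {A B U : C} (f : A ⊗ U ⟶ B ⊗ U) (g : A ⟶ B), g ∈ PartialTrace.tr f →
    G.map g ∈ (comp (Path.nil ▹ G.m A U ▹ G.map f ▹ G.mInv B U)).bind ccTrace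

/-! ### The partial Int-construction -/

/-- Objects `(A⁺, A⁻)` of the partial Int-construction. -/
@[ext]
structure IntP (C : Type u) where
  pos : C
  neg : C

namespace IntP

/-- An arrow `(A⁺, A⁻) ⟶ (B⁺, B⁻)` is an arrow `A⁺ ⊗ B⁻ ⟶ B⁺ ⊗ A⁻` of `C`. -/
@[ext]
structure Hom {C : Type u} [Category.{v} C] [MonoidalCategory C] (X Y : IntP C) : Type v where
  arr : X.pos ⊗ Y.neg ⟶ Y.pos ⊗ X.neg

instance quiver (C : Type u) [Category.{v} C] [MonoidalCategory C] : Quiver.{v} (IntP C) where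
  Hom := IntP.Hom

variable {C : Type u} [Category.{v} C] [MonoidalCategory C]

/-- `A₀⁻ ⊗ ⋯ ⊗ Aₙ₋₁⁻` for a path from `A₀` to `Aₙ` -/
def negs {X : IntP C} : ∀ {Y : IntP C}, Path X Y → C
  | _, .nil => 𝟙_ C
  | _, @Path.cons _ _ _ Y _ p _ => negs p ⊗ Y.neg

variable [SymmetricCategory C]

/-- Precomposition `A₀⁺ ⊗ (A₀⁻ ⊗ ⋯ ⊗ Aₙ₋₁⁻) ⊗ Aₙ⁻ ⟶ Aₙ⁺ ⊗ A₀⁻ ⊗ (A₀⁻ ⊗ ⋯ ⊗ Aₙ₋₁⁻)`. For the path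
`p, e` the new arrow `e` is applied, after precomposition of `p`, to `Aₙ⁺` and `Aₙ₊₁⁻`, and its
output `Aₙ⁻` becomes the last factor. -/
def pre {X : IntP C} : ∀ {Y : IntP C} (p : Path X Y),
    (X.pos ⊗ (negs p ⊗ Y.neg) ⟶ Y.pos ⊗ (X.neg ⊗ negs p))
  | _, .nil => X.pos ◁ ((λ_ X.neg).hom ≫ (ρ_ X.neg).inv)
  | _, @Path.cons _ _ _ Y Z p e =>
      (α_ X.pos (negs p ⊗ Y.neg) Z.neg).inv ≫
      pre p ▷ Z.neg ≫
      (α_ Y.pos (X.neg ⊗ negs p) Z.neg).hom ≫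
      Y.pos ◁ (β_ (X.neg ⊗ negs p) Z.neg).hom ≫
      (α_ Y.pos Z.neg (X.neg ⊗ negs p)).inv ≫
      e.arr ▷ (X.neg ⊗ negs p) ≫
      (α_ Z.pos Y.neg (X.neg ⊗ negs p)).hom ≫
      Z.pos ◁ (β_ Y.neg (X.neg ⊗ negs p)).hom ≫
      Z.pos ◁ (α_ X.neg (negs p) Y.neg).hom

/-- Partial composition: the trace, over `A₀⁻ ⊗ ⋯ ⊗ Aₙ₋₁⁻`, of the precomposition preceded by the
symmetry that exchanges `Aₙ⁻` and `A₀⁻ ⊗ ⋯ ⊗ Aₙ₋₁⁻`. -/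
def pcomp [PartialTrace C] {X Y : IntP C} (p : Path X Y) : Part (IntP.Hom X Y) :=
  (PartialTrace.tr
    ((α_ X.pos Y.neg (negs p)).hom ≫ X.pos ◁ (β_ Y.neg (negs p)).hom ≫ pre p ≫
      (α_ Y.pos X.neg (negs p)).inv)).map IntP.Hom.mk

/-- The tensor product of arrows: permute the inputs, apply `f ⊗ g`, permute the outputs. -/
def tensorArr {X X' Y Y' : IntP C} (f : IntP.Hom X X') (g : IntP.Hom Y Y') :
    (X.pos ⊗ Y.pos) ⊗ (Y'.neg ⊗ X'.neg) ⟶ (X'.pos ⊗ Y'.pos) ⊗ (Y.neg ⊗ X.neg) :=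
  (X.pos ⊗ Y.pos) ◁ (β_ Y'.neg X'.neg).hom ≫
  tensorμ X.pos Y.pos X'.neg Y'.neg ≫
  (f.arr ⊗ₘ g.arr) ≫
  tensorμ X'.pos X.neg Y'.pos Y.neg ≫
  (X'.pos ⊗ Y'.pos) ◁ (β_ X.neg Y.neg).hom

instance compactClosedParaStruct (C : Type u) [Category.{v} C] [MonoidalCategory C]
    [SymmetricCategory C] [IsStrictMonoidal C] [PartialTrace C] :
    CompactClosedParaStruct.{v} (IntP C) where
  comp p := pcomp p
  one X := ⟨𝟙 (X.pos ⊗ X.neg)⟩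
  tObj X Y := ⟨X.pos ⊗ Y.pos, Y.neg ⊗ X.neg⟩
  tHom f g := ⟨tensorArr f g⟩
  unit := ⟨𝟙_ C, 𝟙_ C⟩
  symm X Y := ⟨(β_ X.pos Y.pos).hom ⊗ₘ (β_ X.neg Y.neg).hom⟩
  tObj_assoc _ _ _ := IntP.ext (IsStrictMonoidal.tensor_assoc _ _ _)
    (IsStrictMonoidal.tensor_assoc _ _ _).symm
  unit_tObj _ := IntP.ext (IsStrictMonoidal.unit_tensor _) (IsStrictMonoidal.tensor_unit _)
  tObj_unit _ := IntP.ext (IsStrictMonoidal.tensor_unit _) (IsStrictMonoidal.unit_tensor _)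
  dual X := ⟨X.neg, X.pos⟩
  eta X := ⟨(λ_ (X.neg ⊗ X.pos)).hom ≫ (ρ_ (X.neg ⊗ X.pos)).inv⟩
  eps X := ⟨(ρ_ (X.pos ⊗ X.neg)).hom ≫ (λ_ (X.pos ⊗ X.neg)).inv⟩

/-- `(A, I) ⊗ (B, I) = (A ⊗ B, I)` -/
theorem embed_tensor [IsStrictMonoidal C] [PartialTrace C] (A B : C) :
    ((⟨A, 𝟙_ C⟩ : IntP C) ⊠ ⟨B, 𝟙_ C⟩) = ⟨A ⊠ B, 𝟙_ C⟩ :=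
  IntP.ext rfl (IsStrictMonoidal.tensor_unit _)

/-- The embedding `N A = (A, I)`, `N f = f`; it is strict, that is, its structure arrows are
identities. -/
def embed (C : Type u) [Category.{v} C] [MonoidalCategory C] [SymmetricCategory C]
    [IsStrictMonoidal C] [PartialTrace C] : MonoidalFunctorData C (IntP C) where
  obj A := ⟨A, 𝟙_ C⟩
  map f := ⟨f ▷ 𝟙_ C⟩
  m A B := eqArrow (embed_tensor A B)
  mInv A B := eqArrow (embed_tensor A B).symm
  mI := eqArrow rfl
  mIInv := eqArrow rfl

end IntP

end Para

open Para

/-! Both halves of the theorem rest on one device. A partial operation is replaced by a total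
operation on formal terms modulo an equivalence; a partial equation then becomes an equation between
classes, together with the statement that a class has a representative of a special kind.

For the Int-construction the formal terms are arrows `P ⊗ U ⟶ Q ⊗ U` with pending feedback (`Loop`).
The equivalence `Loop.Equ` is generated by tracing out a part of the feedback whenever that trace is
defined. By the vanishing axiom such a step leaves the Kleene value of the whole trace unchanged,
and an arrow `f` with trivial feedback has trace `f`; hence the trace of a loop is `f` exactly when
the loop is equivalent to `f` (`Loop.mem_tr_iff`). By naturality and strength the equivalence is a
congruence for the total composition and tensor product of loops, which satisfy the expected laws up
to equivalence. The loop of a concatenated path is equivalent to the composite of the loops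
(`IntP.loop_comp`), so a subpath may be replaced by its composite. Composites with symmetries, units
and counits create only feedback that can be yanked, so they are always defined.

For a compact closed paracategory `D` the formal terms are paths modulo replacement of a subpath by
its composite. They form the enveloping category `Env D`, in which `f ∈ comp p` if and only if `mk p
= ι f` (`Env.mem_comp`). The envelope is symmetric monoidal and the given duals become dual pairs in
it. The totality axioms say that certain arrows (`Tot`) and pairings (`TotPairing`) preserve the
arrows coming from `D` (`Rep`). Equations can thus be proved in an ordinary symmetric monoidal
category with duals; what remains is to check that the arrows constructed there come from `D`.

The extension of `G` sends `(A⁺, A⁻)` to `GA⁺ ⊗ (GA⁻)*` and bends the image of an arrow along the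
duals. A composite of bent arrows is a bent trace (`Pairing.bend_comp`), so the composite of the
images of a path is the bent canonical trace of the image of its loop (`IntP.kPath_eq`). If the
partial trace in `C` is defined, trace preservation identifies this with the image of the composite
(`IntP.hat_trace`), so the extension is a functor.

For uniqueness, every object of the Int-construction is `NA⁺ ⊗ (NA⁻)*` and every arrow is a bent
arrow of `C` (`IntP.kMap_embed`). A comparison of two extensions is forced on tensor products by
monoidality and on duals by transposition. Conversely, a comparison on the image of `N` extends by
the same formula, because compatibility is inherited by composites, tensor products and bent arrows.

The numerous equations between structural composites are instances of coherence: a morphism depends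
only on how its generators are wired together (`Wiring.Run.unique`), and `Wiring.solve` compares
wirings by computation. -/

/-! ### Wiring calculus for symmetric monoidal categories

A morphism built from generators and structural isomorphisms is determined by the way its
generators are wired together. Wires are objects labelled with natural numbers. -/

namespace Wiring

set_option linter.unusedSectionVars false

variable {C : Type u} [Category.{v} C] [MonoidalCategory C]

/-- The tensor product of a list of wires. -/
def tens : List (ℕ × C) → C
  | [] => 𝟙_ C
  | w :: l => w.2 ⊗ tens l

/-- `tens l ⊗ tens m ≅ tens (l ++ m)` -/
def app : ∀ l m : List (ℕ × C), tens l ⊗ tens m ≅ tens (l ++ m)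
  | [], m => λ_ (tens m)
  | w :: l, m => α_ w.2 (tens l) (tens m) ≪≫ whiskerLeftIso w.2 (app l m)

theorem cons_append_aux {w X' X Y K P Q R : C} (a' : X' ⊗ K ≅ P) (a : X ⊗ K ≅ Q)
    (b : Y ⊗ K ≅ R) (f : X' ⟶ w ⊗ X) (g : X ⟶ Y) :
    a'.inv ≫ (f ≫ w ◁ g) ▷ K ≫ (α_ _ _ _).hom ≫ w ◁ b.hom =
    (a'.inv ≫ f ▷ K ≫ (α_ _ _ _).hom ≫ w ◁ a.hom) ≫ w ◁ (a.inv ≫ g ▷ K ≫ b.hom) := by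
  simp

theorem whL_cons_aux {w K X Y P Q : C} (a : K ⊗ X ≅ P) (b : K ⊗ Y ≅ Q) (f : X ⟶ Y) :
    (w ◁ a.inv ≫ (α_ _ _ _).inv) ≫ (w ⊗ K) ◁ f ≫ (α_ _ _ _).hom ≫ w ◁ b.hom =
      w ◁ (a.inv ≫ K ◁ f ≫ b.hom) := by
  simp

theorem assoc_aux {w L M K P Q R S : C} (a : L ⊗ M ≅ P) (b : P ⊗ K ≅ Q) (c : M ⊗ K ≅ R)
    (d : L ⊗ R ≅ S) :
    (w ◁ b.inv ≫ (α_ _ _ _).inv) ≫ (w ◁ a.inv ≫ (α_ _ _ _).inv) ▷ K ≫ (α_ _ _ _).hom ≫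
      (w ⊗ L) ◁ c.hom ≫ (α_ _ _ _).hom ≫ w ◁ d.hom =
    w ◁ (b.inv ≫ a.inv ▷ K ≫ (α_ _ _ _).hom ≫ L ◁ c.hom ≫ d.hom) := by
  simp

theorem assoc_inv_aux {w L M K P Q R S : C} (a : L ⊗ M ≅ P) (b : P ⊗ K ≅ Q) (c : M ⊗ K ≅ R)
    (d : L ⊗ R ≅ S) :
    (w ◁ d.inv ≫ (α_ _ _ _).inv) ≫ (w ⊗ L) ◁ c.inv ≫ (α_ _ _ _).inv ≫
      ((α_ _ _ _).hom ≫ w ◁ a.hom) ▷ K ≫ (α_ _ _ _).hom ≫ w ◁ b.hom =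
    w ◁ (d.inv ≫ L ◁ c.inv ≫ (α_ _ _ _).inv ≫ a.hom ▷ K ≫ b.hom) := by
  simp

theorem runit_aux {w L P : C} (a : L ⊗ 𝟙_ C ≅ P) :
    (w ◁ a.inv ≫ (α_ _ _ _).inv) ≫ (ρ_ _).hom = w ◁ (a.inv ≫ (ρ_ _).hom) := by
  simp

theorem runit_inv_aux {w L P : C} (a : L ⊗ 𝟙_ C ≅ P) :
    (ρ_ _).inv ≫ (α_ _ _ _).hom ≫ w ◁ a.hom = w ◁ ((ρ_ _).inv ≫ a.hom) := by
  simp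

/-- `f ⊗ 1` as a morphism between tensor products of lists -/
def appR {l m : List (ℕ × C)} (f : tens l ⟶ tens m) (k : List (ℕ × C)) :
    tens (l ++ k) ⟶ tens (m ++ k) := (app l k).inv ≫ f ▷ tens k ≫ (app m k).hom

/-- `1 ⊗ f` as a morphism between tensor products of lists -/
def appL (k : List (ℕ × C)) {l m : List (ℕ × C)} (f : tens l ⟶ tens m) :
    tens (k ++ l) ⟶ tens (k ++ m) := (app k l).inv ≫ tens k ◁ f ≫ (app k m).hom

theorem appR_appR {l m : List (ℕ × C)} (f : tens l ⟶ tens m) (k k' : List (ℕ × C)) :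
    ((app (l ++ k) k').inv ≫ (app l k).inv ▷ _ ≫
      (α_ _ _ _).hom ≫ _ ◁ (app k k').hom ≫ (app l (k ++ k')).hom) ≫ appR f (k ++ k') =
    appR (appR f k) k' ≫ ((app (m ++ k) k').inv ≫ (app m k).inv ▷ _ ≫
      (α_ _ _ _).hom ≫ _ ◁ (app k k').hom ≫ (app m (k ++ k')).hom) := by
  simp [appR, whisker_exchange_assoc]

theorem appR_comp {l m k : List (ℕ × C)} (f : tens l ⟶ tens m) (g : tens m ⟶ tens k)
    (n : List (ℕ × C)) : appR (f ≫ g) n = appR f n ≫ appR g n := by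
  simp [appR]

theorem appL_comp {l m k : List (ℕ × C)} (f : tens l ⟶ tens m) (g : tens m ⟶ tens k)
    (n : List (ℕ × C)) : appL n (f ≫ g) = appL n f ≫ appL n g := by
  simp [appL]

theorem appL_appR {l m k n : List (ℕ × C)} (f : tens l ⟶ tens m) (g : tens k ⟶ tens n) :
    appL l g ≫ appR f n = appR f k ≫ appL m g := by
  simp [appL, appR, whisker_exchange_assoc]

/-! ### Canonical permutations of named wires -/

variable [SymmetricCategory C]

/-- Exchange of the first two factors. -/
def swp (a b X : C) : a ⊗ (b ⊗ X) ⟶ b ⊗ (a ⊗ X) :=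
  (α_ a b X).inv ≫ (β_ a b).hom ▷ X ≫ (α_ b a X).hom

theorem swp_swp (a b X : C) : swp a b X ≫ swp b a X = 𝟙 _ := by
  simp [swp, ← comp_whiskerRight_assoc]

theorem swp_natural (a b : C) {X Y : C} (f : X ⟶ Y) :
    a ◁ b ◁ f ≫ swp a b Y = swp a b X ≫ b ◁ a ◁ f := by
  simp only [swp, Category.assoc]
  rw [associator_inv_naturality_right_assoc, whisker_exchange_assoc,
    associator_naturality_right]

/-- This is the Yang–Baxter equation of the braiding whiskered by `X`; the rest is coherence of
associators. -/
theorem swp_yang_baxter (a b c X : C) :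
    swp a b (c ⊗ X) ≫ b ◁ swp a c X ≫ swp b c (a ⊗ X) =
      a ◁ swp b c X ≫ swp a c (b ⊗ X) ≫ c ◁ swp a b X := by
  have h := congrArg (fun t => (α_ a b (c ⊗ X)).inv ≫ (α_ (a ⊗ b) c X).inv ≫
    ((α_ a b c).hom ▷ X) ≫ t ▷ X ≫ ((α_ c b a).inv ▷ X) ≫ (α_ (c ⊗ b) a X).hom ≫
      (α_ c b (a ⊗ X)).hom) (BraidedCategory.yang_baxter a b c)
  simp only [comp_whiskerRight] at h
  simp only [swp]
  calc _ = _ := by monoidal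
    _ = _ := h
    _ = _ := by monoidal

/-- `f` moves the wire `w` of `l'` to the front; the other wires are `l`. -/
inductive IsIns (w : ℕ × C) : ∀ l l' : List (ℕ × C), (tens l' ⟶ w.2 ⊗ tens l) → Prop
  | head (l : List (ℕ × C)) : IsIns w l (w :: l) (𝟙 _)
  | tail (v : ℕ × C) {l l' : List (ℕ × C)} {f : tens l' ⟶ w.2 ⊗ tens l} :
      IsIns w l l' f → IsIns w (v :: l) (v :: l') (v.2 ◁ f ≫ swp v.2 w.2 (tens l))

/-- `f` is the canonical permutation of wires from `l` to `m`. -/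
inductive IsPm : ∀ l m : List (ℕ × C), (tens l ⟶ tens m) → Prop
  | nil : IsPm [] [] (𝟙 _)
  | cons {w : ℕ × C} {l l' m : List (ℕ × C)} {f : tens l' ⟶ w.2 ⊗ tens l}
      {g : tens l ⟶ tens m} : IsIns w l l' f → IsPm l m g → IsPm l' (w :: m) (f ≫ w.2 ◁ g)

theorem IsIns.of_eq {w : ℕ × C} {l l' : List (ℕ × C)} {f g : tens l' ⟶ w.2 ⊗ tens l}
    (h : IsIns w l l' f) (e : g = f) : IsIns w l l' g := e ▸ h

theorem IsPm.of_eq {l m : List (ℕ × C)} {f g : tens l ⟶ tens m} (h : IsPm l m f) (e : g = f) :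
    IsPm l m g := e ▸ h

theorem IsIns.perm {w : ℕ × C} {l l' : List (ℕ × C)} {f : tens l' ⟶ w.2 ⊗ tens l}
    (h : IsIns w l l' f) : l'.Perm (w :: l) := by
  induction h with
  | head l => exact .refl _
  | tail v _ ih => exact (ih.cons v).trans (.swap _ _ _)

theorem IsPm.perm {l m : List (ℕ × C)} {f : tens l ⟶ tens m} (h : IsPm l m f) : l.Perm m := by
  induction h with
  | nil => exact .refl _
  | cons h _ ih => exact h.perm.trans (ih.cons _)

/-- Among distinct wires `w` occurs in one place only, which forces the derivation. The list of
remaining wires is part of what is determined, hence the sigma type. -/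
theorem IsIns.unique {w : ℕ × C} {l l' : List (ℕ × C)} {f : tens l' ⟶ w.2 ⊗ tens l}
    (h : IsIns w l l' f) (hn : l'.Nodup) : ∀ {k : List (ℕ × C)} {g : tens l' ⟶ w.2 ⊗ tens k},
    IsIns w k l' g →
      (⟨l, f⟩ : Σ l : List (ℕ × C), (tens l' ⟶ w.2 ⊗ tens l)) = ⟨k, g⟩ := by
  induction h with
  | head l =>
    intro k g hg
    cases hg with
    | head => rfl
    | tail _ h => exact absurd (h.perm.mem_iff.2 (by simp)) (List.nodup_cons.1 hn).1
  | tail v h ih =>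
    intro k g hg
    cases hg with
    | head => exact absurd (h.perm.mem_iff.2 (by simp)) (List.nodup_cons.1 hn).1
    | tail _ h' =>
      have := ih (List.nodup_cons.1 hn).2 h'
      cases this
      rfl

/-- The target list dictates which wire is extracted next. Coherence for diagrams without generators
reduces to this, once the structural isomorphisms are shown to be canonical permutations. -/
theorem IsPm.unique {l m : List (ℕ × C)} {f : tens l ⟶ tens m} (h : IsPm l m f) :
    l.Nodup → ∀ {g : tens l ⟶ tens m}, IsPm l m g → f = g := by
  induction h with
  | nil => intro _ g hg; cases hg; rfl
  | cons h _ ih =>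
    intro hn g hg
    cases hg with
    | cons h' p' =>
      have := h.unique hn h'
      cases this
      rw [ih (List.nodup_cons.1 (h.perm.nodup_iff.1 hn)).2 p']

/-- Two wires extracted in either order give the same result up to a swap. If one of them is in
front, at most the involutivity of the symmetry is needed; if both pass the front wire `u`, the
Yang–Baxter equation is. -/
theorem IsIns.comm {w : ℕ × C} {l l' : List (ℕ × C)} {f : tens l' ⟶ w.2 ⊗ tens l}
    (h : IsIns w l l' f) : ∀ {v : ℕ × C} {m : List (ℕ × C)} {g : tens l ⟶ v.2 ⊗ tens m},
    IsIns v m l g → ∃ (k : List (ℕ × C)) (f' : tens l' ⟶ v.2 ⊗ tens k)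
      (g' : tens k ⟶ w.2 ⊗ tens m), IsIns v k l' f' ∧ IsIns w m k g' ∧
        f ≫ w.2 ◁ g ≫ swp w.2 v.2 (tens m) = f' ≫ v.2 ◁ g' := by
  induction h with
  | head l =>
    intro v m g hg
    exact ⟨_, _, _, .tail w hg, .head _, by simp [tens]⟩
  | @tail u l l' f h ih =>
    intro v m g hg
    cases hg with
    | head => exact ⟨_, _, _, .head _, h, by simp [tens, swp_swp]⟩
    | @tail _ m _ g hg =>
      obtain ⟨k, f', g', h1, h2, h3⟩ := ih hg
      refine ⟨_, _, _, .tail u h1, .tail u h2, ?_⟩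
      simp only [tens, whiskerLeft_comp, Category.assoc]
      rw [← reassoc_of% swp_natural, ← reassoc_of% swp_natural, swp_yang_baxter]
      rw [← whiskerLeft_comp_assoc, ← whiskerLeft_comp_assoc, Category.assoc, h3]
      simp

theorem IsPm.refl (l : List (ℕ × C)) : IsPm l l (𝟙 _) := by
  induction l with
  | nil => exact .nil
  | cons w l ih => simpa [tens] using IsPm.cons (.head l) ih

theorem IsPm.ins {w : ℕ × C} {m' m : List (ℕ × C)} {i : tens m ⟶ w.2 ⊗ tens m'}
    (hi : IsIns w m' m i) : ∀ {l : List (ℕ × C)} {f : tens l ⟶ tens m}, IsPm l m f →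
    ∃ (l' : List (ℕ × C)) (i' : tens l ⟶ w.2 ⊗ tens l') (f' : tens l' ⟶ tens m'),
      IsIns w l' l i' ∧ IsPm l' m' f' ∧ f ≫ i = i' ≫ w.2 ◁ f' := by
  induction hi with
  | head m =>
    intro l f hf
    cases hf with
    | cons h p => exact ⟨_, _, _, h, p, Category.comp_id _⟩
  | tail v hi ih =>
    intro l f hf
    cases hf with
    | cons h p =>
      obtain ⟨l', i', f', h1, h2, h3⟩ := ih p
      obtain ⟨k, a, b, h4, h5, h6⟩ := h.comm h1
      refine ⟨_, _, _, h4, .cons h5 h2, ?_⟩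
      simp only [tens, Category.assoc, whiskerLeft_comp]
      rw [← whiskerLeft_comp_assoc, h3, whiskerLeft_comp_assoc, swp_natural, ← reassoc_of% h6]

/-- Each extraction performed by the second permutation is pulled back through the first one by
`IsPm.ins`. -/
theorem IsPm.trans {m k : List (ℕ × C)} {g : tens m ⟶ tens k} (hg : IsPm m k g) :
    ∀ {l : List (ℕ × C)} {f : tens l ⟶ tens m}, IsPm l m f → IsPm l k (f ≫ g) := by
  induction hg with
  | nil => intro l f hf; cases hf; simpa using IsPm.nil
  | cons h p ih =>
    intro l f hf
    obtain ⟨l', i', f', h1, h2, h3⟩ := hf.ins h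
    exact (IsPm.cons h1 (ih h2)).of_eq (by
      simp only [whiskerLeft_comp]; exact (Category.assoc _ _ _).symm.trans
        ((congrArg (· ≫ _) h3).trans (Category.assoc _ _ _)))

theorem exists_isPm {l m : List (ℕ × C)} (h : l.Perm m) : ∃ f, IsPm l m f := by
  induction h with
  | nil => exact ⟨_, .nil⟩
  | cons w _ ih => obtain ⟨f, hf⟩ := ih; exact ⟨_, .cons (.head _) hf⟩
  | swap w v l => exact ⟨_, .cons (.tail _ (.head _)) (.cons (.head _) (.refl _))⟩
  | trans _ _ ih1 ih2 =>
    obtain ⟨f, hf⟩ := ih1; obtain ⟨g, hg⟩ := ih2; exact ⟨_, hg.trans hf⟩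

theorem tail_append_aux {v w X' X K P Q : C} (a' : X' ⊗ K ≅ P) (a : X ⊗ K ≅ Q)
    (f : X' ⟶ w ⊗ X) :
    (v ◁ a'.inv ≫ (α_ _ _ _).inv) ≫ (v ◁ f ≫ swp v w X) ▷ K ≫ (α_ _ _ _).hom ≫
      w ◁ ((α_ _ _ _).hom ≫ v ◁ a.hom) =
    v ◁ (a'.inv ≫ f ▷ K ≫ (α_ _ _ _).hom ≫ w ◁ a.hom) ≫ swp v w Q := by
  simp only [whiskerLeft_comp, Category.assoc, comp_whiskerRight]
  rw [swp_natural]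
  simp only [swp]
  monoidal

theorem IsIns.append {w : ℕ × C} {l l' : List (ℕ × C)} {f : tens l' ⟶ w.2 ⊗ tens l}
    (h : IsIns w l l' f) (k : List (ℕ × C)) : IsIns w (l ++ k) (l' ++ k)
      ((app l' k).inv ≫ f ▷ tens k ≫ (α_ _ _ _).hom ≫ w.2 ◁ (app l k).hom) := by
  induction h with
  | head l => exact (IsIns.head (w := w) (l ++ k)).of_eq (by simp [app, tens])
  | tail v h ih => exact (IsIns.tail v ih).of_eq (tail_append_aux _ _ _)

theorem IsPm.cons' (w : ℕ × C) {l m : List (ℕ × C)} {f : tens l ⟶ tens m} (h : IsPm l m f) :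
    IsPm (w :: l) (w :: m) (w.2 ◁ f) := by
  simpa [tens] using IsPm.cons (.head l) h

theorem IsPm.whR {l m : List (ℕ × C)} {f : tens l ⟶ tens m} (h : IsPm l m f)
    (k : List (ℕ × C)) : IsPm (l ++ k) (m ++ k) (appR f k) := by
  induction h with
  | nil => exact (IsPm.refl k).of_eq (by simp [appR, app, tens])
  | cons h p ih => exact (IsPm.cons (h.append k) ih).of_eq (cons_append_aux _ _ _ _ _)

theorem IsPm.whL (k : List (ℕ × C)) {l m : List (ℕ × C)} {f : tens l ⟶ tens m}
    (h : IsPm l m f) : IsPm (k ++ l) (k ++ m) (appL k f) := by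
  induction k with
  | nil => exact h.of_eq (by simp [appL, app, tens])
  | cons w k ih => exact (ih.cons' w).of_eq (whL_cons_aux _ _ _)

theorem middle_aux {v w L M P Q : C} (a : L ⊗ (w ⊗ M) ≅ P) (b : L ⊗ M ≅ Q) :
    (v ◁ a.inv ≫ (α_ _ _ _).inv) ≫ swp (v ⊗ L) w M ≫ w ◁ ((α_ _ _ _).hom ≫ v ◁ b.hom) =
    v ◁ (a.inv ≫ swp L w M ≫ w ◁ b.hom) ≫ swp v w Q := by
  simp only [whiskerLeft_comp, Category.assoc]
  rw [swp_natural]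
  simp only [swp, BraidedCategory.braiding_tensor_left_hom]
  monoidal

theorem IsIns.middle (w : ℕ × C) (l m : List (ℕ × C)) :
    IsIns w (l ++ m) (l ++ w :: m)
      ((app l (w :: m)).inv ≫ swp (tens l) w.2 (tens m) ≫ w.2 ◁ (app l m).hom) := by
  induction l with
  | nil =>
    refine (IsIns.head (w := w) m).of_eq ?_
    simp [tens, app, swp]
  | cons v l ih => exact (IsIns.tail v ih).of_eq (middle_aux _ _)

theorem IsPm.runit (l : List (ℕ × C)) :
    IsPm (l ++ []) l ((app l []).inv ≫ (ρ_ _).hom) := by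
  induction l with
  | nil => exact (IsPm.nil (C := C)).of_eq (by simp [app, tens, ← unitors_equal])
  | cons w l ih => exact (ih.cons' w).of_eq (runit_aux _)

theorem IsPm.runit' (l : List (ℕ × C)) :
    IsPm l (l ++ []) ((ρ_ _).inv ≫ (app l []).hom) := by
  induction l with
  | nil => exact (IsPm.nil (C := C)).of_eq (by simp [app, tens, unitors_equal])
  | cons w l ih => exact (ih.cons' w).of_eq (runit_inv_aux _)

theorem braid_aux {L w M P Q R : C} (a : L ⊗ (w ⊗ M) ≅ P) (b : L ⊗ M ≅ Q) (c : M ⊗ L ≅ R) :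
    a.inv ≫ (β_ L (w ⊗ M)).hom ≫ (α_ _ _ _).hom ≫ w ◁ c.hom =
      (a.inv ≫ swp L w M ≫ w ◁ b.hom) ≫ w ◁ (b.inv ≫ (β_ L M).hom ≫ c.hom) := by
  simp [swp]

theorem IsPm.braid (l m : List (ℕ × C)) :
    IsPm (l ++ m) (m ++ l) ((app l m).inv ≫ (β_ _ _).hom ≫ (app m l).hom) := by
  induction m with
  | nil => exact (IsPm.runit l).of_eq (by simp [app, tens])
  | cons w m ih => exact (IsPm.cons (.middle w l m) ih).of_eq (braid_aux _ _ _)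

theorem IsPm.assoc (l m k : List (ℕ × C)) :
    IsPm ((l ++ m) ++ k) (l ++ (m ++ k)) ((app (l ++ m) k).inv ≫ (app l m).inv ▷ _ ≫
      (α_ _ _ _).hom ≫ _ ◁ (app m k).hom ≫ (app l (m ++ k)).hom) := by
  induction l with
  | nil =>
    refine (IsPm.refl (m ++ k)).of_eq ?_
    simp only [List.nil_append, app, tens]
    simp
  | cons w l ih => exact (ih.cons' w).of_eq (assoc_aux _ _ _ _)

theorem IsPm.assoc' (l m k : List (ℕ × C)) :
    IsPm (l ++ (m ++ k)) ((l ++ m) ++ k) ((app l (m ++ k)).inv ≫ _ ◁ (app m k).inv ≫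
      (α_ _ _ _).inv ≫ (app l m).hom ▷ _ ≫ (app (l ++ m) k).hom) := by
  induction l with
  | nil =>
    refine (IsPm.refl (m ++ k)).of_eq ?_
    simp only [List.nil_append, app, tens]
    simp
  | cons w l ih => exact (ih.cons' w).of_eq (assoc_inv_aux _ _ _ _)

/-! ### Applying generators one after another: independence of the order -/

/-- A generator with named inputs and outputs. -/
structure Node (C : Type u) [Category.{v} C] [MonoidalCategory C] where
  id : ℕ
  ins : List (ℕ × C)
  outs : List (ℕ × C)
  map : tens ins ⟶ tens outs

/-- `f` is the result of applying the generators in a list one after another. -/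
inductive Run : List (Node C) → ∀ l m : List (ℕ × C), (tens l ⟶ tens m) → Prop
  | nil {l m : List (ℕ × C)} {f : tens l ⟶ tens m} : IsPm l m f → Run [] l m f
  | cons (r : Node C) {R : List (Node C)} {l m : List (ℕ × C)} (k : List (ℕ × C))
      {f : tens l ⟶ tens (r.ins ++ k)} {h : tens (r.outs ++ k) ⟶ tens m} :
      IsPm l (r.ins ++ k) f → Run R (r.outs ++ k) m h → Run (r :: R) l m (f ≫ appR r.map k ≫ h)

theorem Run.of_eq {R : List (Node C)} {l m : List (ℕ × C)} {f g : tens l ⟶ tens m}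
    (h : Run R l m f) (e : g = f) : Run R l m g := e ▸ h

theorem Run.pre {R : List (Node C)} {l m : List (ℕ × C)} {f : tens l ⟶ tens m}
    (h : Run R l m f) {k : List (ℕ × C)} {q : tens k ⟶ tens l} (hq : IsPm k l q) :
    Run R k m (q ≫ f) := by
  cases h with
  | nil h => exact .nil (h.trans hq)
  | cons r k h h' => rw [← Category.assoc]; exact .cons r k (h.trans hq) h'

theorem Run.trans {R : List (Node C)} {l m : List (ℕ × C)} {f : tens l ⟶ tens m}
    (h : Run R l m f) {R' : List (Node C)} {k : List (ℕ × C)} {g : tens m ⟶ tens k}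
    (h' : Run R' m k g) : Run (R ++ R') l k (f ≫ g) := by
  induction h with
  | nil h => exact h'.pre h
  | cons r k h _ ih => simpa only [Category.assoc] using! Run.cons r k h (ih h')

theorem Run.whR {R : List (Node C)} {l m : List (ℕ × C)} {f : tens l ⟶ tens m}
    (h : Run R l m f) (k : List (ℕ × C)) : Run R (l ++ k) (m ++ k) (appR f k) := by
  induction h with
  | nil h => exact .nil (h.whR k)
  | cons r j h _ ih =>
    refine (Run.cons r (j ++ k) ((IsPm.assoc _ _ _).trans (h.whR k))
      (ih.pre (IsPm.assoc' _ _ _))).of_eq ?_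
    have e := appR_appR r.map j k
    simp only [Category.assoc] at e
    simp only [appR_comp, Category.assoc]
    rw [reassoc_of% e]
    simp

theorem Run.whL (k : List (ℕ × C)) {R : List (Node C)} {l m : List (ℕ × C)}
    {f : tens l ⟶ tens m} (h : Run R l m f) : Run R (k ++ l) (k ++ m) (appL k f) := by
  have := ((h.whR k).pre (IsPm.braid k l)).trans (.nil (IsPm.braid m k))
  rw [List.append_nil] at this
  exact this.of_eq (by simp [appL, appR])

/-- The output wires of a list of generators. -/
def outs (R : List (Node C)) : List (ℕ × C) := R.flatMap Node.outs

theorem Run.ins_mem {A B : List (Node C)} {r : Node C} : ∀ {l m : List (ℕ × C)}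
    {f : tens l ⟶ tens m}, Run (A ++ r :: B) l m f → ∀ w ∈ r.ins, w ∈ l ∨ w ∈ outs A := by
  induction A with
  | nil =>
    intro l m f h w hw
    cases h with
    | cons _ k h _ => exact Or.inl (h.perm.mem_iff.2 (by simp [hw]))
  | cons a A ih =>
    intro l m f h w hw
    cases h with
    | cons _ k h h' =>
      rcases ih h' w hw with h1 | h1
      · rcases List.mem_append.1 h1 with h2 | h2
        · exact Or.inr (by simp [outs, h2])
        · exact Or.inl (h.perm.mem_iff.2 (by simp [h2]))
      · exact Or.inr (by simp only [outs, List.flatMap_cons, List.mem_append]; exact Or.inr h1)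

theorem swp_natural_left {a a' : C} (f : a ⟶ a') (b X : C) :
    f ▷ (b ⊗ X) ≫ swp a' b X = swp a b X ≫ b ◁ f ▷ X := by
  simp only [swp, Category.assoc, associator_inv_naturality_left_assoc,
    ← comp_whiskerRight_assoc, BraidedCategory.braiding_naturality_left]
  simp

theorem swp_natural_middle (a : C) {b b' : C} (f : b ⟶ b') (X : C) :
    a ◁ f ▷ X ≫ swp a b' X = swp a b X ≫ f ▷ (a ⊗ X) := by
  simp only [swp, Category.assoc, associator_inv_naturality_middle_assoc,
    ← comp_whiskerRight_assoc, BraidedCategory.braiding_naturality_right]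
  simp

theorem swp_exchange {A A' R R' : C} (a : A ⟶ A') (r : R ⟶ R') (K : C) :
    a ▷ (R ⊗ K) ≫ swp A' R K ≫ r ▷ (A' ⊗ K) =
      swp A R K ≫ r ▷ (A ⊗ K) ≫ swp R' A K ≫ a ▷ (R' ⊗ K) ≫ swp A' R' K := by
  rw [reassoc_of% swp_natural_left r, reassoc_of% swp_swp, ← swp_natural_middle, ← whisker_exchange_assoc]

/-- Exchange of the first two lists of wires. -/
def swpList (l m k : List (ℕ × C)) : tens (l ++ (m ++ k)) ⟶ tens (m ++ (l ++ k)) :=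
  (app l (m ++ k)).inv ≫ tens l ◁ (app m k).inv ≫ swp (tens l) (tens m) (tens k) ≫
    tens m ◁ (app l k).hom ≫ (app m (l ++ k)).hom

theorem isPm_swpList (l m k : List (ℕ × C)) : IsPm _ _ (swpList l m k) :=
  ((IsPm.assoc m l k).trans (((IsPm.braid l m).whR k).trans (IsPm.assoc' l m k))).of_eq
    (by simp [swpList, appR, swp])

/-- Generators acting on disjoint wires commute by the interchange law; the swaps bring the inputs
of each of them to the front in turn. -/
theorem swpList_exchange (a r : Node C) (k : List (ℕ × C)) :
    appR a.map (r.ins ++ k) ≫ swpList a.outs r.ins k ≫ appR r.map (a.outs ++ k) =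
      swpList a.ins r.ins k ≫ appR r.map (a.ins ++ k) ≫ swpList r.outs a.ins k ≫
        appR a.map (r.outs ++ k) ≫ swpList a.outs r.outs k := by
  have h := swp_exchange a.map r.map (tens k)
  simp only [appR, swpList, Category.assoc, Iso.hom_inv_id_assoc, whisker_exchange_assoc]
  simp only [← whisker_exchange_assoc, ← whiskerLeft_comp_assoc, Iso.hom_inv_id,
    whiskerLeft_id, Category.id_comp]
  simp only [← reassoc_of% h, whisker_exchange_assoc]

/-- A generator whose inputs are all initial wires waits for no earlier generator. As names are
distinct, it also competes with none for inputs, so it can be moved to the front one place at a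
time. -/
theorem Run.bubble {A B : List (Node C)} {r : Node C} : ∀ {l m : List (ℕ × C)}
    {f : tens l ⟶ tens m}, Run (A ++ r :: B) l m f → (l ++ outs (A ++ r :: B)).Nodup →
    r.ins ⊆ l → r.ins.Nodup → Run (r :: (A ++ B)) l m f := by
  induction A with
  | nil => intro l m f h _ _ _; exact h
  | cons a A ih =>
    intro l m f h hn hs hr
    cases h with
    | @cons _ _ _ _ k p h hp h' =>
      have hn' : (a.outs ++ k ++ outs (A ++ r :: B)).Nodup := by
        have h1 : (l ++ outs (a :: A ++ r :: B)).Perm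
            (a.ins ++ (a.outs ++ k ++ outs (A ++ r :: B))) := by
          refine (hp.perm.append_right _).trans ?_
          simp only [outs, List.cons_append, List.flatMap_cons, List.append_assoc]
          refine List.Perm.append_left _ ?_
          rw [← List.append_assoc, ← List.append_assoc]
          exact List.perm_append_comm.append_right _
        exact (List.nodup_append.1 (h1.nodup_iff.1 hn)).2.1
      -- An input of `r` is still present after `a` or is produced later. Being an initial wire, it
      -- cannot be among the outputs, since all names are distinct, so it is one of the wires that
      -- `a` leaves untouched.
      have hk : r.ins ⊆ k := by
        intro w hw
        have h1 := (List.nodup_append.1 hn).2.2 w (hs hw)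
        have h2 := h'.ins_mem w hw
        simp only [outs, List.cons_append, List.flatMap_cons, List.mem_append] at h1 h2
        rcases h2 with (h2 | h2) | h2
        · exact absurd rfl (h1 w (Or.inl h2))
        · exact h2
        · exact absurd rfl (h1 w (Or.inr (by simp [h2])))
      obtain ⟨r', hr', hrk⟩ := hr.subperm hk
      obtain ⟨k', hk'⟩ := hrk.exists_perm_append
      replace hk' := hk'.trans (hr'.append_right k')
      have h3 := ih h' hn' (fun w hw => List.mem_append_right _ (hk hw)) hr
      cases h3 with
      | @cons _ _ _ _ j q h3 hq h3' =>
        have hj : (a.outs ++ k').Perm j := by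
          have : (r.ins ++ (a.outs ++ k')).Perm (r.ins ++ j) := by
            refine List.Perm.trans ?_ hq.perm
            refine List.Perm.trans ?_ (hk'.symm.append_left _)
            exact List.perm_append_comm_assoc _ _ _
          exact (List.perm_append_left_iff _).1 this
        obtain ⟨c, hc⟩ := exists_isPm hk'
        obtain ⟨d, hd⟩ := exists_isPm hj
        refine (Run.cons r (a.ins ++ k') ((isPm_swpList a.ins r.ins k').trans
          ((hc.whL a.ins).trans hp)) (Run.cons a (r.outs ++ k') (isPm_swpList _ _ _)
            (h3'.pre ((hd.whL r.outs).trans (isPm_swpList _ _ _))))).of_eq ?_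
        -- Both sides are canonical permutations of distinct wires.
        have e1 : q = appL a.outs c ≫ swpList a.outs r.ins k' ≫ appL r.ins d := by
          refine hq.unique (List.nodup_append.1 hn').1 ?_
          exact ((hd.whL r.ins).trans (isPm_swpList _ _ _)).trans (hc.whL _)
        have e2 := swpList_exchange a r k'
        rw [e1]
        simp only [Category.assoc]
        rw [← reassoc_of% (appL_appR a.map c), reassoc_of% (appL_appR r.map d), reassoc_of% e2]

/-- The first generator of one run takes only initial wires, so wherever it occurs in the other run
it can be moved to the front. Removing it from both runs gives the induction. -/
theorem Run.unique {R' : List (Node C)} {l m : List (ℕ × C)} {f' : tens l ⟶ tens m}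
    (h' : Run R' l m f') : ∀ {R : List (Node C)} {f : tens l ⟶ tens m}, Run R l m f →
    R.Perm R' → (l ++ outs R).Nodup → f = f' := by
  induction h' with
  | nil h' =>
    intro R f h hR hn
    rw [List.perm_nil] at hR
    subst hR
    cases h with
    | nil h => exact h.unique (List.nodup_append.1 hn).1 h'
  | @cons r R' l m k' p' t' hp' _ ih =>
    intro R f h hR hn
    obtain ⟨A, B, rfl⟩ := List.append_of_mem (hR.mem_iff.2 (List.mem_cons_self))
    have hl := (List.nodup_append.1 hn).1
    have hik := hp'.perm.nodup_iff.1 hl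
    have h2 := h.bubble hn (fun w hw => hp'.perm.mem_iff.2 (by simp [hw]))
      (List.nodup_append.1 hik).1
    have hAB : (r :: (A ++ B)).Perm (A ++ r :: B) := List.perm_middle.symm
    cases h2 with
    | @cons _ _ _ _ k p t hp h3 =>
      have hkk : k.Perm k' := (List.perm_append_left_iff _).1 (hp.perm.symm.trans hp'.perm)
      obtain ⟨c, hc⟩ := exists_isPm hkk
      have e1 : p ≫ appL r.ins c = p' := ((hc.whL _).trans hp).unique hl hp'
      have hn' : (r.outs ++ k ++ outs (A ++ B)).Nodup := by
        have h1 : (l ++ outs (A ++ r :: B)).Perm (r.ins ++ (r.outs ++ k ++ outs (A ++ B))) := by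
          refine (hp.perm.append (hAB.symm.flatMap_right _)).trans ?_
          simp only [outs, List.flatMap_cons, List.append_assoc]
          refine List.Perm.append_left _ ?_
          rw [← List.append_assoc, ← List.append_assoc]
          exact List.perm_append_comm.append_right _
        exact (List.nodup_append.1 (h1.nodup_iff.1 hn)).2.1
      have hAB' : (A ++ B).Perm R' := (List.perm_cons r).1 (hAB.trans hR)
      -- The two runs may list the untouched wires in different orders. The permutations `c` and `d`
      -- between these orders are mutually inverse and pass through the common generator.
      obtain ⟨d, hd⟩ := exists_isPm hkk.symm
      have e2 := ih (h3.pre (hd.whL r.outs)) hAB' (by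
        refine (List.Perm.nodup_iff ?_).1 hn'
        exact (hkk.append_left _).append_right _)
      have e3 : c ≫ d = 𝟙 _ :=
        (hd.trans hc).unique (List.nodup_append.1 (hp.perm.nodup_iff.1 hl)).2.1 (.refl k)
      rw [← e1, ← e2, Category.assoc, reassoc_of% (appL_appR r.map c), ← Category.assoc (appL _ c),
        ← appL_comp, e3]
      simp [appL]

/-! ### Comparison of diagrams by computation -/

/-- Insertion of a generator into a list sorted by labels. -/
def insertNode (r : Node C) : List (Node C) → List (Node C)
  | [] => [r]
  -- `Nat.ble` and `bif` reduce by computation, which lets the comparison in `solve` be closed by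
  -- `rfl`.
  | s :: R => bif Nat.ble r.id s.id then r :: s :: R else s :: insertNode r R

/-- Sorting generators by labels. -/
def sortNodes : List (Node C) → List (Node C)
  | [] => []
  | r :: R => insertNode r (sortNodes R)

theorem insertNode_perm (r : Node C) (R : List (Node C)) : (insertNode r R).Perm (r :: R) := by
  induction R with
  | nil => exact .refl _
  | cons s R ih =>
    unfold insertNode
    cases Nat.ble r.id s.id
    · exact (ih.cons s).trans (.swap _ _ _)
    · exact .refl _

theorem sortNodes_perm (R : List (Node C)) : (sortNodes R).Perm R := by
  induction R with
  | nil => exact .refl _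
  | cons r R ih => exact (insertNode_perm _ _).trans (ih.cons r)

/-- Boolean test for distinct labels. -/
def distinct : List ℕ → Bool
  | [] => true
  | n :: l => (l.all fun m => !(Nat.beq n m)) && distinct l

theorem nodup_of_distinct {l : List ℕ} (h : distinct l = true) : l.Nodup := by
  induction l with
  | nil => exact .nil
  | cons n l ih =>
    simp only [distinct, Bool.and_eq_true, List.all_eq_true, Bool.not_eq_true'] at h
    refine List.nodup_cons.2 ⟨fun hm => ?_, ih h.2⟩
    simpa using h.1 n hm

/-! ### Reading off the wiring of a morphism by instance search -/

/-- Bracketed tensor products of wires. -/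
inductive Tree (C : Type u)
  | unit : Tree C
  | wire : ℕ → C → Tree C
  | ten : Tree C → Tree C → Tree C

namespace Tree

def obj : Tree C → C
  | unit => 𝟙_ C
  | wire _ A => A
  | ten s t => obj s ⊗ obj t

def wires : Tree C → List (ℕ × C)
  | unit => []
  | wire n A => [(n, A)]
  | ten s t => wires s ++ wires t

def iso : ∀ t : Tree C, obj t ≅ tens (wires t)
  | unit => Iso.refl _
  | wire _ A => (ρ_ A).symm
  | ten s t => (iso s ⊗ᵢ iso t) ≪≫ app _ _

end Tree

/-- `s` is a bracketing of `X`. -/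
class Shape (s : Tree C) (X : C) : Prop where
  eq : s.obj = X

instance : Shape (.unit : Tree C) (𝟙_ C) := ⟨rfl⟩
instance (n : ℕ) (A : C) : Shape (.wire n A) A := ⟨rfl⟩
instance (s t : Tree C) (X Y : C) [hs : Shape s X] [ht : Shape t Y] : Shape (.ten s t) (X ⊗ Y) :=
  ⟨by rw [← hs.eq, ← ht.eq]; rfl⟩

/-- `f` with inputs named by `s` has outputs named by `t` and applies the generators `R`. -/
class Diag {X Y : C} (s : Tree C) (f : X ⟶ Y) (t : outParam (Tree C))
    (R : outParam (List (Node C))) : Prop where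
  run : ∃ (hs : s.obj = X) (ht : t.obj = Y),
    Run R s.wires t.wires (s.iso.inv ≫ eqToHom hs ≫ f ≫ eqToHom ht.symm ≫ t.iso.hom)

/-- `s` is the bracketing of `X` with wires numbered from `n` to `k - 1`. -/
class Numbered (X : C) (n : ℕ) (s : outParam (Tree C)) (k : outParam ℕ) : Prop where
  eq : s.obj = X

/-- The low priority makes an object a single wire only if it is not visibly a unit or a tensor
product. -/
instance (priority := low) (X : C) (n : ℕ) : Numbered X n (.wire n X) (n + 1) := ⟨rfl⟩
instance (n : ℕ) : Numbered (𝟙_ C) n .unit n := ⟨rfl⟩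
instance (X Y : C) (n k j : ℕ) (s t : Tree C) [hs : Numbered X n s k] [ht : Numbered Y k t j] :
    Numbered (X ⊗ Y) n (.ten s t) j := ⟨by rw [← hs.eq, ← ht.eq]; rfl⟩

/-- `f` is a generator with label `i`; its outputs are numbered from `100 * (i + 1)`. -/
class Gen {X Y : C} (f : X ⟶ Y) (i : outParam ℕ) : Prop where
  ok : True

theorem gen {X Y : C} (f : X ⟶ Y) (i : ℕ) : Gen f i := ⟨trivial⟩

/-- The generator `f` with named inputs. -/
def Gen.node {X Y : C} (s t : Tree C) (f : X ⟶ Y) (i : ℕ) (hs : s.obj = X) (ht : t.obj = Y) :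
    Node C :=
  ⟨i, s.wires, t.wires, s.iso.inv ≫ eqToHom hs ≫ f ≫ eqToHom ht.symm ≫ t.iso.hom⟩

theorem Diag.of_run {s t : Tree C} {f : s.obj ⟶ t.obj} {R : List (Node C)}
    (h : Run R s.wires t.wires (s.iso.inv ≫ f ≫ t.iso.hom)) : Diag s f t R :=
  ⟨rfl, rfl, h.of_eq (by simp)⟩

theorem Diag.exists_run {X Y : C} {s : Tree C} {f : X ⟶ Y} {t : Tree C} {R : List (Node C)}
    (h : Diag s f t R) : ∃ (hs : X = s.obj) (ht : Y = t.obj) (g : s.obj ⟶ t.obj),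
      g = eqToHom hs.symm ≫ f ≫ eqToHom ht ∧ Run R s.wires t.wires (s.iso.inv ≫ g ≫ t.iso.hom) := by
  obtain ⟨rfl, rfl, h1⟩ := h.run
  exact ⟨rfl, rfl, f, by simp, h1.of_eq (by simp)⟩

section
variable {A A' B B' E E' P P' Q Q' : C}

theorem gen_aux {S S' : C} (a : A ⊗ 𝟙_ C ≅ S) (b : B ⊗ 𝟙_ C ≅ S') (f : A ⟶ B) :
    f = ((ρ_ _).inv ≫ a.hom) ≫ (a.inv ≫ f ▷ 𝟙_ C ≫ b.hom) ≫ b.inv ≫ (ρ_ _).hom := by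
  simp

theorem tensor_aux (a : A ≅ A') (b : B ≅ B') (e : E ≅ E') (p : P ≅ P') (c : A' ⊗ E' ≅ Q)
    (d : B' ⊗ P' ≅ Q') (x : B' ⊗ E' ≅ Y) (f : A ⟶ B) (g : E ⟶ P) :
    (c.inv ≫ (a.inv ⊗ₘ e.inv)) ≫ (f ⊗ₘ g) ≫ (b.hom ⊗ₘ p.hom) ≫ d.hom =
      (c.inv ≫ (a.inv ≫ f ≫ b.hom) ▷ E' ≫ x.hom) ≫
        x.inv ≫ B' ◁ (e.inv ≫ g ≫ p.hom) ≫ d.hom := by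
  simp [MonoidalCategory.tensorHom_def, whisker_exchange_assoc]

theorem whiskerRight_aux (a : A ≅ A') (b : B ≅ B') (e : E ≅ E') (c : A' ⊗ E' ≅ Q)
    (d : B' ⊗ E' ≅ Q') (f : A ⟶ B) :
    (c.inv ≫ (a.inv ⊗ₘ e.inv)) ≫ f ▷ E ≫ (b.hom ⊗ₘ e.hom) ≫ d.hom =
      c.inv ≫ (a.inv ≫ f ≫ b.hom) ▷ E' ≫ d.hom := by
  simp [MonoidalCategory.tensorHom_def, ← whisker_exchange_assoc]

theorem whiskerLeft_aux (a : A ≅ A') (b : B ≅ B') (e : E ≅ E') (c : E' ⊗ A' ≅ Q)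
    (d : E' ⊗ B' ≅ Q') (f : A ⟶ B) :
    (c.inv ≫ (e.inv ⊗ₘ a.inv)) ≫ E ◁ f ≫ (e.hom ⊗ₘ b.hom) ≫ d.hom =
      c.inv ≫ E' ◁ (a.inv ≫ f ≫ b.hom) ≫ d.hom := by
  simp [MonoidalCategory.tensorHom_def', whisker_exchange_assoc]

theorem braiding_aux (a : A ≅ A') (b : B ≅ B') (c : A' ⊗ B' ≅ Q) (d : B' ⊗ A' ≅ Q') :
    (c.inv ≫ (a.inv ⊗ₘ b.inv)) ≫ (β_ A B).hom ≫ (b.hom ⊗ₘ a.hom) ≫ d.hom =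
      c.inv ≫ (β_ A' B').hom ≫ d.hom := by
  simp

theorem associator_aux {S T : C} (a : A ≅ A') (b : B ≅ B') (e : E ≅ E') (c : A' ⊗ B' ≅ Q)
    (d : Q ⊗ E' ≅ S) (x : B' ⊗ E' ≅ Q') (y : A' ⊗ Q' ≅ T) :
    (d.inv ≫ ((c.inv ≫ (a.inv ⊗ₘ b.inv)) ⊗ₘ e.inv)) ≫ (α_ A B E).hom ≫
        (a.hom ⊗ₘ ((b.hom ⊗ₘ e.hom) ≫ x.hom)) ≫ y.hom =
      d.inv ≫ c.inv ▷ E' ≫ (α_ _ _ _).hom ≫ A' ◁ x.hom ≫ y.hom := by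
  have h : ((a.inv ⊗ₘ b.inv) ⊗ₘ e.inv) ≫ (α_ A B E).hom ≫ (a.hom ⊗ₘ (b.hom ⊗ₘ e.hom)) =
      (α_ A' B' E').hom := by rw [associator_naturality_assoc]; simp
  have h1 : (c.inv ≫ (a.inv ⊗ₘ b.inv)) ⊗ₘ e.inv = c.inv ▷ E' ≫ ((a.inv ⊗ₘ b.inv) ⊗ₘ e.inv) := by
    simp [MonoidalCategory.tensorHom_def]
  have h2 : a.hom ⊗ₘ ((b.hom ⊗ₘ e.hom) ≫ x.hom) =
      (a.hom ⊗ₘ (b.hom ⊗ₘ e.hom)) ≫ A' ◁ x.hom := by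
    simp [MonoidalCategory.tensorHom_def]
  rw [h1, h2, ← h]
  simp only [Category.assoc]

theorem associator_inv_aux {S T : C} (a : A ≅ A') (b : B ≅ B') (e : E ≅ E') (c : A' ⊗ B' ≅ Q)
    (d : Q ⊗ E' ≅ S) (x : B' ⊗ E' ≅ Q') (y : A' ⊗ Q' ≅ T) :
    (y.inv ≫ (a.inv ⊗ₘ (x.inv ≫ (b.inv ⊗ₘ e.inv)))) ≫ (α_ A B E).inv ≫
        (((a.hom ⊗ₘ b.hom) ≫ c.hom) ⊗ₘ e.hom) ≫ d.hom =
      y.inv ≫ A' ◁ x.inv ≫ (α_ _ _ _).inv ≫ c.hom ▷ E' ≫ d.hom := by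
  have h : (a.inv ⊗ₘ (b.inv ⊗ₘ e.inv)) ≫ (α_ A B E).inv ≫ ((a.hom ⊗ₘ b.hom) ⊗ₘ e.hom) =
      (α_ A' B' E').inv := by rw [associator_inv_naturality_assoc]; simp
  have h1 : a.inv ⊗ₘ (x.inv ≫ (b.inv ⊗ₘ e.inv)) = A' ◁ x.inv ≫ (a.inv ⊗ₘ (b.inv ⊗ₘ e.inv)) := by
    simp [MonoidalCategory.tensorHom_def']
  have h2 : ((a.hom ⊗ₘ b.hom) ≫ c.hom) ⊗ₘ e.hom =
      ((a.hom ⊗ₘ b.hom) ⊗ₘ e.hom) ≫ c.hom ▷ E' := by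
    simp [MonoidalCategory.tensorHom_def']
  rw [h1, h2, ← h]
  simp only [Category.assoc]

theorem leftUnitor_aux (a : A ≅ A') :
    ((λ_ A').inv ≫ (𝟙 (𝟙_ C) ⊗ₘ a.inv)) ≫ (λ_ A).hom ≫ a.hom = 𝟙 _ := by
  simp

theorem leftUnitor_inv_aux (a : A ≅ A') :
    a.inv ≫ (λ_ A).inv ≫ (𝟙 (𝟙_ C) ⊗ₘ a.hom) ≫ (λ_ A').hom = 𝟙 _ := by
  simp

theorem rightUnitor_aux (a : A ≅ A') (c : A' ⊗ 𝟙_ C ≅ Q) :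
    (c.inv ≫ (a.inv ⊗ₘ 𝟙 (𝟙_ C))) ≫ (ρ_ A).hom ≫ a.hom = c.inv ≫ (ρ_ A').hom := by
  simp

theorem rightUnitor_inv_aux (a : A ≅ A') (c : A' ⊗ 𝟙_ C ≅ Q) :
    a.inv ≫ (ρ_ A).inv ≫ (a.hom ⊗ₘ 𝟙 (𝟙_ C)) ≫ c.hom = (ρ_ A').inv ≫ c.hom := by
  simp

end

/-- The names of the outputs depend only on the label of the generator, and the node records the
names of its inputs. Two diagrams that feed the generator in the same way therefore produce the same
node. Numbering from `100 * (i + 1)` keeps names apart in practice; `solve` checks it. -/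
instance {X Y : C} (s t : Tree C) (f : X ⟶ Y) (i k : ℕ) [Gen f i] [hs : Shape s X]
    [ht : Numbered Y (100 * (i + 1)) t k] : Diag s f t [Gen.node s t f i hs.eq ht.eq] where
  run := ⟨hs.eq, ht.eq, (Run.cons (Gen.node s t f i hs.eq ht.eq) [] (IsPm.runit' _)
      (.nil (IsPm.runit _))).of_eq (gen_aux (app s.wires []) (app t.wires []) _)⟩

instance {X Y Z : C} (s t r : Tree C) (f : X ⟶ Y) (g : Y ⟶ Z) (R R' : List (Node C))
    [hf : Diag s f t R] [hg : Diag t g r R'] : Diag s (f ≫ g) r (R ++ R') where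
  run := by
    obtain ⟨rfl, rfl, h1⟩ := hf.run
    obtain ⟨_, rfl, h2⟩ := hg.run
    exact ⟨rfl, rfl, (h1.trans h2).of_eq (by simp)⟩

instance {X X' Y Y' : C} (s s' t t' : Tree C) (f : X ⟶ Y) (g : X' ⟶ Y') (R R' : List (Node C))
    [hf : Diag s f t R] [hg : Diag s' g t' R'] :
    Diag (.ten s s') (f ⊗ₘ g) (.ten t t') (R ++ R') := by
  obtain ⟨rfl, rfl, f, rfl, h1⟩ := hf.exists_run
  obtain ⟨rfl, rfl, g, rfl, h2⟩ := hg.exists_run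
  simp only [eqToHom_refl, Category.id_comp, Category.comp_id] at h1 h2
  refine Diag.of_run (s := .ten s s') (t := .ten t t') ?_
  exact ((h1.whR _).trans (h2.whL _)).of_eq
    (tensor_aux s.iso t.iso s'.iso t'.iso _ _ _ f g)

instance {X Y Z : C} (s s' t : Tree C) (f : X ⟶ Y) (R : List (Node C))
    [hf : Diag s f t R] [hs : Shape s' Z] : Diag (.ten s s') (f ▷ Z) (.ten t s') R := by
  obtain ⟨rfl, rfl, f, rfl, h1⟩ := hf.exists_run
  obtain rfl := hs.eq
  simp only [eqToHom_refl, Category.id_comp, Category.comp_id] at h1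
  refine Diag.of_run (s := .ten s s') (t := .ten t s') ?_
  exact (h1.whR _).of_eq (whiskerRight_aux s.iso t.iso s'.iso _ _ f)

instance {X Y Z : C} (s s' t : Tree C) (f : X ⟶ Y) (R : List (Node C))
    [hf : Diag s f t R] [hs : Shape s' Z] : Diag (.ten s' s) (Z ◁ f) (.ten s' t) R := by
  obtain ⟨rfl, rfl, f, rfl, h1⟩ := hf.exists_run
  obtain rfl := hs.eq
  simp only [eqToHom_refl, Category.id_comp, Category.comp_id] at h1
  refine Diag.of_run (s := .ten s' s) (t := .ten s' t) ?_
  exact (h1.whL _).of_eq (whiskerLeft_aux s.iso t.iso s'.iso _ _ f)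

instance {X : C} (s : Tree C) [hs : Shape s X] : Diag s (𝟙 X) s [] := by
  obtain rfl := hs.eq
  exact .of_run ((Run.nil (IsPm.refl _)).of_eq (by simp))

instance {X Y : C} (s t : Tree C) [hs : Shape s X] [ht : Shape t Y] :
    Diag (.ten s t) (β_ X Y).hom (.ten t s) [] := by
  obtain rfl := hs.eq
  obtain rfl := ht.eq
  refine Diag.of_run (s := .ten s t) (t := .ten t s) ?_
  exact (Run.nil (IsPm.braid _ _)).of_eq (braiding_aux s.iso t.iso _ _)

instance {X Y : C} (s t : Tree C) [hs : Shape s X] [ht : Shape t Y] :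
    Diag (.ten t s) (β_ X Y).inv (.ten s t) [] := by
  obtain rfl := hs.eq
  obtain rfl := ht.eq
  rw [← SymmetricCategory.braiding_swap_eq_inv_braiding]
  refine Diag.of_run (s := .ten t s) (t := .ten s t) ?_
  exact (Run.nil (IsPm.braid _ _)).of_eq (braiding_aux t.iso s.iso _ _)

instance {X Y Z : C} (s t r : Tree C) [hs : Shape s X] [ht : Shape t Y] [hr : Shape r Z] :
    Diag (.ten (.ten s t) r) (α_ X Y Z).hom (.ten s (.ten t r)) [] := by
  obtain rfl := hs.eq
  obtain rfl := ht.eq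
  obtain rfl := hr.eq
  refine Diag.of_run (s := .ten (.ten s t) r) (t := .ten s (.ten t r)) ?_
  exact (Run.nil (IsPm.assoc _ _ _)).of_eq (associator_aux s.iso t.iso r.iso _ _ _ _)

instance {X Y Z : C} (s t r : Tree C) [hs : Shape s X] [ht : Shape t Y] [hr : Shape r Z] :
    Diag (.ten s (.ten t r)) (α_ X Y Z).inv (.ten (.ten s t) r) [] := by
  obtain rfl := hs.eq
  obtain rfl := ht.eq
  obtain rfl := hr.eq
  refine Diag.of_run (s := .ten s (.ten t r)) (t := .ten (.ten s t) r) ?_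
  exact (Run.nil (IsPm.assoc' _ _ _)).of_eq (associator_inv_aux s.iso t.iso r.iso _ _ _ _)

instance {X : C} (s : Tree C) [hs : Shape s X] : Diag (.ten .unit s) (λ_ X).hom s [] := by
  obtain rfl := hs.eq
  refine Diag.of_run (s := .ten .unit s) ?_
  exact (Run.nil (IsPm.refl _)).of_eq (leftUnitor_aux s.iso)

instance {X : C} (s : Tree C) [hs : Shape s X] : Diag s (λ_ X).inv (.ten .unit s) [] := by
  obtain rfl := hs.eq
  refine Diag.of_run (t := .ten .unit s) ?_
  exact (Run.nil (IsPm.refl _)).of_eq (leftUnitor_inv_aux s.iso)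

instance {X : C} (s : Tree C) [hs : Shape s X] : Diag (.ten s .unit) (ρ_ X).hom s [] := by
  obtain rfl := hs.eq
  refine Diag.of_run (s := .ten s .unit) ?_
  exact (Run.nil (IsPm.runit _)).of_eq (rightUnitor_aux s.iso _)

instance {X : C} (s : Tree C) [hs : Shape s X] : Diag s (ρ_ X).inv (.ten s .unit) [] := by
  obtain rfl := hs.eq
  refine Diag.of_run (t := .ten s .unit) ?_
  exact (Run.nil (IsPm.runit' _)).of_eq (rightUnitor_inv_aux s.iso _)

instance {X Y Z : C} (s t r : Tree C) [hs : Shape s X] [ht : Shape t Y] [hr : Shape r Z] :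
    Diag (.ten s (.ten t r)) (swp X Y Z) (.ten t (.ten s r)) [] := by
  unfold swp
  exact (inferInstance : Diag (.ten s (.ten t r))
    ((α_ X Y Z).inv ≫ (β_ X Y).hom ▷ Z ≫ (α_ Y X Z).hom) (.ten t (.ten s r)) ([] ++ ([] ++ [])))

instance {X Y Z W : C} (s t r q : Tree C) [hs : Shape s X] [ht : Shape t Y] [hr : Shape r Z]
    [hq : Shape q W] :
    Diag (.ten (.ten s t) (.ten r q)) (tensorμ X Y Z W) (.ten (.ten s r) (.ten t q)) [] := by
  unfold tensorμ
  exact (inferInstance : Diag (.ten (.ten s t) (.ten r q))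
    ((α_ X Y (Z ⊗ W)).hom ≫ X ◁ (α_ Y Z W).inv ≫ X ◁ (β_ Y Z).hom ▷ W ≫ X ◁ (α_ Z Y W).hom ≫
      (α_ X Z (Y ⊗ W)).inv)
    (.ten (.ten s r) (.ten t q)) ([] ++ ([] ++ ([] ++ ([] ++ [])))))

instance {X Y Z : C} (e : X ≅ Y) (e' : Y ≅ Z) (s t r : Tree C) (R R' : List (Node C))
    [Diag s e.hom t R] [Diag t e'.hom r R'] : Diag s (e ≪≫ e').hom r (R ++ R') :=
  inferInstanceAs (Diag s (e.hom ≫ e'.hom) r (R ++ R'))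

instance {X Y Z : C} (e : X ≅ Y) (e' : Y ≅ Z) (s t r : Tree C) (R R' : List (Node C))
    [Diag s e'.inv t R] [Diag t e.inv r R'] : Diag s (e ≪≫ e').inv r (R ++ R') :=
  inferInstanceAs (Diag s (e'.inv ≫ e.inv) r (R ++ R'))

instance {X Y : C} (e : X ≅ Y) (s t : Tree C) (R : List (Node C)) [h : Diag s e.inv t R] :
    Diag s e.symm.hom t R := h

instance {X Y : C} (e : X ≅ Y) (s t : Tree C) (R : List (Node C)) [h : Diag s e.hom t R] :
    Diag s e.symm.inv t R := h

instance {X Y Z : C} (s s' t : Tree C) (e : X ≅ Y) (R : List (Node C))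
    [Diag s e.hom t R] [Shape s' Z] : Diag (.ten s s') (whiskerRightIso e Z).hom (.ten t s') R :=
  inferInstanceAs (Diag (.ten s s') (e.hom ▷ Z) (.ten t s') R)

instance {X Y Z : C} (s s' t : Tree C) (e : X ≅ Y) (R : List (Node C))
    [Diag s e.inv t R] [Shape s' Z] : Diag (.ten s s') (whiskerRightIso e Z).inv (.ten t s') R :=
  inferInstanceAs (Diag (.ten s s') (e.inv ▷ Z) (.ten t s') R)

instance {X Y Z : C} (s s' t : Tree C) (e : X ≅ Y) (R : List (Node C))
    [Diag s e.hom t R] [Shape s' Z] : Diag (.ten s' s) (whiskerLeftIso Z e).hom (.ten s' t) R :=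
  inferInstanceAs (Diag (.ten s' s) (Z ◁ e.hom) (.ten s' t) R)

instance {X Y Z : C} (s s' t : Tree C) (e : X ≅ Y) (R : List (Node C))
    [Diag s e.inv t R] [Shape s' Z] : Diag (.ten s' s) (whiskerLeftIso Z e).inv (.ten s' t) R :=
  inferInstanceAs (Diag (.ten s' s) (Z ◁ e.inv) (.ten s' t) R)

/-- `(X ⊗ Y) ⊗ Z ≅ (X ⊗ Z) ⊗ Y` -/
abbrev mvIso (X Y Z : C) : (X ⊗ Y) ⊗ Z ≅ (X ⊗ Z) ⊗ Y :=
  α_ X Y Z ≪≫ whiskerLeftIso X (β_ Y Z) ≪≫ (α_ X Z Y).symm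

/-- Two morphisms with the same wiring are equal. -/
theorem solve {X Y : C} {f g : X ⟶ Y} {s t t' : Tree C} {k : ℕ} {R R' : List (Node C)}
    [Numbered X 0 s k] [hf : Diag s f t R] [hg : Diag s g t' R'] (ht : t = t' := by rfl)
    (hR : sortNodes R = sortNodes R' := by rfl)
    (hn : distinct ((s.wires ++ outs R).map Prod.fst) = true := by rfl) : f = g := by
  subst ht
  obtain ⟨rfl, rfl, h1⟩ := hf.run
  obtain ⟨_, _, h2⟩ := hg.run
  have := h2.unique h1 ((sortNodes_perm R).symm.trans (hR ▸ sortNodes_perm R'))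
    (List.Nodup.of_map _ (nodup_of_distinct hn))
  simpa using this

end Wiring

/-! ### Consequences of the axioms for partial traces -/

namespace Para

open Wiring PartialTrace

set_option synthInstance.maxSize 100000
set_option synthInstance.maxHeartbeats 1000000

variable {C : Type u} [Category.{v} C] [MonoidalCategory C] [SymmetricCategory C] [PartialTrace C]

/-- A traced arrow in a context. -/
theorem tr_context {A B U P Q R : C} {f : A ⊗ U ⟶ B ⊗ U} {t : A ⟶ B} (h : t ∈ tr f)
    (a : P ⟶ R ⊗ A) (b : R ⊗ B ⟶ Q) :
    a ≫ R ◁ t ≫ b ∈ tr (a ▷ U ≫ (α_ R A U).hom ≫ R ◁ f ≫ (α_ R B U).inv ≫ b ▷ U) := by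
  have h1 := strength f (𝟙 R) _ (Part.mem_map _ h)
  have h2 := naturality _ a b _ (Part.mem_map _ h1)
  simpa using h2

/-- The yanking axiom in a context. It supplies traces that are defined without any hypothesis, and
so the totality statements for the Int-construction. -/
theorem tr_yank {P Q R V : C} (a : P ⟶ R ⊗ V) (b : R ⊗ V ⟶ Q) :
    a ≫ b ∈ tr (a ▷ V ≫ (α_ R V V).hom ≫ R ◁ (β_ V V).hom ≫ (α_ R V V).inv ≫ b ▷ V) := by
  have h := tr_context (by rw [yanking]; exact Part.mem_some _) a b
  simpa using h

theorem tr_conj {A B U U' : C} (e : U ≅ U') (f : A ⊗ U ⟶ B ⊗ U) :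
    tr (A ◁ e.inv ≫ f ≫ B ◁ e.hom) = tr f := by
  have h := dinaturality (f ≫ B ◁ e.hom) e.inv
  rw [← h]
  simp

/-! ### Loops modulo partial tracing -/

/-- An arrow with an additional input and output that are to be traced out. -/
structure Loop (P Q : C) where
  obj : C
  arr : P ⊗ obj ⟶ Q ⊗ obj

namespace Loop

variable {P Q : C}

/-- An arrow regarded as an arrow with trivial feedback. -/
def single (f : P ⟶ Q) : Loop P Q := ⟨𝟙_ C, (ρ_ P).hom ≫ f ≫ (ρ_ Q).inv⟩

theorem tr_single (f : P ⟶ Q) : tr (single f).arr = Part.some f := by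
  simp [single, vanishing_unit]

/-- `G` is obtained from `F` by tracing out a part of the feedback. -/
def Step (F G : Loop P Q) : Prop :=
  ∃ (V : C) (e : F.obj ≅ G.obj ⊗ V),
    G.arr ∈ tr ((α_ _ _ _).hom ≫ P ◁ e.inv ≫ F.arr ≫ Q ◁ e.hom ≫ (α_ _ _ _).inv)

/-- Vanishing for tensor products assumes that the inner trace is defined; this is what a step
provides. The isomorphism that splits the feedback is harmless by dinaturality. -/
theorem Step.tr_eq {F G : Loop P Q} (h : Step F G) : tr F.arr = tr G.arr := by
  obtain ⟨V, e, h⟩ := h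
  rw [vanishing_tensor _ _ h, ← tr_conj e]
  simp

/-- The equivalence relation generated by partial tracing. -/
def Equ (F G : Loop P Q) : Prop := Relation.EqvGen Step F G

theorem Step.equ {F G : Loop P Q} (h : Step F G) : Equ F G := .rel _ _ h

theorem Equ.tr_eq {F G : Loop P Q} (h : Equ F G) : tr F.arr = tr G.arr := by
  induction h with
  | rel _ _ h => exact h.tr_eq
  | refl => rfl
  | symm _ _ _ h => exact h.symm
  | trans _ _ _ _ _ h h' => exact h.trans h'

theorem Equ.map {P' Q' : C} {Φ : Loop P Q → Loop P' Q'}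
    (hΦ : ∀ F G, Step F G → Step (Φ F) (Φ G)) {F G : Loop P Q} (h : Equ F G) :
    Equ (Φ F) (Φ G) := by
  induction h with
  | rel _ _ h => exact (hΦ _ _ h).equ
  | refl => exact .refl _
  | symm _ _ _ h => exact .symm _ _ h
  | trans _ _ _ _ _ h h' => exact .trans _ _ _ h h'

theorem Equ.trans {F G H : Loop P Q} (h : Equ F G) (h' : Equ G H) : Equ F H :=
  Relation.EqvGen.trans _ _ _ h h'

theorem Equ.refl (F : Loop P Q) : Equ F F := Relation.EqvGen.refl _

theorem Equ.symm {F G : Loop P Q} (h : Equ F G) : Equ G F := Relation.EqvGen.symm _ _ h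

/-- All of the feedback is traced out at once, leaving the unit object; naturality absorbs the
unitors. -/
theorem step_single {F : Loop P Q} {f : P ⟶ Q} (h : f ∈ tr F.arr) : Step F (single f) := by
  refine ⟨F.obj, (λ_ _).symm, ?_⟩
  have := naturality _ (ρ_ P).hom (ρ_ Q).inv _ (Part.mem_map _ h)
  convert! this using 2
  have := gen F.arr 0
  dsimp only [single]
  exact solve

/-- This turns definedness and value of a trace into an equivalence of loops, which can be
manipulated by congruence even where intermediate traces are undefined. -/
theorem mem_tr_iff {F : Loop P Q} {f : P ⟶ Q} : f ∈ tr F.arr ↔ Equ F (single f) :=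
  ⟨fun h => (step_single h).equ, fun h => by rw [h.tr_eq, tr_single]; exact Part.mem_some _⟩

theorem equ_of_iso {F G : Loop P Q} (e : F.obj ≅ G.obj)
    (h : G.arr = P ◁ e.inv ≫ F.arr ≫ Q ◁ e.hom) : Equ F G := by
  refine Step.equ ⟨𝟙_ C, e ≪≫ (ρ_ _).symm, ?_⟩
  rw [vanishing_unit, Part.mem_some_iff, h]
  simp

/-- If `F` contains `f` in a context, a trace of `f` is a partial trace of `F` by naturality and
strength. The operations on loops are shown to respect steps in this way. -/
theorem step_of_context {F G : Loop P Q} {A B R V : C} {f : A ⊗ V ⟶ B ⊗ V} {t : A ⟶ B}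
    (h : t ∈ tr f) (e : F.obj ≅ G.obj ⊗ V) (a : P ⊗ G.obj ⟶ R ⊗ A) (b : R ⊗ B ⟶ Q ⊗ G.obj)
    (hG : G.arr = a ≫ R ◁ t ≫ b)
    (hF : (α_ _ _ _).hom ≫ P ◁ e.inv ≫ F.arr ≫ Q ◁ e.hom ≫ (α_ _ _ _).inv =
      a ▷ V ≫ (α_ R A V).hom ≫ R ◁ f ≫ (α_ R B V).inv ≫ b ▷ V) : Step F G :=
  ⟨V, e, by rw [hF, hG]; exact tr_context h a b⟩

theorem equ_of_yank {F G : Loop P Q} {R V : C} (e : F.obj ≅ G.obj ⊗ V)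
    (a : P ⊗ G.obj ⟶ R ⊗ V) (b : R ⊗ V ⟶ Q ⊗ G.obj) (hG : G.arr = a ≫ b)
    (hF : (α_ _ _ _).hom ≫ P ◁ e.inv ≫ F.arr ≫ Q ◁ e.hom ≫ (α_ _ _ _).inv =
      a ▷ V ≫ (α_ R V V).hom ≫ R ◁ (β_ V V).hom ≫ (α_ R V V).inv ≫ b ▷ V) : Equ F G :=
  Step.equ ⟨V, e, by rw [hF, hG]; exact tr_yank a b⟩

variable {a x b y c z d w : C}

/-- Composition in the Int-construction, where the middle negative object becomes feedback. -/
def comp (F : Loop (a ⊗ y) (b ⊗ x)) (G : Loop (b ⊗ z) (c ⊗ y)) : Loop (a ⊗ z) (c ⊗ x) where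
  obj := (F.obj ⊗ G.obj) ⊗ y
  arr :=
    (_ ◁ (β_ _ _).hom ≫ tensorμ _ _ _ _ ≫ _ ◁ swp _ _ _ ≫ (α_ _ _ _).inv) ≫
    F.arr ▷ (z ⊗ G.obj) ≫
    ((α_ _ _ _).hom ≫ _ ◁ swp _ _ _ ≫ tensorμ _ _ _ _ ≫
      _ ◁ ((α_ _ _ _).inv ≫ (β_ _ _).hom) ≫ (α_ _ _ _).inv) ≫
    G.arr ▷ (x ⊗ F.obj) ≫
    ((α_ _ _ _).hom ≫ _ ◁ swp _ _ _ ≫ tensorμ _ _ _ _ ≫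
      _ ◁ ((β_ _ _).hom ≫ (β_ _ _).hom ▷ y))

/-- `F` occurs once in the composite, surrounded by a context, so its trace can be taken there. The
isomorphism moves `V` to the end of the feedback. -/
theorem step_comp_left {F F' : Loop (a ⊗ y) (b ⊗ x)} (h : Step F F')
    (G : Loop (b ⊗ z) (c ⊗ y)) : Step (comp F G) (comp F' G) := by
  obtain ⟨V, e, h⟩ := h
  refine step_of_context h (whiskerRightIso (whiskerRightIso e _ ≪≫ mvIso _ _ _) _ ≪≫ mvIso _ _ _)
    (R := z ⊗ G.obj)
    ((_ ◁ (β_ _ _).hom ≫ tensorμ _ _ _ _ ≫ _ ◁ swp _ _ _ ≫ (α_ _ _ _).inv) ≫ (β_ _ _).hom)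
    ((β_ _ _).hom ≫ ((α_ _ _ _).hom ≫ _ ◁ swp _ _ _ ≫ tensorμ _ _ _ _ ≫
      _ ◁ ((α_ _ _ _).inv ≫ (β_ _ _).hom) ≫ (α_ _ _ _).inv) ≫
    G.arr ▷ (x ⊗ F'.obj) ≫
    ((α_ _ _ _).hom ≫ _ ◁ swp _ _ _ ≫ tensorμ _ _ _ _ ≫
      _ ◁ ((β_ _ _).hom ≫ (β_ _ _).hom ▷ y))) ?_ ?_
  · have := gen F'.arr 0; have := gen G.arr 1
    dsimp only [comp]
    exact solve
  · have := gen F.arr 0; have := gen G.arr 1; have := gen e.hom 2; have := gen e.inv 3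
    dsimp only [comp]
    exact solve

theorem step_comp_right (F : Loop (a ⊗ y) (b ⊗ x)) {G G' : Loop (b ⊗ z) (c ⊗ y)}
    (h : Step G G') : Step (comp F G) (comp F G') := by
  obtain ⟨V, e, h⟩ := h
  refine step_of_context h
    (whiskerRightIso (whiskerLeftIso _ e ≪≫ (α_ _ _ _).symm) _ ≪≫ mvIso _ _ _)
    (R := x ⊗ F.obj)
    ((_ ◁ (β_ _ _).hom ≫ tensorμ _ _ _ _ ≫ _ ◁ swp _ _ _ ≫ (α_ _ _ _).inv) ≫
    F.arr ▷ (z ⊗ G'.obj) ≫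
    ((α_ _ _ _).hom ≫ _ ◁ swp _ _ _ ≫ tensorμ _ _ _ _ ≫
      _ ◁ ((α_ _ _ _).inv ≫ (β_ _ _).hom) ≫ (α_ _ _ _).inv) ≫ (β_ _ _).hom)
    ((β_ _ _).hom ≫
    ((α_ _ _ _).hom ≫ _ ◁ swp _ _ _ ≫ tensorμ _ _ _ _ ≫
      _ ◁ ((β_ _ _).hom ≫ (β_ _ _).hom ▷ y))) ?_ ?_
  · have := gen F.arr 0; have := gen G'.arr 1
    dsimp only [comp]
    exact solve
  · have := gen F.arr 0; have := gen G.arr 1; have := gen e.hom 2; have := gen e.inv 3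
    dsimp only [comp]
    exact solve

theorem Equ.comp {F F' : Loop (a ⊗ y) (b ⊗ x)} (h : Equ F F') {G G' : Loop (b ⊗ z) (c ⊗ y)}
    (h' : Equ G G') : Equ (F.comp G) (F'.comp G') :=
  (h.map (Φ := fun F => F.comp G) fun _ _ h => step_comp_left h G).trans
    (h'.map (Φ := fun G => F'.comp G) fun _ _ h => step_comp_right F' h)

/-- No trace is evaluated: the two loops differ only in the order of their feedback objects. -/
theorem comp_assoc (F : Loop (a ⊗ y) (b ⊗ x)) (G : Loop (b ⊗ z) (c ⊗ y))
    (H : Loop (c ⊗ w) (d ⊗ z)) : Equ ((F.comp G).comp H) (F.comp (G.comp H)) := by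
  refine equ_of_iso (whiskerRightIso (mvIso _ _ _) z ≪≫ mvIso _ _ _ ≪≫
    whiskerRightIso (whiskerRightIso (α_ _ _ _) z ≪≫ α_ _ _ _) y) ?_
  have := gen F.arr 0; have := gen G.arr 1; have := gen H.arr 2
  dsimp only [comp]
  exact solve

/-- Composition with an identity adds the feedback `y`, which runs through nothing but a crossing
and is yanked. -/
theorem comp_one (F : Loop (a ⊗ y) (b ⊗ x)) : Equ (F.comp (single (𝟙 (b ⊗ y)))) F := by
  refine equ_of_yank (whiskerRightIso (ρ_ _) y) (R := a ⊗ F.obj)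
    (mvIso _ _ _).hom ((mvIso _ _ _).hom ≫ F.arr) ?_ ?_
  · have := gen F.arr 0
    exact solve
  · have := gen F.arr 0
    dsimp only [comp, single]
    exact solve

theorem one_comp (F : Loop (a ⊗ y) (b ⊗ x)) : Equ ((single (𝟙 (a ⊗ x))).comp F) F := by
  refine equ_of_yank (whiskerRightIso (λ_ _) x) (R := b ⊗ F.obj)
    (F.arr ≫ (mvIso _ _ _).hom) ((mvIso _ _ _).hom) ?_ ?_
  · have := gen F.arr 0
    exact solve
  · have := gen F.arr 0
    dsimp only [comp, single]
    exact solve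

/-- Tensor product in the Int-construction. -/
def tensor {a' x' b' y' : C} (F : Loop (a ⊗ x') (a' ⊗ x)) (G : Loop (b ⊗ y') (b' ⊗ y)) :
    Loop ((a ⊗ b) ⊗ (y' ⊗ x')) ((a' ⊗ b') ⊗ (y ⊗ x)) where
  obj := F.obj ⊗ G.obj
  arr :=
    (_ ◁ (β_ _ _).hom ≫ tensorμ _ _ _ _) ▷ _ ≫ tensorμ _ _ _ _ ≫ (F.arr ⊗ₘ G.arr) ≫
      tensorμ _ _ _ _ ≫ (tensorμ _ _ _ _ ≫ _ ◁ (β_ _ _).hom) ▷ _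

variable {a' x' b' y' c' z' : C}

theorem step_tensor_left {F F' : Loop (a ⊗ x') (a' ⊗ x)} (h : Step F F')
    (G : Loop (b ⊗ y') (b' ⊗ y)) : Step (tensor F G) (tensor F' G) := by
  obtain ⟨V, e, h⟩ := h
  refine step_of_context h (whiskerRightIso e _ ≪≫ mvIso _ _ _)
    (R := (b' ⊗ y) ⊗ G.obj)
    (((_ ◁ (β_ _ _).hom ≫ tensorμ _ _ _ _) ▷ _ ≫ tensorμ _ _ _ _ ≫ _ ◁ G.arr) ≫ (β_ _ _).hom)
    ((β_ _ _).hom ≫ tensorμ _ _ _ _ ≫ (tensorμ _ _ _ _ ≫ _ ◁ (β_ _ _).hom) ▷ _) ?_ ?_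
  · have := gen F'.arr 0; have := gen G.arr 1
    dsimp only [tensor]
    exact solve
  · have := gen F.arr 0; have := gen G.arr 1; have := gen e.hom 2; have := gen e.inv 3
    dsimp only [tensor]
    exact solve

theorem step_tensor_right (F : Loop (a ⊗ x') (a' ⊗ x)) {G G' : Loop (b ⊗ y') (b' ⊗ y)}
    (h : Step G G') : Step (tensor F G) (tensor F G') := by
  obtain ⟨V, e, h⟩ := h
  refine step_of_context h (whiskerLeftIso _ e ≪≫ (α_ _ _ _).symm)
    (R := (a' ⊗ x) ⊗ F.obj)
    ((_ ◁ (β_ _ _).hom ≫ tensorμ _ _ _ _) ▷ _ ≫ tensorμ _ _ _ _ ≫ F.arr ▷ _)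
    (tensorμ _ _ _ _ ≫ (tensorμ _ _ _ _ ≫ _ ◁ (β_ _ _).hom) ▷ _) ?_ ?_
  · have := gen F.arr 0; have := gen G'.arr 1
    dsimp only [tensor]
    exact solve
  · have := gen F.arr 0; have := gen G.arr 1; have := gen e.hom 2; have := gen e.inv 3
    dsimp only [tensor]
    exact solve

theorem Equ.tensor {F F' : Loop (a ⊗ x') (a' ⊗ x)} (h : Equ F F')
    {G G' : Loop (b ⊗ y') (b' ⊗ y)} (h' : Equ G G') : Equ (F.tensor G) (F'.tensor G') :=
  (h.map (Φ := fun F => F.tensor G) fun _ _ h => step_tensor_left h G).trans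
    (h'.map (Φ := fun G => F'.tensor G) fun _ _ h => step_tensor_right F' h)

/-- The interchange law also needs only a rearrangement of the feedback. -/
theorem tensor_comp (F : Loop (a ⊗ x') (a' ⊗ x)) (G : Loop (b ⊗ y') (b' ⊗ y))
    (F' : Loop (a' ⊗ z) (c ⊗ x')) (G' : Loop (b' ⊗ z') (c' ⊗ y')) :
    Equ ((F.tensor G).comp (F'.tensor G')) ((F.comp F').tensor (G.comp G')) := by
  refine equ_of_iso (whiskerRightIso (α_ _ _ _ ≪≫ whiskerLeftIso _ ((α_ _ _ _).symm ≪≫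
    whiskerRightIso (β_ _ _) _ ≪≫ α_ _ _ _) ≪≫ (α_ _ _ _).symm) _ ≪≫ whiskerLeftIso _ (β_ _ _) ≪≫
    α_ _ _ _ ≪≫ whiskerLeftIso _ ((α_ _ _ _).symm ≪≫
    whiskerRightIso (β_ _ _) _ ≪≫ α_ _ _ _) ≪≫ (α_ _ _ _).symm) ?_
  have := gen F.arr 0; have := gen G.arr 1; have := gen F'.arr 2; have := gen G'.arr 3
  dsimp only [comp, tensor]
  exact solve

end Loop

/-! ### Partial composition of paths in terms of loops -/

namespace IntP

/-- The arrow whose trace is the composite of a path. -/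
def loop {X Y : IntP C} (p : Path X Y) : Loop (X.pos ⊗ Y.neg) (Y.pos ⊗ X.neg) :=
  ⟨negs p, (α_ _ _ _).hom ≫ X.pos ◁ (β_ _ _).hom ≫ pre p ≫ (α_ _ _ _).inv⟩

theorem mem_pcomp {X Y : IntP C} {p : Path X Y} {f : IntP.Hom X Y} :
    f ∈ pcomp p ↔ Loop.Equ (loop p) (.single f.arr) := by
  rw [← Loop.mem_tr_iff, pcomp, Part.mem_map_iff]
  constructor
  · rintro ⟨t, ht, rfl⟩; exact ht
  · intro h; exact ⟨_, h, rfl⟩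

theorem loop_nil (X : IntP C) : Loop.Equ (loop (Path.nil : Path X X)) (.single (𝟙 _)) := by
  refine Loop.equ_of_iso (Iso.refl (𝟙_ C)) ?_
  dsimp only [loop, Loop.single, negs, pre, Iso.refl_hom, Iso.refl_inv]
  exact solve

theorem loop_cons {X Y Z : IntP C} (p : Path X Y) (e : Y ⟶ Z) :
    Loop.Equ (loop (p ▹ e)) ((loop p).comp (.single (IntP.Hom.arr e))) := by
  refine Loop.equ_of_iso (whiskerRightIso (ρ_ (negs p)).symm Y.neg) ?_
  have := gen (pre p) 0; have := gen (IntP.Hom.arr e) 1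
  dsimp only [loop, Loop.comp, Loop.single, negs, pre]
  exact solve

theorem loop_comp {X Y Z : IntP C} (p : Path X Y) (q : Path Y Z) :
    Loop.Equ (loop (p.comp q)) ((loop p).comp (loop q)) := by
  induction q with
  | nil => exact (((Loop.Equ.refl _).comp (loop_nil Y)).trans (Loop.comp_one _)).symm
  | cons q e ih =>
    refine (loop_cons _ _).trans ((ih.comp (.refl _)).trans ((Loop.comp_assoc _ _ _).trans ?_))
    exact (Loop.Equ.refl _).comp (loop_cons _ _).symm

theorem pcomp_nil (X : IntP C) :
    pcomp (Path.nil : Path X X) = Part.some (⟨𝟙 _⟩ : IntP.Hom X X) :=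
  Part.eq_some_iff.2 (mem_pcomp.2 (loop_nil X))

theorem loop_single {X Y : IntP C} (f : X ⟶ Y) :
    Loop.Equ (loop (Path.nil ▹ f)) (.single (IntP.Hom.arr f)) :=
  (loop_cons _ _).trans (((loop_nil X).comp (.refl _)).trans (Loop.one_comp _))

theorem pcomp_single {X Y : IntP C} (f : X ⟶ Y) : pcomp (Path.nil ▹ f) = Part.some f :=
  Part.eq_some_iff.2 (mem_pcomp.2 (loop_single f))

theorem pcomp_congr {X Y : IntP C} {p q : Path X Y} (h : Loop.Equ (loop p) (loop q)) :
    pcomp p = pcomp q := by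
  ext f
  rw [mem_pcomp, mem_pcomp]
  exact ⟨fun h' => h.symm.trans h', fun h' => h.trans h'⟩

/-- That `p` has composite `f` means that its loop is equivalent to `f`; congruence of composition
puts this into the context of `r` and `s`. Whether the long path has a composite is irrelevant. -/
theorem pcomp_subpath {X Y Y' X' : IntP C} (r : Path X Y) (p : Path Y Y') (s : Path Y' X')
    (f : Y ⟶ Y') (h : f ∈ pcomp p) : pcomp ((r ▹ f).comp s) = pcomp ((r.comp p).comp s) := by
  refine pcomp_congr ((loop_comp _ _).trans (.trans (.comp ?_ (.refl _)) (loop_comp _ _).symm))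
  refine (loop_cons _ _).trans (.trans (.comp (.refl _) ?_) (loop_comp _ _).symm)
  exact (mem_pcomp.1 h).symm

theorem single_tensor {X X' Y Y' : IntP C} (f : IntP.Hom X X') (g : IntP.Hom Y Y') :
    Loop.Equ ((Loop.single f.arr).tensor (Loop.single g.arr)) (.single (tensorArr f g)) := by
  refine Loop.equ_of_iso (λ_ (𝟙_ C)) ?_
  have := gen f.arr 0; have := gen g.arr 1
  dsimp only [Loop.tensor, Loop.single, tensorArr]
  exact solve

theorem tensorArr_one (X Y : IntP C) :
    tensorArr (⟨𝟙 _⟩ : IntP.Hom X X) (⟨𝟙 _⟩ : IntP.Hom Y Y) = 𝟙 _ := by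
  dsimp only [tensorArr]
  exact solve

variable [IsStrictMonoidal C]

instance : IsParacategory (IntP C) where
  comp_nil := pcomp_nil
  comp_single := pcomp_single
  comp_subpath := pcomp_subpath

theorem loop_tensor {X Y : ProdPara (IntP C) (IntP C)} (p : Path X Y) :
    Loop.Equ (loop ((tensorPre (IntP C)).mapPath p))
      ((loop ((ProdPara.fstPre _ _).mapPath p)).tensor
        (loop ((ProdPara.sndPre _ _).mapPath p))) := by
  induction p with
  | nil =>
    refine (loop_nil _).trans (.trans ?_ ((loop_nil _).tensor (loop_nil _)).symm)
    refine .trans ?_ (single_tensor (X := X.fst) (X' := X.fst) (Y := X.snd) (Y' := X.snd)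
      ⟨𝟙 _⟩ ⟨𝟙 _⟩).symm
    rw [tensorArr_one]
    exact .refl _
  | cons p e ih =>
    refine (loop_cons _ _).trans (.trans ?_ ((loop_cons _ _).tensor (loop_cons _ _)).symm)
    refine (ih.comp ?_).trans (Loop.tensor_comp _ _ _ _)
    exact (single_tensor _ _).symm

/-- Definedness of both components allows each factor of the tensor product of loops to be replaced
by a single arrow. -/
theorem tensor_isParaFunctor : IsParaFunctor (tensorPre (IntP C)) := by
  intro A B p h hh
  obtain ⟨⟨f, g⟩, hfg, rfl⟩ := (Part.mem_map_iff _).1 hh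
  obtain ⟨f', hf, hg⟩ := Part.mem_bind_iff.1 hfg
  obtain ⟨g', hg, h2⟩ := (Part.mem_map_iff _).1 hg
  cases h2
  exact mem_pcomp.2 ((loop_tensor p).trans
    (((mem_pcomp.1 hf).tensor (mem_pcomp.1 hg)).trans (single_tensor _ _)))

end IntP

end Para

set_option synthInstance.maxSize 100000
set_option synthInstance.maxHeartbeats 1000000

namespace Para

open Wiring PartialTrace

/-! ### The axioms for the partial Int-construction -/

section paracategory

open ParacategoryStruct

variable {D : Type u} [ParacategoryStruct.{v} D] [IsParacategory D]

theorem comp_cons_of_mem {A B E : D} {p : Path A B} {f : A ⟶ B} (h : f ∈ comp p) (g : B ⟶ E) :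
    comp (p ▹ g) = comp (Path.nil ▹ f ▹ g) := by
  have := IsParacategory.comp_subpath Path.nil p (Path.nil ▹ g) f h
  rw [Path.nil_comp] at this
  exact this.symm

end paracategory

variable {C : Type u} [Category.{v} C] [MonoidalCategory C] [SymmetricCategory C] [PartialTrace C]

namespace Loop

variable {a b c x y z P Q : C}

/-- An arrow that is a tensor product of a positive and a negative part does not connect the
feedback to itself, so the feedback is yanked and the composite is always defined. Identities,
associators and symmetries are of this kind. -/
theorem single_str_comp (s : a ⟶ b) (t : y ⟶ x) (f : b ⊗ z ⟶ c ⊗ y) :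
    Equ ((single (s ⊗ₘ t) : Loop (a ⊗ y) (b ⊗ x)).comp (single f))
      (single (s ▷ z ≫ f ≫ c ◁ t)) := by
  refine equ_of_yank (whiskerRightIso (λ_ _) y) (R := c ⊗ 𝟙_ C)
    ((s ▷ z ≫ f) ▷ _ ≫ (mvIso _ _ _).hom) ((mvIso _ _ _).hom ≫ (_ ◁ t) ▷ _) ?_ ?_
  · have := gen s 0; have := gen t 1; have := gen f 2
    dsimp only [single]
    exact solve
  · have := gen s 0; have := gen t 1; have := gen f 2
    dsimp only [single, comp]
    exact solve

theorem single_comp_str (f : a ⊗ y ⟶ b ⊗ x) (s : b ⟶ c) (t : z ⟶ y) :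
    Equ ((single f).comp (single (s ⊗ₘ t) : Loop (b ⊗ z) (c ⊗ y)))
      (single (a ◁ t ≫ f ≫ s ▷ x)) := by
  refine equ_of_yank (whiskerRightIso (λ_ _) y) (R := a ⊗ 𝟙_ C)
    ((a ◁ t) ▷ _ ≫ (mvIso _ _ _).hom) ((mvIso _ _ _).hom ≫ (f ≫ s ▷ x) ▷ _) ?_ ?_
  · have := gen s 0; have := gen t 1; have := gen f 2
    dsimp only [single]
    exact solve
  · have := gen s 0; have := gen t 1; have := gen f 2
    dsimp only [single, comp]
    exact solve

/-- Two loops, one before and one after `m`, are yanked. -/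
theorem equ_of_yank₂ {F G : Loop P Q} {R R' V V' : C} (e : F.obj ≅ (G.obj ⊗ V) ⊗ V')
    (k : P ⊗ G.obj ⟶ R ⊗ V) (m : R ⊗ V ⟶ R' ⊗ V') (l : R' ⊗ V' ⟶ Q ⊗ G.obj)
    (hG : G.arr = k ≫ m ≫ l)
    (hF : (α_ _ _ _).hom ≫ P ◁ e.inv ≫ F.arr ≫ Q ◁ e.hom ≫ (α_ _ _ _).inv =
      ((α_ _ _ _).inv ≫ k ▷ V ≫ (mvIso _ _ _).hom ≫ m ▷ V ≫ (mvIso _ _ _).hom) ▷ V' ≫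
      (mvIso _ _ _).hom ≫ ((mvIso _ _ _).hom ≫ l ▷ V ≫ (α_ _ _ _).hom) ▷ V') : Equ F G := by
  refine Equ.trans (G := ⟨G.obj ⊗ V, (α_ _ _ _).inv ≫ k ▷ V ≫ (mvIso _ _ _).hom ≫ m ▷ V ≫
    l ▷ V ≫ (α_ _ _ _).hom⟩) ?_ ?_
  · refine equ_of_yank e (R := R' ⊗ V)
      ((α_ _ _ _).inv ≫ k ▷ V ≫ (mvIso _ _ _).hom ≫ m ▷ V ≫ (mvIso _ _ _).hom)
      ((mvIso _ _ _).hom ≫ l ▷ V ≫ (α_ _ _ _).hom) ?_ ?_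
    · have := gen k 0; have := gen m 1; have := gen l 2
      exact solve
    · rw [hF]
      have := gen k 0; have := gen m 1; have := gen l 2
      exact solve
  · refine equ_of_yank (Iso.refl _) (R := R) k (m ≫ l) hG ?_
    have := gen k 0; have := gen m 1; have := gen l 2
    dsimp only [Iso.refl_hom, Iso.refl_inv]
    exact solve

end Loop

namespace IntP

open ParacategoryStruct MonoidalParaStruct CompactClosedParaStruct

theorem eqToHom_assoc_symm [IsStrictMonoidal C] (X Y Z : C) (h : X ⊗ (Y ⊗ Z) = (X ⊗ Y) ⊗ Z) :
    eqToHom h = (α_ X Y Z).inv := by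
  rw [← cancel_epi (α_ X Y Z).hom, Iso.hom_inv_id, IsStrictMonoidal.associator_eq, eqToHom_trans,
    eqToHom_refl]

theorem eqToHom_unit_symm [IsStrictMonoidal C] (X : C) (h : X = 𝟙_ C ⊗ X) :
    eqToHom h = (λ_ X).inv := by
  rw [← cancel_epi (λ_ X).hom, Iso.hom_inv_id, IsStrictMonoidal.leftUnitor_eq, eqToHom_trans,
    eqToHom_refl]

theorem eqToHom_tensor_unit_symm [IsStrictMonoidal C] (X : C) (h : X = X ⊗ 𝟙_ C) :
    eqToHom h = (ρ_ X).inv := by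
  rw [← cancel_epi (ρ_ X).hom, Iso.hom_inv_id, IsStrictMonoidal.rightUnitor_eq, eqToHom_trans,
    eqToHom_refl]

/-- The arrow given by an arrow of positive parts and an arrow of negative parts. -/
def str {X Y : IntP C} (s : X.pos ⟶ Y.pos) (t : Y.neg ⟶ X.neg) : X ⟶ Y := IntP.Hom.mk (s ⊗ₘ t)

variable [IsStrictMonoidal C]

theorem comp_str_left {X Y Z : IntP C} (s : X.pos ⟶ Y.pos) (t : Y.neg ⟶ X.neg) (f : Y ⟶ Z) :
    comp (Path.nil ▹ str s t ▹ f) =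
      Part.some (IntP.Hom.mk (s ▷ _ ≫ IntP.Hom.arr f ≫ _ ◁ t) : X ⟶ Z) :=
  Part.eq_some_iff.2 (mem_pcomp.2 ((loop_cons _ _).trans
    (((loop_single _).comp (.refl _)).trans (Loop.single_str_comp s t (IntP.Hom.arr f)))))

theorem comp_str_right {X Y Z : IntP C} (f : X ⟶ Y) (s : Y.pos ⟶ Z.pos) (t : Z.neg ⟶ Y.neg) :
    comp (Path.nil ▹ f ▹ str s t) =
      Part.some (IntP.Hom.mk (_ ◁ t ≫ IntP.Hom.arr f ≫ s ▷ _) : X ⟶ Z) :=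
  Part.eq_some_iff.2 (mem_pcomp.2 ((loop_cons _ _).trans
    (((loop_single _).comp (.refl _)).trans (Loop.single_comp_str (IntP.Hom.arr f) s t))))

theorem one_eq (X : IntP C) : one X = str (𝟙 _) (𝟙 _) :=
  IntP.Hom.ext (id_tensorHom_id _ _).symm

theorem eqArrow_eq {X Y : IntP C} (h : X = Y) :
    eqArrow h = str (eqToHom (congrArg pos h)) (eqToHom (congrArg neg h.symm)) := by
  subst h
  exact one_eq X

theorem tHom_str {X X' Y Y' : IntP C} (s : X.pos ⟶ X'.pos) (t : X'.neg ⟶ X.neg)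
    (s' : Y.pos ⟶ Y'.pos) (t' : Y'.neg ⟶ Y.neg) :
    str s t ⊠ₘ str s' t' = (str (s ⊗ₘ s') (t' ⊗ₘ t) : X ⊠ Y ⟶ X' ⊠ Y') := by
  refine IntP.Hom.ext ?_
  change tensorArr _ _ = _
  dsimp only [tensorArr, str]
  have := gen s 0; have := gen t 1; have := gen s' 2; have := gen t' 3
  exact solve

theorem symm_eq (X Y : IntP C) : (symm X Y : X ⊠ Y ⟶ Y ⊠ X) = str (β_ _ _).hom (β_ _ _).hom := rfl

theorem asc_eq (X Y Z : IntP C) : asc X Y Z = str (α_ _ _ _).hom (α_ _ _ _).hom := by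
  rw [asc, eqArrow_eq, IsStrictMonoidal.associator_eq, IsStrictMonoidal.associator_eq]

theorem ascInv_eq (X Y Z : IntP C) : ascInv X Y Z = str (α_ _ _ _).inv (α_ _ _ _).inv := by
  rw [ascInv, eqArrow_eq, ← eqToHom_assoc_symm, ← eqToHom_assoc_symm]

theorem lun_eq (X : IntP C) : lun X = str (λ_ _).hom (ρ_ _).inv := by
  rw [lun, eqArrow_eq, IsStrictMonoidal.leftUnitor_eq, ← eqToHom_tensor_unit_symm]

theorem lunInv_eq (X : IntP C) : lunInv X = str (λ_ _).inv (ρ_ _).hom := by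
  rw [lunInv, eqArrow_eq, IsStrictMonoidal.rightUnitor_eq, ← eqToHom_unit_symm]

theorem run_eq (X : IntP C) : run X = str (ρ_ _).hom (λ_ _).inv := by
  rw [run, eqArrow_eq, IsStrictMonoidal.rightUnitor_eq, ← eqToHom_unit_symm]

theorem runInv_eq (X : IntP C) : runInv X = str (ρ_ _).inv (λ_ _).hom := by
  rw [runInv, eqArrow_eq, IsStrictMonoidal.leftUnitor_eq, ← eqToHom_tensor_unit_symm]

/-- Strictness of the tensor product is a heterogeneous equality. In this form it becomes an
equation in `C` whose `eqToHom` arrows are associators and unitors, so that `solve` applies. -/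
theorem heq_of_arr {X X' Y Y' : IntP C} (hX : X = X') (hY : Y = Y') (f : X ⟶ Y) (g : X' ⟶ Y')
    (h : IntP.Hom.arr f ≫ (eqToHom (congrArg pos hY) ⊗ₘ eqToHom (congrArg neg hX)) =
      (eqToHom (congrArg pos hX) ⊗ₘ eqToHom (congrArg neg hY)) ≫ IntP.Hom.arr g) : HEq f g := by
  subst hX hY
  refine heq_of_eq (IntP.Hom.ext ?_)
  simpa using h

theorem tHom_assoc {A A' B B' E E' : IntP C} (f : A ⟶ A') (g : B ⟶ B') (h : E ⟶ E') :
    HEq ((f ⊠ₘ g) ⊠ₘ h) (f ⊠ₘ (g ⊠ₘ h)) := by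
  refine heq_of_arr (tObj_assoc _ _ _) (tObj_assoc _ _ _) _ _ ?_
  rw [eqToHom_assoc_symm, eqToHom_assoc_symm, ← IsStrictMonoidal.associator_eq,
    ← IsStrictMonoidal.associator_eq]
  change tensorArr (X := ⟨_, _⟩) (X' := ⟨_, _⟩) ⟨tensorArr f g⟩ h ≫ _ =
    _ ≫ tensorArr (Y := ⟨_, _⟩) (Y' := ⟨_, _⟩) f ⟨tensorArr g h⟩
  have := gen (IntP.Hom.arr f) 0; have := gen (IntP.Hom.arr g) 1; have := gen (IntP.Hom.arr h) 2
  dsimp only [tensorArr]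
  exact solve

theorem tHom_unit {A B : IntP C} (f : A ⟶ B) : HEq (f ⊠ₘ one (unit : IntP C)) f := by
  refine heq_of_arr (tObj_unit _) (tObj_unit _) _ _ ?_
  rw [← IsStrictMonoidal.rightUnitor_eq, ← IsStrictMonoidal.rightUnitor_eq,
    ← IsStrictMonoidal.leftUnitor_eq, ← IsStrictMonoidal.leftUnitor_eq]
  change tensorArr (Y := ⟨_, _⟩) (Y' := ⟨_, _⟩) f ⟨𝟙 _⟩ ≫ _ = _
  have := gen (IntP.Hom.arr f) 0
  dsimp only [tensorArr]
  exact solve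

theorem unit_tHom {A B : IntP C} (f : A ⟶ B) : HEq (one (unit : IntP C) ⊠ₘ f) f := by
  refine heq_of_arr (unit_tObj _) (unit_tObj _) _ _ ?_
  rw [← IsStrictMonoidal.rightUnitor_eq, ← IsStrictMonoidal.rightUnitor_eq,
    ← IsStrictMonoidal.leftUnitor_eq, ← IsStrictMonoidal.leftUnitor_eq]
  change tensorArr (X := ⟨_, _⟩) (X' := ⟨_, _⟩) ⟨𝟙 _⟩ f ≫ _ = _
  have := gen (IntP.Hom.arr f) 0
  dsimp only [tensorArr]
  exact solve

theorem symm_natural_left {A A' : IntP C} (f : A ⟶ A') (B : IntP C) :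
    comp (Path.nil ▹ (f ⊠ₘ one B) ▹ symm A' B) = comp (Path.nil ▹ symm A B ▹ (one B ⊠ₘ f)) := by
  rw [symm_eq, symm_eq, comp_str_left, comp_str_right]
  refine congrArg Part.some (IntP.Hom.ext ?_)
  change _ ◁ _ ≫ tensorArr f ⟨𝟙 _⟩ ≫ _ ▷ _ = _ ▷ _ ≫ tensorArr ⟨𝟙 _⟩ f ≫ _ ◁ _
  have := gen (IntP.Hom.arr f) 0
  dsimp only [tensorArr, tObj]
  exact solve

theorem symm_natural_right (A : IntP C) {B B' : IntP C} (g : B ⟶ B') :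
    comp (Path.nil ▹ (one A ⊠ₘ g) ▹ symm A B') = comp (Path.nil ▹ symm A B ▹ (g ⊠ₘ one A)) := by
  rw [symm_eq, symm_eq, comp_str_left, comp_str_right]
  refine congrArg Part.some (IntP.Hom.ext ?_)
  change _ ◁ _ ≫ tensorArr ⟨𝟙 _⟩ g ≫ _ ▷ _ = _ ▷ _ ≫ tensorArr g ⟨𝟙 _⟩ ≫ _ ◁ _
  have := gen (IntP.Hom.arr g) 0
  dsimp only [tensorArr, tObj]
  exact solve

theorem str_comp_str {X Y Z : IntP C} (s : X.pos ⟶ Y.pos) (t : Y.neg ⟶ X.neg)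
    (s' : Y.pos ⟶ Z.pos) (t' : Z.neg ⟶ Y.neg) :
    comp (Path.nil ▹ str s t ▹ str s' t') = Part.some (str (s ≫ s') (t' ≫ t)) := by
  rw [comp_str_left]
  refine congrArg Part.some (IntP.Hom.ext ?_)
  have := gen s 0; have := gen s' 1; have := gen t 2; have := gen t' 3
  dsimp only [str]
  exact solve

theorem comp_cons_str {X Y Z : IntP C} {p : Path X Y} {s : X.pos ⟶ Y.pos} {t : Y.neg ⟶ X.neg}
    (h : comp p = Part.some (str s t)) (s' : Y.pos ⟶ Z.pos) (t' : Z.neg ⟶ Y.neg) :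
    comp (p ▹ str s' t') = Part.some (str (s ≫ s') (t' ≫ t)) := by
  rw [comp_cons_of_mem (f := str s t) (by rw [h]; exact Part.mem_some _), str_comp_str]

theorem symm_symm (A B : IntP C) :
    comp (Path.nil ▹ symm A B ▹ symm B A) = Part.some (one (A ⊠ B)) := by
  rw [symm_eq, symm_eq, str_comp_str, one_eq]
  simp only [SymmetricCategory.symmetry]
  rfl

theorem hexagon (A B E : IntP C) :
    comp (Path.nil ▹ ascInv A B E ▹ (symm A B ⊠ₘ one E) ▹ asc B A E ▹ (one B ⊠ₘ symm A E) ▹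
      ascInv B E A) = Part.some (symm A (B ⊠ E)) := by
  simp only [asc_eq, ascInv_eq, symm_eq, one_eq, tHom_str]
  rw [comp_cons_str (comp_cons_str (comp_cons_str (str_comp_str _ _ _ _) _ _) _ _) _ _]
  refine congrArg Part.some (congrArg₂ str ?_ ?_)
  · dsimp only [tObj]
    exact solve
  · dsimp only [tObj]
    exact solve

instance : IsSymmMonoidalParacategory (IntP C) where
  tensor_functor := tensor_isParaFunctor
  tHom_assoc := tHom_assoc
  tHom_unit := tHom_unit
  unit_tHom := unit_tHom
  symm_total_left f := by
    rw [symm_eq, one_eq, tHom_str, comp_str_left]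
    trivial
  symm_total_right f := by
    rw [symm_eq, one_eq, tHom_str, comp_str_right]
    trivial
  symm_natural_left := symm_natural_left
  symm_natural_right := symm_natural_right
  symm_symm := symm_symm
  hexagon := hexagon

/-- A composite of two arrows whose feedback is yanked. -/
theorem comp_of_yank₂ {X Y Z : IntP C} (a : X ⟶ Y) (b : Y ⟶ Z) {R R' V V' : C}
    (e : Y.neg ≅ V ⊗ V') (k : X.pos ⊗ Z.neg ⟶ R ⊗ V) (m : R ⊗ V ⟶ R' ⊗ V')
    (l : R' ⊗ V' ⟶ Z.pos ⊗ X.neg)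
    (hF : (α_ _ _ _).hom ≫ X.pos ◁ (Z.neg ◁ e.inv ≫ (β_ _ _).hom) ≫ (α_ _ _ _).inv ≫
        IntP.Hom.arr a ▷ Z.neg ≫ (mvIso _ _ _).hom ≫ IntP.Hom.arr b ▷ X.neg ≫ (mvIso _ _ _).hom ≫
        _ ◁ e.hom =
      (α_ _ _ _).inv ≫ (k ▷ V ≫ (mvIso _ _ _).hom ≫ m ▷ V ≫ (mvIso _ _ _).hom) ▷ V' ≫
      (mvIso _ _ _).hom ≫ ((mvIso _ _ _).hom ≫ l ▷ V) ▷ V' ≫ (α_ _ _ _).hom) :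
    comp (Path.nil ▹ a ▹ b) = Part.some (IntP.Hom.mk (k ≫ m ≫ l) : X ⟶ Z) := by
  refine Part.eq_some_iff.2 (mem_pcomp.2 ((loop_cons _ _).trans
    (((loop_single _).comp (.refl _)).trans ?_)))
  refine Loop.equ_of_yank₂ (whiskerLeftIso _ e ≪≫ whiskerRightIso (λ_ _) _ ≪≫ (α_ _ _ _).symm)
    ((ρ_ _).hom ≫ k) m (l ≫ (ρ_ _).inv) ?_ ?_
  · have := gen k 0; have := gen l 1; have := gen m 2
    dsimp only [Loop.single]
    exact solve
  · have hF' := congrArg (fun t => (α_ _ _ _).hom ≫ _ ◁ ((α_ _ _ _).hom ≫ (λ_ _).hom) ≫ t ≫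
      _ ◁ ((λ_ _).inv ≫ (α_ _ _ _).inv) ≫ (α_ _ _ _).inv) hF
    refine Eq.trans ?_ (hF'.trans ?_)
    · have := gen (IntP.Hom.arr a) 0; have := gen (IntP.Hom.arr b) 1
      have := gen e.hom 2; have := gen e.inv 3
      dsimp only [Loop.comp, Loop.single]
      exact solve
    · have := gen k 0; have := gen l 1; have := gen m 2
      dsimp only [Loop.single]
      exact solve

end IntP
end Para

/-! ### Duals in the Int-construction -/

namespace Para

open Wiring PartialTrace

variable {C : Type u} [Category.{v} C] [MonoidalCategory C] [SymmetricCategory C] [PartialTrace C]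
  [IsStrictMonoidal C]

namespace IntP

open ParacategoryStruct MonoidalParaStruct CompactClosedParaStruct

/-- The unit is an identity of `C`, so the negative middle object splits into two factors that are
yanked before and after `f`. The explicit value, and not only its existence, is needed for the
zigzag identities and for bending; the three companions are analogous. -/
theorem comp_eta_right {A B E : IntP C} (f : A ⊠ dual E ⟶ B) :
    comp (Path.nil ▹ (one A ⊠ₘ eta E) ▹ ascInv A (dual E) E ▹ (f ⊠ₘ one E)) =
      Part.some (IntP.Hom.mk ((((ρ_ _).hom ⊗ₘ (β_ _ _).hom) ≫ (α_ _ _ _).inv) ≫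
        ((mvIso _ _ _).hom ≫ IntP.Hom.arr f) ≫ (α_ _ _ _).inv ≫ _ ◁ (λ_ _).inv) :
          A ⊠ unit ⟶ B ⊠ E) := by
  rw [ascInv_eq, comp_cons_of_mem (by rw [comp_str_right]; exact Part.mem_some _)]
  refine comp_of_yank₂ _ _ (Iso.refl _) _ _ _ ?_
  change _ ≫ _ ≫ _ ≫ (_ ◁ _ ≫ tensorArr ⟨𝟙 _⟩ (Y := ⟨_, _⟩) (Y' := ⟨_, _⟩)
      ⟨(λ_ _).hom ≫ (ρ_ _).inv⟩ ≫ _ ▷ _) ▷ _ ≫ _ ≫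
    (tensorArr (X := ⟨_, _⟩) f ⟨𝟙 _⟩) ▷ _ ≫ _ = _
  have := gen (IntP.Hom.arr f) 0
  dsimp only [tensorArr, Iso.refl_hom, Iso.refl_inv, tObj, dual, unit]
  exact solve

theorem comp_eps_right {A B E : IntP C} (g : A ⟶ B ⊠ E) :
    comp (Path.nil ▹ (g ⊠ₘ one (dual E)) ▹ asc B E (dual E) ▹ (one B ⊠ₘ eps E)) =
      Part.some (IntP.Hom.mk (((α_ _ _ _).hom ≫ _ ◁ _ ◁ (λ_ _).hom) ≫
        (IntP.Hom.arr g ≫ (mvIso _ _ _).hom) ≫ (α_ _ _ _).hom ≫ ((ρ_ _).inv ⊗ₘ (β_ _ _).hom)) :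
          A ⊠ dual E ⟶ B ⊠ unit) := by
  rw [asc_eq, comp_cons_of_mem (by rw [comp_str_right]; exact Part.mem_some _)]
  refine comp_of_yank₂ _ _ (α_ _ _ _ ≪≫ β_ _ _) _ _ _ ?_
  change _ ≫ _ ≫ _ ≫ (_ ◁ _ ≫ tensorArr (X' := ⟨_, _⟩) g (Y := ⟨_, _⟩) (Y' := ⟨_, _⟩)
      ⟨𝟙 _⟩ ≫ _ ▷ _) ▷ _ ≫ _ ≫
    (tensorArr ⟨𝟙 _⟩ (Y := ⟨_, _⟩) (Y' := ⟨_, _⟩) ⟨(ρ_ _).hom ≫ (λ_ _).inv⟩) ▷ _ ≫ _ = _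
  have := gen (IntP.Hom.arr g) 0
  dsimp only [tensorArr, Iso.refl_hom, Iso.refl_inv, tObj, dual, unit]
  exact solve

theorem comp_eta_left {A B E : IntP C} (h : A ⊠ B ⟶ E) :
    comp (Path.nil ▹ (eta A ⊠ₘ one B) ▹ asc (dual A) A B ▹ (one (dual A) ⊠ₘ h)) =
      Part.some (IntP.Hom.mk (((λ_ _).hom ▷ _ ≫ (α_ _ _ _).inv) ≫
        ((β_ _ _).hom ≫ (α_ _ _ _).inv ≫ IntP.Hom.arr h) ≫ (α_ _ _ _).inv ≫ (β_ _ _).hom ≫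
          (α_ _ _ _).inv ≫ _ ◁ (ρ_ _).inv) : unit ⊠ B ⟶ dual A ⊠ E) := by
  rw [asc_eq, comp_cons_of_mem (by rw [comp_str_right]; exact Part.mem_some _)]
  refine comp_of_yank₂ _ _ (β_ _ _) _ _ _ ?_
  change _ ≫ _ ≫ _ ≫ (_ ◁ _ ≫ tensorArr (X := ⟨_, _⟩) (X' := ⟨_, _⟩)
      ⟨(λ_ _).hom ≫ (ρ_ _).inv⟩ ⟨𝟙 _⟩ ≫ _ ▷ _) ▷ _ ≫ _ ≫
    (tensorArr (X := ⟨_, _⟩) (X' := ⟨_, _⟩) ⟨𝟙 _⟩ (Y := ⟨_, _⟩) h) ▷ _ ≫ _ = _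
  have := gen (IntP.Hom.arr h) 0
  dsimp only [tensorArr, Iso.refl_hom, Iso.refl_inv, tObj, dual, unit]
  exact solve

theorem comp_eps_left {A B E : IntP C} (k : B ⟶ dual A ⊠ E) :
    comp (Path.nil ▹ (one A ⊠ₘ k) ▹ ascInv A (dual A) E ▹ (eps A ⊠ₘ one E)) =
      Part.some (IntP.Hom.mk ((((β_ _ _).hom ⊗ₘ (ρ_ _).hom) ≫ (α_ _ _ _).hom ≫ _ ◁ (β_ _ _).hom) ≫
        (IntP.Hom.arr k ≫ (α_ _ _ _).hom ≫ (β_ _ _).hom) ≫ (α_ _ _ _).hom ≫ (λ_ _).inv ▷ _) :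
          A ⊠ B ⟶ unit ⊠ E) := by
  rw [ascInv_eq, comp_cons_of_mem (by rw [comp_str_right]; exact Part.mem_some _)]
  refine comp_of_yank₂ _ _ (α_ _ _ _).symm _ _ _ ?_
  change _ ≫ _ ≫ _ ≫ (_ ◁ _ ≫ tensorArr ⟨𝟙 _⟩ (Y' := ⟨_, _⟩) k ≫ _ ▷ _) ▷ _ ≫ _ ≫
    (tensorArr (X := ⟨_, _⟩) (X' := ⟨_, _⟩) ⟨(ρ_ _).hom ≫ (λ_ _).inv⟩ ⟨𝟙 _⟩) ▷ _ ≫ _ = _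
  have := gen (IntP.Hom.arr k) 0
  dsimp only [tensorArr, Iso.refl_hom, Iso.refl_inv, tObj, dual, unit]
  exact solve

/-- In the zigzag identities the unit identities flank a composite whose value is already known,
with a counit as its middle arrow. -/
theorem comp_between_str {W X Y Z : IntP C} {p : Path X Y} {f : X ⟶ Y} (h : comp p = Part.some f)
    (s : W.pos ⟶ X.pos) (t : X.neg ⟶ W.neg) (s' : Y.pos ⟶ Z.pos) (t' : Z.neg ⟶ Y.neg) :
    comp (((Path.nil ▹ str s t).comp p) ▹ str s' t') =
      Part.some (IntP.Hom.mk ((s ⊗ₘ t') ≫ IntP.Hom.arr f ≫ (s' ⊗ₘ t)) : W ⟶ Z) := by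
  have h1 := IsParacategory.comp_subpath (Path.nil ▹ str s t) p (Path.nil ▹ str s' t') f
    (by rw [h]; exact Part.mem_some _)
  refine h1.symm.trans ((comp_cons_of_mem (p := Path.nil ▹ str s t ▹ f)
    (by rw [comp_str_left]; exact Part.mem_some _) _).trans ?_)
  rw [comp_str_right]
  refine congrArg Part.some (IntP.Hom.ext ?_)
  have := gen (IntP.Hom.arr f) 0; have := gen s 1; have := gen t 2
  have := gen s' 3; have := gen t' 4
  exact solve

theorem zigzag (A : IntP C) :
    comp (Path.nil ▹ runInv A ▹ (one A ⊠ₘ eta A) ▹ ascInv A (dual A) A ▹ (eps A ⊠ₘ one A) ▹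
      lun A) = Part.some (one A) := by
  rw [runInv_eq, lun_eq]
  refine (comp_between_str (comp_eta_right (eps A)) _ _ _ _).trans ?_
  refine congrArg Part.some (IntP.Hom.ext ?_)
  change _ ≫ (_ ≫ (_ ≫ _ ≫ _) ≫ _) ≫ _ = 𝟙 _
  dsimp only [tObj, dual, unit]
  exact solve

theorem zigzag_dual (A : IntP C) :
    comp (Path.nil ▹ lunInv (dual A) ▹ (eta A ⊠ₘ one (dual A)) ▹ asc (dual A) A (dual A) ▹
      (one (dual A) ⊠ₘ eps A) ▹ run (dual A)) = Part.some (one (dual A)) := by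
  rw [lunInv_eq, run_eq]
  refine (comp_between_str (comp_eta_left (eps A)) _ _ _ _).trans ?_
  refine congrArg Part.some (IntP.Hom.ext ?_)
  change _ ≫ (_ ≫ (_ ≫ _ ≫ _ ≫ _) ≫ _) ≫ _ = 𝟙 _
  dsimp only [tObj, dual, unit]
  exact solve

instance : IsCompactClosedParacategory (IntP C) where
  eta_total_right f := by rw [comp_eta_right]; trivial
  eps_total_right f := by rw [comp_eps_right]; trivial
  eta_total_left f := by rw [comp_eta_left]; trivial
  eps_total_left f := by rw [comp_eps_left]; trivial
  zigzag := zigzag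
  zigzag_dual := zigzag_dual

end IntP
end Para

/-! ### The embedding of the base category -/

namespace Para

open Wiring PartialTrace

section paracategory

open ParacategoryStruct

variable {D : Type u} [ParacategoryStruct.{v} D] [IsParacategory D]

theorem comp_comp_of_mem {A B E : D} {p : Path A B} {f : A ⟶ B} (h : f ∈ comp p) {q : Path B E}
    {g : B ⟶ E} (h' : g ∈ comp q) : comp (p.comp q) = comp (Path.nil ▹ f ▹ g) :=
  (IsParacategory.comp_subpath p q Path.nil g h').symm.trans (comp_cons_of_mem h g)

end paracategory

variable {C : Type u} [Category.{v} C] [MonoidalCategory C] [SymmetricCategory C] [PartialTrace C]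
  [IsStrictMonoidal C]

namespace IntP

open ParacategoryStruct MonoidalParaStruct CompactClosedParaStruct

theorem isTotalIso_str {X Y : IntP C} (s : X.pos ≅ Y.pos) (t : Y.neg ≅ X.neg) :
    IsTotalIso (str s.hom t.hom) (str s.inv t.inv) where
  hom_inv := by rw [str_comp_str, s.hom_inv_id, t.inv_hom_id, ← one_eq]
  inv_hom := by rw [str_comp_str, s.inv_hom_id, t.hom_inv_id, ← one_eq]
  hom_total_left f := by rw [one_eq, tHom_str, comp_str_left]; trivial
  hom_total_right f := by rw [one_eq, tHom_str, comp_str_right]; trivial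
  inv_total_left f := by rw [one_eq, tHom_str, comp_str_left]; trivial
  inv_total_right f := by rw [one_eq, tHom_str, comp_str_right]; trivial

theorem embed_map {A B : C} (f : A ⟶ B) : (embed C).map f = str f (𝟙 (𝟙_ C)) :=
  IntP.Hom.ext (tensorHom_id _ _).symm

theorem embed_m (A B : C) : (embed C).m A B = str (𝟙 (A ⊗ B)) (ρ_ _).inv :=
  (eqArrow_eq _).trans (congrArg₂ str rfl (eqToHom_tensor_unit_symm _ _))

theorem embed_mInv (A B : C) : (embed C).mInv A B = str (𝟙 (A ⊗ B)) (ρ_ _).hom :=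
  (eqArrow_eq _).trans (congrArg₂ str rfl (IsStrictMonoidal.rightUnitor_eq _).symm)

theorem embed_mI : (embed C).mI = str (𝟙 (𝟙_ C)) (𝟙 (𝟙_ C)) := eqArrow_eq rfl

theorem embed_mIInv : (embed C).mIInv = str (𝟙 (𝟙_ C)) (𝟙 (𝟙_ C)) := eqArrow_eq rfl

theorem eqArrow_base {A B : C} (h : A = B) : eqArrow h = eqToHom h := by
  subst h
  rfl

theorem asc_base (A B E : C) : asc A B E = (α_ A B E).hom :=
  (eqArrow_base _).trans (IsStrictMonoidal.associator_eq _ _ _).symm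

theorem lun_base (A : C) : lun A = (λ_ A).hom :=
  (eqArrow_base _).trans (IsStrictMonoidal.leftUnitor_eq _).symm

theorem run_base (A : C) : run A = (ρ_ A).hom :=
  (eqArrow_base _).trans (IsStrictMonoidal.rightUnitor_eq _).symm

theorem tHom_of_eq_str {X X' Y Y' : IntP C} {f : X ⟶ X'} {g : Y ⟶ Y'} {s : X.pos ⟶ X'.pos}
    {t : X'.neg ⟶ X.neg} {s' : Y.pos ⟶ Y'.pos} {t' : Y'.neg ⟶ Y.neg} (hf : f = str s t)
    (hg : g = str s' t') : f ⊠ₘ g = str (s ⊗ₘ s') (t' ⊗ₘ t) := by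
  rw [hf, hg, tHom_str]

theorem comp_of_eq_str {X Y Z : IntP C} {f : X ⟶ Y} {g : Y ⟶ Z} {s : X.pos ⟶ Y.pos}
    {t : Y.neg ⟶ X.neg} {s' : Y.pos ⟶ Z.pos} {t' : Z.neg ⟶ Y.neg} (hf : f = str s t)
    (hg : g = str s' t') : comp (Path.nil ▹ f ▹ g) = Part.some (str (s ≫ s') (t' ≫ t)) := by
  rw [hf, hg, str_comp_str]

theorem comp_of_eq_str₃ {W X Y Z : IntP C} {f : X ⟶ Y} {g : Y ⟶ Z} {h : Z ⟶ W} {s : X.pos ⟶ Y.pos}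
    {t : Y.neg ⟶ X.neg} {s' : Y.pos ⟶ Z.pos} {t' : Z.neg ⟶ Y.neg} {s'' : Z.pos ⟶ W.pos}
    {t'' : W.neg ⟶ Z.neg} (hf : f = str s t) (hg : g = str s' t') (hh : h = str s'' t'') :
    comp (Path.nil ▹ f ▹ g ▹ h) = Part.some (str ((s ≫ s') ≫ s'') (t'' ≫ t' ≫ t)) := by
  rw [hf, hg, hh, comp_cons_str (str_comp_str _ _ _ _)]

theorem embed_functor : IsParaFunctor (embed C).toPrefunctor := by
  intro A B p
  change (Part.some _).map _ ≤ _
  rw [Part.map_some]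
  refine le_of_eq ?_
  rw [embed_map]
  induction p with
  | nil => exact (congrArg Part.some (one_eq _).symm).trans (IsParacategory.comp_nil _).symm
  | cons p e ih =>
    have := comp_cons_str (Z := (embed C).obj _) ih.symm e (𝟙 (𝟙_ C))
    rw [← embed_map] at this
    refine (congrArg Part.some (congrArg₂ str rfl ?_)).trans this.symm
    exact (Category.comp_id _).symm

theorem embed_isSymmMonoidal : (embed C).IsSymmMonoidal where
  functor := embed_functor
  m_total A B := by
    rw [embed_m, embed_mInv]
    exact isTotalIso_str (X := (embed C).obj A ⊠ (embed C).obj B) (Y := (embed C).obj (A ⊗ B))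
      (Iso.refl (A ⊗ B)) (ρ_ (𝟙_ C)).symm
  mI_total := by
    rw [embed_mI, embed_mIInv]
    exact isTotalIso_str (X := (unit : IntP C)) (Y := (unit : IntP C))
      (Iso.refl (𝟙_ C)) (Iso.refl (𝟙_ C))
  m_natural f g := by
    refine (comp_of_eq_str (tHom_of_eq_str (embed_map f) (embed_map g)) (embed_m _ _)).trans
      ((congrArg Part.some (congrArg₂ str ?_ ?_)).trans
        (comp_of_eq_str (embed_m _ _) (embed_map _)).symm)
    · exact (Category.comp_id _).trans (Category.id_comp _).symm
    · dsimp only [embed]; exact solve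
  m_assoc A B E := by
    refine (comp_of_eq_str₃ (tHom_of_eq_str (embed_m A B) (one_eq _)) (embed_m _ _)
      ((embed_map _).trans (congrArg₂ str (asc_base A B E) rfl))).trans
      ((congrArg Part.some (congrArg₂ str ?_ ?_)).trans
        (comp_of_eq_str₃ (asc_eq _ _ _) (tHom_of_eq_str (one_eq _) (embed_m _ _))
          (embed_m _ _)).symm)
    · dsimp only [embed, tObj]; exact solve
    · dsimp only [embed, tObj]; exact solve
  m_left_unit A := by
    refine (comp_of_eq_str₃ (tHom_of_eq_str embed_mI (one_eq _)) (embed_m _ _)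
      ((embed_map _).trans (congrArg₂ str (lun_base A) rfl))).trans
      ((congrArg Part.some (congrArg₂ str ?_ ?_)).trans (congrArg Part.some (lun_eq _).symm))
    · dsimp only [embed, tObj, unit]; exact solve
    · dsimp only [embed, tObj, unit]; exact solve
  m_right_unit A := by
    refine (comp_of_eq_str₃ (tHom_of_eq_str (one_eq _) embed_mI) (embed_m _ _)
      ((embed_map _).trans (congrArg₂ str (run_base A) rfl))).trans
      ((congrArg Part.some (congrArg₂ str ?_ ?_)).trans (congrArg Part.some (run_eq _).symm))
    · dsimp only [embed, tObj, unit]; exact solve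
    · dsimp only [embed, tObj, unit]; exact solve
  m_symm A B := by
    refine (comp_of_eq_str (embed_m _ _) (embed_map _)).trans
      ((congrArg Part.some (congrArg₂ str ?_ ?_)).trans
        (comp_of_eq_str (symm_eq _ _) (embed_m _ _)).symm)
    · exact (Category.id_comp _).trans (Category.comp_id _).symm
    · dsimp only [embed, tObj, unit]; exact solve

/-- The path that defines the trace is cut in front of `f ⊗ 1`. Each half has an explicit composite,
and the feedback between the halves is `U` up to units, so composing them amounts to taking the
given trace of `f`. -/
theorem embed_isTracePreserving : IsTracePreserving (embed C) := by
  intro A B U f g hg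
  rw [comp_of_eq_str₃ (embed_m A U) (embed_map f) (embed_mInv B U), Part.bind_some]
  let h : (embed C).obj A ⊠ (embed C).obj U ⟶ (embed C).obj B ⊠ (embed C).obj U :=
    str ((𝟙 (A ⊗ U) ≫ f) ≫ 𝟙 (B ⊗ U)) ((ρ_ (𝟙_ C)).hom ≫ 𝟙 (𝟙_ C) ≫ (ρ_ (𝟙_ C)).inv)
  have h1 : comp (Path.nil ▹ runInv ((embed C).obj A) ▹
      (one ((embed C).obj A) ⊠ₘ eta ((embed C).obj U)) ▹
      (one ((embed C).obj A) ⊠ₘ symm (dual ((embed C).obj U)) ((embed C).obj U)) ▹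
      ascInv _ _ _) = Part.some (IntP.Hom.mk ((A ◁ (U ◁ (λ_ (𝟙_ C)).hom ≫
        (ρ_ _).hom)) ≫ (ρ_ _).inv ≫ (ρ_ _).inv) :
          (embed C).obj A ⟶ ((embed C).obj A ⊠ (embed C).obj U) ⊠ dual ((embed C).obj U)) := by
    rw [runInv_eq, ascInv_eq, symm_eq, one_eq, tHom_str]
    rw [comp_cons_of_mem (by
      rw [comp_cons_of_mem (by rw [comp_str_left]; exact Part.mem_some _), comp_str_right]
      exact Part.mem_some _), comp_str_right]
    refine congrArg Part.some (IntP.Hom.ext ?_)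
    change _ ◁ _ ≫ (_ ◁ _ ≫ (_ ▷ _ ≫ (tensorArr (Y := ⟨_, _⟩) (Y' := ⟨_, _⟩) (str (𝟙 _) (𝟙 _))
      ⟨(λ_ _).hom ≫ (ρ_ _).inv⟩) ≫ _ ◁ _) ≫ _ ▷ _) ≫ _ ▷ _ = _
    dsimp only [tensorArr, embed, tObj, unit, dual, str]
    exact solve
  have h2 : comp (Path.nil ▹ (h ⊠ₘ one (dual ((embed C).obj U))) ▹ asc _ _ _ ▹
      (one ((embed C).obj B) ⊠ₘ eps ((embed C).obj U)) ▹ run _) = Part.some (IntP.Hom.mk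
        ((ρ_ _).hom ≫ (ρ_ _).hom ≫ f ≫ _ ◁ ((ρ_ _).inv ≫ _ ◁ (ρ_ _).inv)) :
          (_ ⊠ _) ⊠ _ ⟶ (embed C).obj B) := by
    rw [comp_cons_of_mem (by rw [comp_eps_right]; exact Part.mem_some _), run_eq, comp_str_right]
    refine congrArg Part.some (IntP.Hom.ext ?_)
    have := gen f 0
    dsimp only [h, embed, tObj, unit, dual, str]
    exact solve
  have h3 : ccTrace h = _ :=
    comp_comp_of_mem (Part.eq_some_iff.1 h1) (Part.eq_some_iff.1 h2)
  change _ ∈ ccTrace h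
  rw [h3]
  refine mem_pcomp.2 ((loop_cons _ _).trans
    (((loop_single _).comp (.refl _)).trans (Loop.Step.equ ?_)))
  -- The middle object has negative part `U ⊗ (I ⊗ I)`; the isomorphism discards the units.
  refine Loop.step_of_context hg (R := 𝟙_ C)
    (whiskerRightIso (λ_ _) _ ≪≫ whiskerLeftIso _ (whiskerLeftIso _ (ρ_ _) ≪≫ ρ_ _))
    ((ρ_ _).hom ≫ (β_ _ _).hom) ((λ_ _).hom ≫ (ρ_ _).inv ≫ (ρ_ _).inv) ?_ ?_
  · have := gen g 0
    dsimp only [Loop.single, embed]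
    exact solve
  · have := gen f 0
    dsimp only [Loop.single, Loop.comp, embed, tObj, unit, dual]
    exact solve

end IntP
end Para

/-! ### The enveloping category of a paracategory -/

namespace Para

open ParacategoryStruct

/-- Objects of the enveloping category of a paracategory. -/
structure Env (D : Type u) where
  of ::
  obj : D

namespace Env

section category

variable {D : Type u} [ParacategoryStruct.{v} D]

/-- Replacing a subpath by its composite. -/
inductive Rel : ∀ {A B : D}, Path A B → Path A B → Prop
  | mk {A B B' A' : D} (r : Path A B) (p : Path B B') (s : Path B' A') (f : B ⟶ B')
      (h : f ∈ comp p) : Rel ((r ▹ f).comp s) ((r.comp p).comp s)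

theorem Rel.comp_left {A B E : D} {p q : Path A B} (h : Rel p q) (s : Path B E) :
    Rel (p.comp s) (q.comp s) := by
  obtain ⟨r, p, s', f, h⟩ := h
  rw [Path.comp_assoc, Path.comp_assoc]
  exact ⟨r, p, _, f, h⟩

theorem Rel.comp_right {A B E : D} (r : Path A B) {p q : Path B E} (h : Rel p q) :
    Rel (r.comp p) (r.comp q) := by
  obtain ⟨r', p, s, f, h⟩ := h
  rw [← Path.comp_assoc, ← Path.comp_assoc, ← Path.comp_assoc]
  exact ⟨r.comp r', p, s, f, h⟩

theorem Rel.mapPath {D' : Type u'} [ParacategoryStruct.{v'} D'] {F : D ⥤q D'}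
    (hF : IsParaFunctor F) {A B : D} {p q : Path A B} (h : Rel p q) :
    Rel (F.mapPath p) (F.mapPath q) := by
  obtain ⟨r, p, s, f, h⟩ := h
  simp only [Prefunctor.mapPath_comp, Prefunctor.mapPath_cons]
  exact ⟨_, _, _, _, hF p _ (Part.mem_map _ h)⟩

/-- The enveloping category: paths modulo partial composition. -/
instance : Category.{max u v} (Env D) where
  Hom X Y := Quot (Rel (A := X.obj) (B := Y.obj))
  id X := Quot.mk _ Path.nil
  comp := Quot.map₂ Path.comp (fun r _ _ h => h.comp_right r) (fun _ _ s h => h.comp_left s)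
  id_comp := by rintro X Y ⟨p⟩; exact congrArg (Quot.mk _) (Path.nil_comp p)
  comp_id := by rintro X Y ⟨p⟩; rfl
  assoc := by rintro W X Y Z ⟨p⟩ ⟨q⟩ ⟨r⟩; exact congrArg (Quot.mk _) (Path.comp_assoc p q r)

/-- The class of a path. -/
def mk {A B : D} (p : Path A B) : Env.of A ⟶ Env.of B := Quot.mk _ p

/-- The class of an arrow. -/
def ι {A B : D} (f : A ⟶ B) : Env.of A ⟶ Env.of B := mk (Path.nil ▹ f)

theorem mk_nil (A : D) : mk (Path.nil : Path A A) = 𝟙 (Env.of A) := rfl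

theorem mk_cons {A B E : D} (p : Path A B) (f : B ⟶ E) : mk (p ▹ f) = mk p ≫ ι f := rfl

theorem hom_induction {P : ∀ {X Y : Env D}, (X ⟶ Y) → Prop} (nil : ∀ X : Env D, P (𝟙 X))
    (cons : ∀ {X Y : Env D} (x : X ⟶ Y) {B : D} (f : Y.obj ⟶ B), P x → P (x ≫ ι f))
    {X Y : Env D} (x : X ⟶ Y) : P x := by
  obtain ⟨p⟩ := x
  obtain ⟨X⟩ := X
  obtain ⟨Y⟩ := Y
  have h : ∀ {A B : D} (p : Path A B), P (mk p) := by
    intro A B p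
    induction p with
    | nil => exact nil _
    | cons p f ih => exact cons (mk p) f ih
  exact h p

theorem mk_eq_ι {A B : D} {p : Path A B} {f : A ⟶ B} (h : f ∈ comp p) : mk p = ι f := by
  have := Quot.sound (Rel.mk Path.nil p Path.nil f h)
  rw [Path.nil_comp] at this
  exact this.symm

variable [IsParacategory D]

/-- The arrow represented by an arrow of the envelope, if any. -/
def val {X Y : Env D} : (X ⟶ Y) → Part (X.obj ⟶ Y.obj) :=
  Quot.lift comp (by rintro _ _ ⟨r, p, s, f, h⟩; exact IsParacategory.comp_subpath r p s f h)

theorem val_ι {A B : D} (f : A ⟶ B) : val (ι f) = Part.some f := IsParacategory.comp_single f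

theorem comp_congr {A B : D} {p q : Path A B} (h : mk p = mk q) : comp p = comp q :=
  congrArg val h

/-- Since `val` is invariant under replacing subpaths and recovers an arrow from its class, passing
to the envelope identifies no distinct arrows and creates no new composites. -/
theorem comp_eq_some {A B : D} {p : Path A B} {f : A ⟶ B} : comp p = Part.some f ↔ mk p = ι f :=
  ⟨fun h => mk_eq_ι (Part.eq_some_iff.1 h), fun h => (congrArg val h).trans (val_ι f)⟩

theorem mem_comp {A B : D} {p : Path A B} {f : A ⟶ B} : f ∈ comp p ↔ mk p = ι f :=
  Part.eq_some_iff.symm.trans comp_eq_some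

theorem ι_injective {A B : D} {f g : A ⟶ B} (h : ι f = ι g) : f = g :=
  Part.some_injective ((val_ι f).symm.trans ((congrArg val h).trans (val_ι g)))

theorem ι_one (A : D) : ι (one A) = 𝟙 (Env.of A) :=
  (comp_eq_some.1 (IsParacategory.comp_nil A)).symm

theorem ι_eqArrow {A B : D} (h : A = B) : ι (eqArrow h) = eqToHom (congrArg Env.of h) := by
  subst h
  exact ι_one A

theorem ι_heq {A B A' B' : D} (hA : A = A') (hB : B = B') {f : A ⟶ B} {g : A' ⟶ B'} (h : HEq f g) :
    ι f ≫ eqToHom (congrArg Env.of hB) = eqToHom (congrArg Env.of hA) ≫ ι g := by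
  subst hA hB
  obtain rfl := eq_of_heq h
  simp

/-- Arrows of the envelope that are arrows of the paracategory. -/
def Rep {X Y : Env D} (x : X ⟶ Y) : Prop := ∃ f : X.obj ⟶ Y.obj, x = ι f

theorem Rep.congr {X Y : Env D} {x y : X ⟶ Y} (hx : Rep x) (h : x = y) : Rep y := h ▸ hx

theorem rep_ι {A B : D} (f : A ⟶ B) : Rep (ι f) := ⟨f, rfl⟩

theorem rep_id (X : Env D) : Rep (𝟙 X) := ⟨_, (ι_one X.obj).symm⟩

theorem rep_mk {A B : D} {p : Path A B} (h : (comp p).Dom) : Rep (mk p) :=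
  ⟨_, mk_eq_ι (Part.get_mem h)⟩

theorem dom_of_rep {A B : D} {p : Path A B} (h : Rep (mk p)) : (comp p).Dom := by
  obtain ⟨f, h⟩ := h
  rw [comp_eq_some.2 h]
  trivial

theorem rep_comp_eqToHom {X Y Z : Env D} {x : X ⟶ Y} (hx : Rep x) (h : Y = Z) :
    Rep (x ≫ eqToHom h) := by
  subst h
  simpa using hx

theorem rep_eqToHom_comp {X Y Z : Env D} {x : Y ⟶ Z} (hx : Rep x) (h : X = Y) :
    Rep (eqToHom h ≫ x) := by
  subst h
  simpa using hx

end category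

section functor

variable {D : Type u} [ParacategoryStruct.{v} D] {D' : Type u'} [ParacategoryStruct.{v'} D']

/-- The functor between envelopes induced by a functor of paracategories. -/
def map (F : D ⥤q D') (hF : IsParaFunctor F) : Env D ⥤ Env D' where
  obj X := .of (F.obj X.obj)
  map := Quot.map F.mapPath (fun _ _ h => h.mapPath hF)
  map_id _ := rfl
  map_comp := by
    rintro X Y Z ⟨p⟩ ⟨q⟩
    exact congrArg (Quot.mk _) (F.mapPath_comp p q)

end functor

/-! ### The symmetric monoidal structure of the envelope -/

section monoidal

open MonoidalParaStruct

variable {D : Type u} [MonoidalParaStruct.{v} D] [IsSymmMonoidalParacategory D]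

theorem comp_tensor {X Y : ProdPara D D} (p : Path X Y) {f : X.fst ⟶ Y.fst} {g : X.snd ⟶ Y.snd}
    (hf : f ∈ comp ((ProdPara.fstPre D D).mapPath p))
    (hg : g ∈ comp ((ProdPara.sndPre D D).mapPath p)) :
    mk ((tensorPre D).mapPath p) = ι (f ⊠ₘ g) :=
  mk_eq_ι (IsSymmMonoidalParacategory.tensor_functor p _
    (Part.mem_map_iff _ |>.2 ⟨(f, g), Part.mem_bind_iff.2 ⟨f, hf, Part.mem_map _ hg⟩, rfl⟩))

theorem one_tHom_one (A B : D) : one A ⊠ₘ one B = one (A ⊠ B) := by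
  refine ι_injective ((comp_tensor (X := ⟨A, B⟩) Path.nil ?_ ?_).symm.trans (ι_one _).symm)
  · exact Part.eq_some_iff.1 (IsParacategory.comp_nil _)
  · exact Part.eq_some_iff.1 (IsParacategory.comp_nil _)

theorem ι_tHom_comp {A B E A' B' E' : D} {f : A ⟶ B} {g : B ⟶ E} {h : A ⟶ E} {f' : A' ⟶ B'}
    {g' : B' ⟶ E'} {h' : A' ⟶ E'} (e : ι f ≫ ι g = ι h) (e' : ι f' ≫ ι g' = ι h') :
    ι (f ⊠ₘ f') ≫ ι (g ⊠ₘ g') = ι (h ⊠ₘ h') :=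
  comp_tensor (X := ⟨A, A'⟩) (Y := ⟨E, E'⟩)
    ((Path.nil : Path (⟨A, A'⟩ : ProdPara D D) ⟨A, A'⟩).cons
      ((f, f') : (⟨A, A'⟩ : ProdPara D D) ⟶ ⟨B, B'⟩) |>.cons
      ((g, g') : (⟨B, B'⟩ : ProdPara D D) ⟶ ⟨E, E'⟩)) (mem_comp.2 e) (mem_comp.2 e')

/-- Tensoring with an object on the left. -/
def leftPre (A : D) : D ⥤q D where
  obj B := A ⊠ B
  map f := one A ⊠ₘ f

/-- Tensoring with an object on the right. -/
def rightPre (A : D) : D ⥤q D where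
  obj B := B ⊠ A
  map f := f ⊠ₘ one A

/-- The arrow `(1, f)` of the product. -/
def leftProd (A : D) : D ⥤q ProdPara D D where
  obj B := ⟨A, B⟩
  map f := (one A, f)

/-- The arrow `(f, 1)` of the product. -/
def rightProd (A : D) : D ⥤q ProdPara D D where
  obj B := ⟨B, A⟩
  map f := (f, one A)

theorem comp_mapPath_one {A : D} (F : D ⥤q D) (hA : ∀ B, F.obj B = A)
    (hF : ∀ {B E : D} (f : B ⟶ E), F.map f = eqArrow ((hA B).trans (hA E).symm)) {B E : D}
    (p : Path B E) : mk (F.mapPath p) = ι (eqArrow ((hA B).trans (hA E).symm)) := by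
  induction p with
  | nil => rw [ι_eqArrow]; rfl
  | cons p f ih =>
    rw [Prefunctor.mapPath_cons, mk_cons, ih, hF, ι_eqArrow, ι_eqArrow, ι_eqArrow, eqToHom_trans]

/-- The tensor functor is applied to the path of pairs `(1, fᵢ)`. Its first component consists of
identities, so the composite there is always defined. -/
theorem leftPre_functor (A : D) : IsParaFunctor (leftPre A) := by
  intro B E p f' hf'
  obtain ⟨f, hf, rfl⟩ := (Part.mem_map_iff _).1 hf'
  have h1 : (leftPre A).mapPath p = (tensorPre D).mapPath ((leftProd A).mapPath p) := by
    rw [← Prefunctor.mapPath_comp_apply]; rfl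
  have h2 : p = (ProdPara.sndPre D D).mapPath ((leftProd A).mapPath p) := by
    rw [← Prefunctor.mapPath_comp_apply]; exact (Prefunctor.mapPath_id p).symm
  rw [h1]
  refine mem_comp.2 (comp_tensor _ (f := one A) ?_ (by rwa [← h2]))
  rw [← Prefunctor.mapPath_comp_apply]
  exact mem_comp.2 (comp_mapPath_one (A := A) _ (fun _ => rfl) (fun _ => rfl) p)

theorem rightPre_functor (A : D) : IsParaFunctor (rightPre A) := by
  intro B E p f' hf'
  obtain ⟨f, hf, rfl⟩ := (Part.mem_map_iff _).1 hf'
  have h1 : (rightPre A).mapPath p = (tensorPre D).mapPath ((rightProd A).mapPath p) := by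
    rw [← Prefunctor.mapPath_comp_apply]; rfl
  have h2 : p = (ProdPara.fstPre D D).mapPath ((rightProd A).mapPath p) := by
    rw [← Prefunctor.mapPath_comp_apply]; exact (Prefunctor.mapPath_id p).symm
  rw [h1]
  refine mem_comp.2 (comp_tensor _ (g := one A) (by rwa [← h2]) ?_)
  rw [← Prefunctor.mapPath_comp_apply]
  exact mem_comp.2 (comp_mapPath_one (A := A) _ (fun _ => rfl) (fun _ => rfl) p)

/-- Tensoring with an object on the left, as a functor on the envelope. -/
def left (X : Env D) : Env D ⥤ Env D := map (leftPre X.obj) (leftPre_functor X.obj)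

/-- Tensoring with an object on the right, as a functor on the envelope. -/
def right (X : Env D) : Env D ⥤ Env D := map (rightPre X.obj) (rightPre_functor X.obj)

instance : MonoidalCategoryStruct (Env D) where
  tensorObj X Y := .of (X.obj ⊠ Y.obj)
  whiskerLeft X {_ _} y := (left X).map y
  whiskerRight x Y := (right Y).map x
  tensorHom {_ X' Y _} x y := (right Y).map x ≫ (left X').map y
  tensorUnit := .of unit
  associator X Y Z := eqToIso (congrArg Env.of (tObj_assoc X.obj Y.obj Z.obj))
  leftUnitor X := eqToIso (congrArg Env.of (unit_tObj X.obj))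
  rightUnitor X := eqToIso (congrArg Env.of (tObj_unit X.obj))

theorem associator_hom (X Y Z : Env D) :
    (α_ X Y Z).hom = eqToHom (congrArg Env.of (tObj_assoc X.obj Y.obj Z.obj)) := rfl

theorem leftUnitor_hom (X : Env D) :
    (λ_ X).hom = eqToHom (congrArg Env.of (unit_tObj X.obj)) := rfl

theorem rightUnitor_hom (X : Env D) :
    (ρ_ X).hom = eqToHom (congrArg Env.of (tObj_unit X.obj)) := rfl

theorem ι_asc (A B E : D) : ι (asc A B E) = (α_ (Env.of A) (.of B) (.of E)).hom := ι_eqArrow _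

theorem ι_ascInv (A B E : D) : ι (ascInv A B E) = (α_ (Env.of A) (.of B) (.of E)).inv := ι_eqArrow _

theorem ι_lun (A : D) : ι (lun A) = (λ_ (Env.of A)).hom := ι_eqArrow _

theorem ι_lunInv (A : D) : ι (lunInv A) = (λ_ (Env.of A)).inv := ι_eqArrow _

theorem ι_run (A : D) : ι (run A) = (ρ_ (Env.of A)).hom := ι_eqArrow _

theorem ι_runInv (A : D) : ι (runInv A) = (ρ_ (Env.of A)).inv := ι_eqArrow _

theorem ι_tHom {A A' B B' : D} (f : A ⟶ A') (g : B ⟶ B') : ι (f ⊠ₘ g) = ι f ⊗ₘ ι g :=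
  (ι_tHom_comp (by rw [ι_one, Category.comp_id]) (by rw [ι_one, Category.id_comp])).symm

theorem ι_one_tHom (A : D) {B B' : D} (g : B ⟶ B') : ι (one A ⊠ₘ g) = Env.of A ◁ ι g := rfl

theorem ι_tHom_one {A A' : D} (f : A ⟶ A') (B : D) : ι (f ⊠ₘ one B) = ι f ▷ Env.of B := rfl

theorem whiskerLeft_id' (X Y : Env D) : X ◁ 𝟙 Y = 𝟙 (X ⊗ Y) := (left X).map_id Y

theorem whiskerRight_id' (X Y : Env D) : 𝟙 X ▷ Y = 𝟙 (X ⊗ Y) := (right Y).map_id X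

theorem whiskerLeft_comp' (X : Env D) {Y Y' Y'' : Env D} (y : Y ⟶ Y') (y' : Y' ⟶ Y'') :
    X ◁ (y ≫ y') = X ◁ y ≫ X ◁ y' := (left X).map_comp y y'

theorem whiskerRight_comp' {X X' X'' : Env D} (x : X ⟶ X') (x' : X' ⟶ X'') (Y : Env D) :
    (x ≫ x') ▷ Y = x ▷ Y ≫ x' ▷ Y := (right Y).map_comp x x'

/-- Induction on both paths reduces to two single arrows, for which both sides are the class of `f
⊠ₘ g`. -/
theorem whisker_exchange' {X X' Y Y' : Env D} (x : X ⟶ X') (y : Y ⟶ Y') :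
    X ◁ y ≫ x ▷ Y' = x ▷ Y ≫ X' ◁ y := by
  induction x using hom_induction with
  | nil X =>
    rw [whiskerRight_id', whiskerRight_id', Category.id_comp, Category.comp_id]
  | cons x f ih =>
    rw [whiskerRight_comp', whiskerRight_comp', ← Category.assoc, ih, Category.assoc,
      Category.assoc]
    congr 1
    clear ih x
    induction y using hom_induction with
    | nil Y => rw [whiskerLeft_id', whiskerLeft_id', Category.id_comp, Category.comp_id]
    | cons y g ih' =>
      rw [whiskerLeft_comp', whiskerLeft_comp', Category.assoc, ← Category.assoc (ι f ▷ _), ← ih',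
        Category.assoc]
      congr 1
      refine Eq.trans (ι_tHom_comp ?_ ?_) (ι_tHom f g)
      · rw [ι_one, Category.id_comp]
      · rw [ι_one, Category.comp_id]

theorem whiskerLeft_eqToHom' (X : Env D) {Y Y' : Env D} (h : Y = Y') :
    X ◁ eqToHom h = eqToHom (congrArg (X ⊗ ·) h) := by
  subst h
  exact whiskerLeft_id' X Y

theorem eqToHom_whiskerRight' {X X' : Env D} (h : X = X') (Y : Env D) :
    eqToHom h ▷ Y = eqToHom (congrArg (· ⊗ Y) h) := by
  subst h
  exact whiskerRight_id' X Y

theorem associator_naturality_left' {X X' : Env D} (x : X ⟶ X') (Y Z : Env D) :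
    (x ▷ Y) ▷ Z ≫ (α_ X' Y Z).hom = (α_ X Y Z).hom ≫ x ▷ (Y ⊗ Z) := by
  induction x using hom_induction with
  | nil X => simp only [whiskerRight_id', Category.id_comp, Category.comp_id]
  | cons x f ih =>
    rw [whiskerRight_comp', whiskerRight_comp', Category.assoc, whiskerRight_comp',
      ← Category.assoc (α_ _ _ _).hom, ← ih, Category.assoc]
    congr 1
    have h := IsSymmMonoidalParacategory.tHom_assoc f (one Y.obj) (one Z.obj)
    rw [one_tHom_one] at h
    exact ι_heq (tObj_assoc _ _ _) (tObj_assoc _ _ _) h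

theorem associator_naturality_middle' (X : Env D) {Y Y' : Env D} (y : Y ⟶ Y') (Z : Env D) :
    (X ◁ y) ▷ Z ≫ (α_ X Y' Z).hom = (α_ X Y Z).hom ≫ X ◁ (y ▷ Z) := by
  induction y using hom_induction with
  | nil X => simp only [whiskerRight_id', whiskerLeft_id', Category.id_comp, Category.comp_id]
  | cons x f ih =>
    rw [whiskerRight_comp', whiskerLeft_comp', whiskerRight_comp', Category.assoc,
      whiskerLeft_comp', ← Category.assoc (α_ _ _ _).hom, ← ih, Category.assoc]
    congr 1
    exact ι_heq (tObj_assoc _ _ _) (tObj_assoc _ _ _)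
      (IsSymmMonoidalParacategory.tHom_assoc (one X.obj) f (one Z.obj))

theorem associator_naturality_right' (X Y : Env D) {Z Z' : Env D} (z : Z ⟶ Z') :
    (X ⊗ Y) ◁ z ≫ (α_ X Y Z').hom = (α_ X Y Z).hom ≫ X ◁ (Y ◁ z) := by
  induction z using hom_induction with
  | nil X => simp only [whiskerLeft_id', Category.id_comp, Category.comp_id]
  | cons x f ih =>
    rw [whiskerLeft_comp', whiskerLeft_comp', Category.assoc,
      whiskerLeft_comp', ← Category.assoc (α_ _ _ _).hom, ← ih, Category.assoc]
    congr 1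
    have h := IsSymmMonoidalParacategory.tHom_assoc (one X.obj) (one Y.obj) f
    rw [one_tHom_one] at h
    exact ι_heq (tObj_assoc _ _ _) (tObj_assoc _ _ _) h

instance : MonoidalCategory (Env D) where
  tensorHom_def _ _ := rfl
  id_tensorHom_id X Y := by
    change 𝟙 X ▷ Y ≫ X ◁ 𝟙 Y = _
    rw [whiskerLeft_id', whiskerRight_id', Category.id_comp]
  tensorHom_comp_tensorHom {X Y Z X' Y' Z'} x x' y y' := by
    change (x ▷ X' ≫ Y ◁ x') ≫ (y ▷ Y' ≫ Z ◁ y') = (x ≫ y) ▷ X' ≫ Z ◁ (x' ≫ y')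
    rw [whiskerRight_comp', whiskerLeft_comp', Category.assoc, Category.assoc,
      ← Category.assoc (Y ◁ x'), whisker_exchange', Category.assoc]
  whiskerLeft_id := whiskerLeft_id'
  id_whiskerRight := whiskerRight_id'
  associator_naturality {X Y Z X' Y' Z'} x y z := by
    change ((x ▷ Y ≫ X' ◁ y) ▷ Z ≫ (X' ⊗ Y') ◁ z) ≫ _ = _ ≫ (x ▷ (Y ⊗ Z) ≫ X' ◁ (y ▷ Z ≫ Y' ◁ z))
    rw [Category.assoc, associator_naturality_right', whiskerRight_comp', Category.assoc,
      ← Category.assoc ((X' ◁ y) ▷ Z), associator_naturality_middle', Category.assoc,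
      ← Category.assoc, associator_naturality_left', whiskerLeft_comp', Category.assoc]
  leftUnitor_naturality x := by
    induction x using hom_induction with
    | nil X => rw [whiskerLeft_id', Category.id_comp, Category.comp_id]
    | cons x f ih =>
      rw [whiskerLeft_comp', Category.assoc, ← Category.assoc (λ_ _).hom, ← ih, Category.assoc]
      congr 1
      exact ι_heq (unit_tObj _) (unit_tObj _) (IsSymmMonoidalParacategory.unit_tHom f)
  rightUnitor_naturality x := by
    induction x using hom_induction with
    | nil X => rw [whiskerRight_id', Category.id_comp, Category.comp_id]
    | cons x f ih =>
      rw [whiskerRight_comp', Category.assoc, ← Category.assoc (ρ_ _).hom, ← ih, Category.assoc]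
      congr 1
      exact ι_heq (tObj_unit _) (tObj_unit _) (IsSymmMonoidalParacategory.tHom_unit f)
  pentagon W X Y Z := by
    simp only [associator_hom]
    rw [eqToHom_whiskerRight', whiskerLeft_eqToHom', eqToHom_trans, eqToHom_trans, eqToHom_trans]
  triangle X Y := by
    rw [associator_hom, leftUnitor_hom, rightUnitor_hom, eqToHom_whiskerRight', whiskerLeft_eqToHom', eqToHom_trans]

/-- The symmetry of the envelope. -/
def braid (X Y : Env D) : X ⊗ Y ≅ Y ⊗ X where
  hom := ι (symm X.obj Y.obj)
  inv := ι (symm Y.obj X.obj)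
  hom_inv_id := (comp_eq_some.1 (IsSymmMonoidalParacategory.symm_symm _ _)).trans (ι_one _)
  inv_hom_id := (comp_eq_some.1 (IsSymmMonoidalParacategory.symm_symm _ _)).trans (ι_one _)

/-- A Kleene equality yields an equation in the envelope only if one side is defined. The totality
axioms provide this wherever naturality or compatibility is transferred. -/
theorem mk_eq_mk {A B : D} {p q : Path A B} (h : comp p = comp q) (hp : (comp p).Dom) :
    mk p = mk q :=
  (mk_eq_ι (Part.get_mem hp)).trans (mk_eq_ι (h ▸ Part.get_mem hp)).symm

theorem braid_hexagon (X Y Z : Env D) :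
    (α_ X Y Z).hom ≫ (braid X (Y ⊗ Z)).hom ≫ (α_ Y Z X).hom =
      (braid X Y).hom ▷ Z ≫ (α_ Y X Z).hom ≫ Y ◁ (braid X Z).hom := by
  have h := comp_eq_some.1 (IsSymmMonoidalParacategory.hexagon X.obj Y.obj Z.obj)
  simp only [mk_cons, mk_nil, Category.id_comp, ι_ascInv, ι_asc] at h
  change _ = (braid X (Y ⊗ Z)).hom at h
  rw [← h]
  simp only [Category.assoc, Iso.inv_hom_id, Category.comp_id]
  exact Iso.hom_inv_id_assoc (α_ X Y Z) _

theorem rep_whiskerLeft_braid_comp {X Y Z W : Env D} {x : Z ⊗ (Y ⊗ X) ⟶ W} (hx : Rep x) :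
    Rep (Z ◁ (braid X Y).hom ≫ x) := by
  obtain ⟨f, rfl⟩ := hx
  exact rep_mk (IsSymmMonoidalParacategory.symm_total_left f)

theorem rep_comp_whiskerLeft_braid {X Y Z W : Env D} {x : W ⟶ Z ⊗ (X ⊗ Y)} (hx : Rep x) :
    Rep (x ≫ Z ◁ (braid X Y).hom) := by
  obtain ⟨f, rfl⟩ := hx
  exact rep_mk (IsSymmMonoidalParacategory.symm_total_right f)

theorem rep_comp_braid {X Y W : Env D} {x : W ⟶ X ⊗ Y} (hx : Rep x) :
    Rep (x ≫ (braid X Y).hom) := by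
  have h := rep_comp_eqToHom (rep_comp_whiskerLeft_braid
    (rep_comp_eqToHom hx (congrArg Env.of (unit_tObj _).symm))) (congrArg Env.of (unit_tObj _))
  refine h.congr ?_
  change ((x ≫ (λ_ _).inv) ≫ 𝟙_ _ ◁ (braid X Y).hom) ≫ (λ_ _).hom = _
  simp

theorem braid_naturality_left {X X' : Env D} (x : X ⟶ X') (Y : Env D) :
    x ▷ Y ≫ (braid X' Y).hom = (braid X Y).hom ≫ Y ◁ x := by
  induction x using hom_induction with
  | nil X => rw [whiskerRight_id', whiskerLeft_id', Category.id_comp, Category.comp_id]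
  | cons x f ih =>
    rw [whiskerRight_comp', whiskerLeft_comp', Category.assoc, ← Category.assoc (braid _ _).hom,
      ← ih, Category.assoc]
    congr 1
    exact mk_eq_mk (IsSymmMonoidalParacategory.symm_natural_left f Y.obj)
      (dom_of_rep (rep_comp_braid (rep_ι _)))

theorem braid_naturality_right (X : Env D) {Y Y' : Env D} (y : Y ⟶ Y') :
    X ◁ y ≫ (braid X Y').hom = (braid X Y).hom ≫ y ▷ X := by
  induction y using hom_induction with
  | nil X => rw [whiskerRight_id', whiskerLeft_id', Category.id_comp, Category.comp_id]
  | cons x f ih =>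
    rw [whiskerRight_comp', whiskerLeft_comp', Category.assoc, ← Category.assoc (braid _ _).hom,
      ← ih, Category.assoc]
    congr 1
    exact mk_eq_mk (IsSymmMonoidalParacategory.symm_natural_right X.obj f)
      (dom_of_rep (rep_comp_braid (rep_ι _)))

instance : SymmetricCategory (Env D) where
  braiding := braid
  braiding_naturality_right := braid_naturality_right
  braiding_naturality_left := braid_naturality_left
  hexagon_forward := braid_hexagon
  hexagon_reverse X Y Z := by
    have h := congrArg Iso.inv (Iso.ext (α := (α_ Z X Y) ≪≫ braid Z (X ⊗ Y) ≪≫ α_ X Y Z)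
      (β := whiskerRightIso (braid Z X) Y ≪≫ α_ X Z Y ≪≫ whiskerLeftIso X (braid Z Y))
      (braid_hexagon Z X Y))
    simp only [Iso.trans_inv, whiskerLeftIso_inv, whiskerRightIso_inv, Category.assoc] at h
    exact h
  symmetry X Y := (braid X Y).hom_inv_id

theorem ι_symm (A B : D) : ι (symm A B) = (β_ (Env.of A) (.of B)).hom := rfl

end monoidal

end Env

end Para

/-! ### Dual pairs in symmetric monoidal categories -/

namespace Para

open Wiring

/-- A pairing that exhibits `V` as a dual of `U`. -/
structure Pairing {E : Type u} [Category.{v} E] [MonoidalCategory E] (U V : E) where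
  η : 𝟙_ E ⟶ V ⊗ U
  ε : U ⊗ V ⟶ 𝟙_ E
  zig : (ρ_ U).inv ≫ U ◁ η ≫ (α_ U V U).inv ≫ ε ▷ U ≫ (λ_ U).hom = 𝟙 U
  zag : (λ_ V).inv ≫ η ▷ V ≫ (α_ V U V).hom ≫ V ◁ ε ≫ (ρ_ V).hom = 𝟙 V

namespace Pairing

variable {E : Type u} [Category.{v} E] [MonoidalCategory E] [SymmetricCategory E]
  {U V U' V' U'' V'' : E}

theorem zig_context (p : Pairing U V) {P Q R : E} (a : P ⟶ R ⊗ U) (b : R ⊗ U ⟶ Q) :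
    a ≫ R ◁ ((ρ_ U).inv ≫ U ◁ p.η ≫ (α_ U V U).inv ≫ p.ε ▷ U ≫ (λ_ U).hom) ≫ b = a ≫ b := by
  rw [p.zig]
  simp

theorem zag_context (p : Pairing U V) {P Q R : E} (a : P ⟶ R ⊗ V) (b : R ⊗ V ⟶ Q) :
    a ≫ R ◁ ((λ_ V).inv ≫ p.η ▷ V ≫ (α_ V U V).hom ≫ V ◁ p.ε ≫ (ρ_ V).hom) ≫ b = a ≫ b := by
  rw [p.zag]
  simp

/-- An arrow into `V` is recovered from its pairing with `U` by bending back with the unit and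
straightening. -/
theorem hom_ext (p : Pairing U V) {Z : E} {x y : Z ⟶ V} (h : U ◁ x ≫ p.ε = U ◁ y ≫ p.ε) : x = y := by
  have key : ∀ x : Z ⟶ V, (λ_ _).inv ≫ p.η ▷ Z ≫ (α_ _ _ _).hom ≫ V ◁ (U ◁ x ≫ p.ε) ≫
      (ρ_ _).hom = x := by
    intro x
    refine Eq.trans ?_ ((congrArg (x ≫ ·) p.zag).trans (Category.comp_id _))
    have := gen x 0; have := gen p.η 1; have := gen p.ε 2
    exact solve
  rw [← key x, ← key y, h]

/-- Inserting a zigzag of `p` into the unit of `q` leaves the unit of `p` followed by a mixed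
zigzag, which is an identity if the counits agree. -/
theorem ext_of_ε (p q : Pairing U V) (h : p.ε = q.ε) : p.η = q.η := by
  have h1 : q.η = p.η ≫ ((λ_ V).inv ≫ q.η ▷ V ≫ (α_ V U V).hom ≫ V ◁ p.ε ≫ (ρ_ V).hom) ▷ U := by
    refine Eq.trans ?_ ((congrArg (fun t => q.η ≫ V ◁ t) p.zig).symm.trans ?_)
    · simp
    · have := gen q.η 0; have := gen p.η 1; have := gen p.ε 2
      exact solve
  rw [h1, h, q.zag]
  simp

/-- The transpose of an arrow with respect to two pairings. -/
def mate (p : Pairing U V) (q : Pairing U' V') (e : U' ⟶ U) : V ⟶ V' :=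
  (λ_ _).inv ≫ q.η ▷ V ≫ (α_ _ _ _).hom ≫ V' ◁ (e ▷ V ≫ p.ε) ≫ (ρ_ _).hom

theorem mate_ε (p : Pairing U V) (q : Pairing U' V') (e : U' ⟶ U) :
    U' ◁ mate p q e ≫ q.ε = e ▷ V ≫ p.ε := by
  refine Eq.trans ?_ ((congrArg (fun t => t ▷ V ≫ e ▷ V ≫ p.ε) q.zig).trans ?_)
  · have := gen q.η 0; have := gen q.ε 1; have := gen e 2; have := gen p.ε 3
    dsimp only [mate]
    exact solve
  · simp

theorem mate_η (p : Pairing U V) (q : Pairing U' V') (e : U' ⟶ U) :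
    p.η ≫ mate p q e ▷ U = q.η ≫ V' ◁ e := by
  refine Eq.trans ?_ ((congrArg (fun t => q.η ≫ V' ◁ e ≫ V' ◁ t) p.zig).trans ?_)
  · have := gen q.η 0; have := gen p.η 1; have := gen e 2; have := gen p.ε 3
    dsimp only [mate]
    exact solve
  · simp

theorem eq_mate (p : Pairing U V) (q : Pairing U' V') {e : U' ⟶ U} {x : V ⟶ V'}
    (h : U' ◁ x ≫ q.ε = e ▷ V ≫ p.ε) : x = mate p q e :=
  q.hom_ext (h.trans (mate_ε p q e).symm)

theorem mate_comp (p : Pairing U V) (q : Pairing U' V') (r : Pairing U'' V'') (e : U' ⟶ U)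
    (e' : U'' ⟶ U') : mate p q e ≫ mate q r e' = mate p r (e' ≫ e) := by
  refine eq_mate p r ?_
  rw [whiskerLeft_comp, Category.assoc, mate_ε, whisker_exchange_assoc, mate_ε,
    comp_whiskerRight, Category.assoc]

theorem mate_id (p : Pairing U V) : mate p p (𝟙 U) = 𝟙 V :=
  (eq_mate p p (by simp)).symm

/-- The isomorphism of duals induced by an isomorphism. -/
def mateIso (p : Pairing U V) (q : Pairing U' V') (e : U' ≅ U) : V ≅ V' where
  hom := mate p q e.hom
  inv := mate q p e.inv
  hom_inv_id := by rw [mate_comp, e.inv_hom_id, mate_id]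
  inv_hom_id := by rw [mate_comp, e.hom_inv_id, mate_id]

/-- The tensor product of two pairings. -/
def tensor (p : Pairing U V) (q : Pairing U' V') : Pairing (U ⊗ U') (V' ⊗ V) where
  η := q.η ≫ V' ◁ ((λ_ _).inv ≫ p.η ▷ U') ≫ V' ◁ (α_ _ _ _).hom ≫ (α_ _ _ _).inv
  ε := (α_ _ _ _).hom ≫ U ◁ ((α_ _ _ _).inv ≫ q.ε ▷ V ≫ (λ_ _).hom) ≫ p.ε
  zig := by
    refine Eq.trans ?_ ((congrArg₂ (fun s t => s ⊗ₘ t) p.zig q.zig).trans (id_tensorHom_id _ _))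
    have := gen p.η 0; have := gen p.ε 1; have := gen q.η 2; have := gen q.ε 3
    exact solve
  zag := by
    refine Eq.trans ?_ ((congrArg₂ (fun s t => s ⊗ₘ t) q.zag p.zag).trans (id_tensorHom_id _ _))
    have := gen p.η 0; have := gen p.ε 1; have := gen q.η 2; have := gen q.ε 3
    exact solve

/-- A pairing with the roles of the objects exchanged. -/
def swap (p : Pairing U V) : Pairing V U where
  η := p.η ≫ (β_ _ _).hom
  ε := (β_ _ _).hom ≫ p.ε
  zig := by
    refine Eq.trans ?_ p.zag
    have := gen p.η 0; have := gen p.ε 1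
    exact solve
  zag := by
    refine Eq.trans ?_ p.zig
    have := gen p.η 0; have := gen p.ε 1
    exact solve

/-- A pairing transported along isomorphisms. -/
def transport (p : Pairing U V) (e : U ≅ U') (f : V ≅ V') : Pairing U' V' where
  η := p.η ≫ (f.hom ⊗ₘ e.hom)
  ε := (e.inv ⊗ₘ f.inv) ≫ p.ε
  zig := by
    refine Eq.trans (b := e.inv ≫ ((ρ_ U).inv ≫ U ◁ (p.η ≫ (f.hom ≫ f.inv) ▷ U) ≫
      (α_ U V U).inv ≫ p.ε ▷ U ≫ (λ_ U).hom) ≫ e.hom) ?_ ?_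
    · have := gen p.η 0; have := gen p.ε 1; have := gen e.hom 2; have := gen e.inv 3
      have := gen f.hom 4; have := gen f.inv 5
      exact solve
    · rw [f.hom_inv_id, id_whiskerRight, Category.comp_id, p.zig, Category.id_comp, e.inv_hom_id]
  zag := by
    refine Eq.trans (b := f.inv ≫ ((λ_ V).inv ≫ (p.η ≫ V ◁ (e.hom ≫ e.inv)) ▷ V ≫
      (α_ V U V).hom ≫ V ◁ p.ε ≫ (ρ_ V).hom) ≫ f.hom) ?_ ?_
    · have := gen p.η 0; have := gen p.ε 1; have := gen e.hom 2; have := gen e.inv 3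
      have := gen f.hom 4; have := gen f.inv 5
      exact solve
    · rw [e.hom_inv_id, whiskerLeft_id, Category.comp_id, p.zag, Category.id_comp, f.inv_hom_id]

/-- The unit object is its own dual. -/
def unit : Pairing (𝟙_ E) (𝟙_ E) where
  η := (λ_ _).inv
  ε := (λ_ _).hom
  zig := solve
  zag := solve

/-- The trace with respect to a pairing. -/
def trace (p : Pairing U V) {A B : E} (f : A ⊗ U ⟶ B ⊗ U) : A ⟶ B :=
  (ρ_ A).inv ≫ A ◁ (p.η ≫ (β_ _ _).hom) ≫ (α_ _ _ _).inv ≫ f ▷ V ≫ (α_ _ _ _).hom ≫ B ◁ p.ε ≫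
    (ρ_ B).hom

/-- The trace does not depend on the pairing. -/
theorem trace_conj (p : Pairing U V) (q : Pairing U' V') (e : U ≅ U') {A B : E}
    (f : A ⊗ U ⟶ B ⊗ U) : q.trace (A ◁ e.inv ≫ f ≫ B ◁ e.hom) = p.trace f := by
  refine Eq.trans (b := (ρ_ A).inv ≫ A ◁ (q.η ≫ V' ◁ e.inv ≫ (β_ _ _).hom) ≫ (α_ _ _ _).inv ≫
    f ▷ V' ≫ (α_ _ _ _).hom ≫ B ◁ (e.hom ▷ V' ≫ q.ε) ≫ (ρ_ B).hom) ?_ ?_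
  · have := gen q.η 0; have := gen q.ε 1; have := gen e.hom 2; have := gen e.inv 3
    have := gen f 4
    dsimp only [trace]
    exact solve
  -- The isomorphism and its inverse are moved across the counit and the unit; their transposes meet
  -- on the dual strand and cancel.
  · rw [← mate_ε q p e.hom, ← Category.assoc q.η, ← mate_η p q e.inv]
    refine Eq.trans (b := (ρ_ A).inv ≫ A ◁ (p.η ≫ (mate p q e.inv ≫ mate q p e.hom) ▷ U ≫
      (β_ _ _).hom) ≫ (α_ _ _ _).inv ≫ f ▷ V ≫ (α_ _ _ _).hom ≫ B ◁ p.ε ≫ (ρ_ B).hom) ?_ ?_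
    · have := gen p.η 0; have := gen p.ε 1; have := gen (mate p q e.inv) 2
      have := gen (mate q p e.hom) 3; have := gen f 4
      exact solve
    · rw [mate_comp, e.hom_inv_id, mate_id, id_whiskerRight, Category.id_comp]
      rfl

end Pairing

end Para

/-! ### Total arrows and total pairings in the envelope -/

namespace Para

open Wiring ParacategoryStruct MonoidalParaStruct

namespace Env

variable {D : Type u} [MonoidalParaStruct.{v} D] [IsSymmMonoidalParacategory D]

/-- Arrows of the envelope whose composites with arrows of the paracategory are arrows of the
paracategory. -/
structure Tot {X Y : Env D} (m : X ⟶ Y) : Prop where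
  comp_left : ∀ {Z W : Env D} {x : Z ⊗ Y ⟶ W}, Rep x → Rep (Z ◁ m ≫ x)
  comp_right : ∀ {Z W : Env D} {x : W ⟶ Z ⊗ X}, Rep x → Rep (x ≫ Z ◁ m)

theorem tot_eqToHom {X Y : Env D} (h : X = Y) : Tot (eqToHom h) := by
  subst h
  constructor
  · intro Z W x hx
    simpa using hx
  · intro Z W x hx
    simpa using hx

theorem tot_id (X : Env D) : Tot (𝟙 X) := tot_eqToHom rfl

theorem tot_associator_hom (X Y Z : Env D) : Tot (α_ X Y Z).hom :=
  tot_eqToHom (congrArg Env.of (tObj_assoc _ _ _))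

theorem tot_associator_inv (X Y Z : Env D) : Tot (α_ X Y Z).inv :=
  tot_eqToHom (congrArg Env.of (tObj_assoc _ _ _).symm)

theorem tot_leftUnitor_hom (X : Env D) : Tot (λ_ X).hom :=
  tot_eqToHom (congrArg Env.of (unit_tObj _))

theorem tot_leftUnitor_inv (X : Env D) : Tot (λ_ X).inv :=
  tot_eqToHom (congrArg Env.of (unit_tObj _).symm)

theorem tot_rightUnitor_hom (X : Env D) : Tot (ρ_ X).hom :=
  tot_eqToHom (congrArg Env.of (tObj_unit _))

theorem tot_rightUnitor_inv (X : Env D) : Tot (ρ_ X).inv :=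
  tot_eqToHom (congrArg Env.of (tObj_unit _).symm)

theorem tot_braiding (X Y : Env D) : Tot (β_ X Y).hom :=
  ⟨rep_whiskerLeft_braid_comp, rep_comp_whiskerLeft_braid⟩

theorem Tot.comp {X Y Z : Env D} {m : X ⟶ Y} {n : Y ⟶ Z} (hm : Tot m) (hn : Tot n) :
    Tot (m ≫ n) := by
  constructor
  · intro Z W x hx
    exact (hm.comp_left (hn.comp_left hx)).congr (by simp)
  · intro Z W x hx
    exact (hn.comp_right (hm.comp_right hx)).congr (by simp)

theorem Tot.rep_comp {X Y W : Env D} {m : X ⟶ Y} (hm : Tot m) {x : Y ⟶ W} (hx : Rep x) :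
    Rep (m ≫ x) :=
  (rep_eqToHom_comp (hm.comp_left (rep_eqToHom_comp hx (congrArg Env.of (unit_tObj Y.obj))))
    (congrArg Env.of (unit_tObj X.obj).symm)).congr (by
      change (λ_ _).inv ≫ 𝟙_ _ ◁ m ≫ (λ_ _).hom ≫ x = _
      simp)

theorem Tot.comp_rep {X Y W : Env D} {m : X ⟶ Y} (hm : Tot m) {x : W ⟶ X} (hx : Rep x) :
    Rep (x ≫ m) :=
  (rep_comp_eqToHom (hm.comp_right (rep_comp_eqToHom hx (congrArg Env.of (unit_tObj X.obj).symm)))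
    (congrArg Env.of (unit_tObj Y.obj))).congr (by
      change ((x ≫ (λ_ _).inv) ≫ 𝟙_ _ ◁ m) ≫ (λ_ _).hom = _
      simp)

theorem Tot.rep {X Y : Env D} {m : X ⟶ Y} (hm : Tot m) : Rep m :=
  (hm.rep_comp (rep_id Y)).congr (Category.comp_id m)

theorem Tot.whiskerLeft (Y : Env D) {X X' : Env D} {m : X ⟶ X'} (hm : Tot m) : Tot (Y ◁ m) := by
  constructor
  · intro Z W x hx
    refine ((tot_associator_inv Z Y X).rep_comp (hm.comp_left
      ((tot_associator_hom Z Y X').rep_comp hx))).congr ?_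
    simp
  · intro Z W x hx
    refine ((tot_associator_hom Z Y X').comp_rep (hm.comp_right
      ((tot_associator_inv Z Y X).comp_rep hx))).congr ?_
    simp

theorem Tot.whiskerRight {X X' : Env D} {m : X ⟶ X'} (hm : Tot m) (Y : Env D) : Tot (m ▷ Y) := by
  have h := ((tot_braiding X Y).comp (hm.whiskerLeft Y)).comp (tot_braiding Y X')
  have e : ((β_ X Y).hom ≫ Y ◁ m) ≫ (β_ Y X').hom = m ▷ Y := by
    have := gen m 0
    exact solve
  rwa [e] at h

theorem Tot.tensor {X X' Y Y' : Env D} {m : X ⟶ X'} {n : Y ⟶ Y'} (hm : Tot m) (hn : Tot n) :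
    Tot (m ⊗ₘ n) := by
  rw [MonoidalCategory.tensorHom_def]
  exact (hm.whiskerRight Y).comp (hn.whiskerLeft X')

theorem tot_tensorμ (W X Y Z : Env D) : Tot (tensorμ W X Y Z) := by
  refine (tot_associator_hom _ _ _).comp (Tot.comp (Tot.whiskerLeft _ (tot_associator_inv _ _ _))
    (Tot.comp (Tot.whiskerLeft _ (Tot.whiskerRight (tot_braiding _ _) _)) (Tot.comp
      (Tot.whiskerLeft _ (tot_associator_hom _ _ _)) (tot_associator_inv _ _ _))))

/-- Pairings for which transposition preserves arrows of the paracategory. -/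
structure TotPairing {U V : Env D} (p : Pairing U V) : Prop where
  η_right : ∀ {A B : Env D} {x : A ⊗ V ⟶ B}, Rep x → Rep (A ◁ p.η ≫ (α_ A V U).inv ≫ x ▷ U)
  ε_right : ∀ {A B : Env D} {x : A ⟶ B ⊗ U}, Rep x → Rep (x ▷ V ≫ (α_ B U V).hom ≫ B ◁ p.ε)
  η_left : ∀ {A B : Env D} {x : U ⊗ A ⟶ B}, Rep x → Rep (p.η ▷ A ≫ (α_ V U A).hom ≫ V ◁ x)
  ε_left : ∀ {A B : Env D} {x : A ⟶ V ⊗ B}, Rep x → Rep (U ◁ x ≫ (α_ U V B).inv ≫ p.ε ▷ B)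

namespace TotPairing

variable {U V U' V' : Env D} {p : Pairing U V} {q : Pairing U' V'}

/-- The composite with a transpose is built in stages, by a unit, `e` and a counit, each of which
preserves representability. For composition on the right the counit acts first and the unit last; on
the left the order is reversed. -/
theorem tot_mate (hp : TotPairing p) (hq : TotPairing q) {e : U' ⟶ U} (he : Tot e) :
    Tot (p.mate q e) := by
  constructor
  · intro Z W x hx
    have h := hp.ε_right ((he.whiskerLeft W).comp_rep (hq.η_right hx))
    refine (((tot_rightUnitor_inv Z).whiskerRight V).rep_comp
      ((tot_rightUnitor_hom W).comp_rep h)).congr ?_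
    have := gen q.η 0; have := gen p.ε 1; have := gen e 2; have := gen x 3
    dsimp only [Pairing.mate]
    exact solve
  · intro Z W x hx
    have h := hq.η_left ((he.whiskerRight W).rep_comp (hp.ε_left ((tot_braiding _ _).comp_rep hx)))
    refine ((tot_leftUnitor_inv W).rep_comp (((tot_leftUnitor_hom Z).whiskerLeft V').comp_rep h |>
      (tot_braiding _ _).comp_rep)).congr ?_
    have := gen q.η 0; have := gen p.ε 1; have := gen e 2; have := gen x 3
    dsimp only [Pairing.mate]
    exact solve

theorem tensor (hp : TotPairing p) (hq : TotPairing q) : TotPairing (p.tensor q) where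
  η_right {A B x} hx := by
    have h := hq.η_right ((tot_rightUnitor_inv (A ⊗ V')).rep_comp
      (hp.η_right ((tot_associator_hom A V' V).rep_comp hx)))
    refine ((tot_associator_hom _ _ _).comp_rep h).congr ?_
    have := gen q.η 0; have := gen p.η 1; have := gen x 2
    dsimp only [Pairing.tensor]
    exact solve
  ε_right {A B x} hx := by
    have h := hp.ε_right ((tot_rightUnitor_hom _).comp_rep
      (hq.ε_right ((tot_associator_inv _ _ _).comp_rep hx)))
    refine ((tot_associator_inv _ _ _).rep_comp h).congr ?_
    have := gen q.ε 0; have := gen p.ε 1; have := gen x 2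
    dsimp only [Pairing.tensor]
    exact solve
  η_left {A B x} hx := by
    have h := hq.η_left ((tot_leftUnitor_inv _).rep_comp
      (hp.η_left ((tot_associator_inv _ _ _).rep_comp hx)))
    refine ((tot_associator_inv _ _ _).comp_rep h).congr ?_
    have := gen q.η 0; have := gen p.η 1; have := gen x 2
    dsimp only [Pairing.tensor]
    exact solve
  ε_left {A B x} hx := by
    have h := hp.ε_left ((tot_leftUnitor_hom _).comp_rep
      (hq.ε_left ((tot_associator_hom _ _ _).comp_rep hx)))
    refine ((tot_associator_hom _ _ _).rep_comp h).congr ?_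
    have := gen q.ε 0; have := gen p.ε 1; have := gen x 2
    dsimp only [Pairing.tensor]
    exact solve

theorem swap (hp : TotPairing p) : TotPairing p.swap where
  η_right {A B x} hx := by
    have h := hp.η_left ((tot_braiding _ _).rep_comp hx)
    refine ((tot_braiding _ _).rep_comp ((tot_braiding _ _).comp_rep h)).congr ?_
    have := gen p.η 0; have := gen x 1
    dsimp only [Pairing.swap]
    exact solve
  ε_right {A B x} hx := by
    have h := hp.ε_left ((tot_braiding _ _).comp_rep hx)
    refine ((tot_braiding _ _).rep_comp ((tot_braiding _ _).comp_rep h)).congr ?_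
    have := gen p.ε 0; have := gen x 1
    dsimp only [Pairing.swap]
    exact solve
  η_left {A B x} hx := by
    have h := hp.η_right ((tot_braiding _ _).rep_comp hx)
    refine ((tot_braiding _ _).rep_comp ((tot_braiding _ _).comp_rep h)).congr ?_
    have := gen p.η 0; have := gen x 1
    dsimp only [Pairing.swap]
    exact solve
  ε_left {A B x} hx := by
    have h := hp.ε_right ((tot_braiding _ _).comp_rep hx)
    refine ((tot_braiding _ _).rep_comp ((tot_braiding _ _).comp_rep h)).congr ?_
    have := gen p.ε 0; have := gen x 1
    dsimp only [Pairing.swap]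
    exact solve

theorem transport (hp : TotPairing p) {e : U ≅ U'} {f : V ≅ V'} (he : Tot e.hom) (he' : Tot e.inv)
    (hf : Tot f.hom) (hf' : Tot f.inv) : TotPairing (p.transport e f) where
  η_right {A B x} hx := by
    have h := (he.whiskerLeft B).comp_rep (hp.η_right ((hf.whiskerLeft A).rep_comp hx))
    refine h.congr ?_
    have := gen p.η 0; have := gen x 1; have := gen e.hom 2; have := gen f.hom 3
    dsimp only [Pairing.transport]
    exact solve
  ε_right {A B x} hx := by
    have h := (hf'.whiskerLeft A).rep_comp (hp.ε_right ((he'.whiskerLeft B).comp_rep hx))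
    refine h.congr ?_
    have := gen p.ε 0; have := gen x 1; have := gen e.inv 2; have := gen f.inv 3
    dsimp only [Pairing.transport]
    exact solve
  η_left {A B x} hx := by
    have h := (hf.whiskerRight B).comp_rep (hp.η_left ((he.whiskerRight A).rep_comp hx))
    refine h.congr ?_
    have := gen p.η 0; have := gen x 1; have := gen e.hom 2; have := gen f.hom 3
    dsimp only [Pairing.transport]
    exact solve
  ε_left {A B x} hx := by
    have h := (he'.whiskerRight A).rep_comp (hp.ε_left ((hf'.whiskerRight B).comp_rep hx))
    refine h.congr ?_
    have := gen p.ε 0; have := gen x 1; have := gen e.inv 2; have := gen f.inv 3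
    dsimp only [Pairing.transport]
    exact solve

theorem unit : TotPairing (Pairing.unit : Pairing (𝟙_ (Env D)) (𝟙_ (Env D))) where
  η_right {A B x} hx := by
    refine ((tot_rightUnitor_inv B).comp_rep hx).congr ?_
    have := gen x 0
    dsimp only [Pairing.unit]
    exact solve
  ε_right {A B x} hx := by
    refine ((tot_rightUnitor_hom A).rep_comp hx).congr ?_
    have := gen x 0
    dsimp only [Pairing.unit]
    exact solve
  η_left {A B x} hx := by
    refine ((tot_leftUnitor_inv B).comp_rep hx).congr ?_
    have := gen x 0
    dsimp only [Pairing.unit]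
    exact solve
  ε_left {A B x} hx := by
    refine ((tot_leftUnitor_hom A).rep_comp hx).congr ?_
    have := gen x 0
    dsimp only [Pairing.unit]
    exact solve

end TotPairing

section compact

open CompactClosedParaStruct

variable {D : Type u} [CompactClosedParaStruct.{v} D] [IsCompactClosedParacategory D]

/-- The dual object in the envelope. -/
def du (X : Env D) : Env D := .of (dual X.obj)

/-- The pairing of an object with its given dual. -/
def duPairing (X : Env D) : Pairing X (du X) where
  η := ι (eta X.obj)
  ε := ι (eps X.obj)
  zig := by
    have h := comp_eq_some.1 (IsCompactClosedParacategory.zigzag X.obj)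
    simp only [mk_cons, mk_nil, Category.id_comp, ι_ascInv, ι_runInv, ι_lun, ι_one,
      Category.assoc] at h
    exact h
  zag := by
    have h := comp_eq_some.1 (IsCompactClosedParacategory.zigzag_dual X.obj)
    simp only [mk_cons, mk_nil, Category.id_comp, ι_asc, ι_lunInv, ι_run, ι_one,
      Category.assoc] at h
    exact h

theorem tot_duPairing (X : Env D) : TotPairing (duPairing X) where
  η_right {A B x} hx := by
    obtain ⟨f, rfl⟩ := hx
    refine (rep_mk (IsCompactClosedParacategory.eta_total_right (E := X.obj) f)).congr ?_
    simp only [mk_cons, mk_nil, Category.id_comp, ι_ascInv, Category.assoc]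
    rfl
  ε_right {A B x} hx := by
    obtain ⟨f, rfl⟩ := hx
    refine (rep_mk (IsCompactClosedParacategory.eps_total_right (E := X.obj) f)).congr ?_
    simp only [mk_cons, mk_nil, Category.id_comp, ι_asc, Category.assoc]
    rfl
  η_left {A B x} hx := by
    obtain ⟨f, rfl⟩ := hx
    refine (rep_mk (IsCompactClosedParacategory.eta_total_left (A := X.obj) f)).congr ?_
    simp only [mk_cons, mk_nil, Category.id_comp, ι_asc, Category.assoc]
    rfl
  ε_left {A B x} hx := by
    obtain ⟨f, rfl⟩ := hx
    refine (rep_mk (IsCompactClosedParacategory.eps_total_left (A := X.obj) f)).congr ?_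
    simp only [mk_cons, mk_nil, Category.id_comp, ι_ascInv, Category.assoc]
    rfl

end compact

end Env

end Para

namespace Para

open Wiring

/-! ### Bending of arrows along pairings -/

namespace Pairing

variable {E : Type u} [Category.{v} E] [MonoidalCategory E] [SymmetricCategory E]
  {M M' N N' L L' P P' Q Q' R U U' V V' : E}

/-- An arrow `P ⊗ N ⟶ Q ⊗ M` as an arrow `P ⊗ M* ⟶ Q ⊗ N*`. -/
def bend (p : Pairing M M') (q : Pairing N N') (h : P ⊗ N ⟶ Q ⊗ M) : P ⊗ M' ⟶ Q ⊗ N' :=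
  (ρ_ _).inv ≫ (P ⊗ M') ◁ (q.η ≫ (β_ _ _).hom) ≫ tensorμ _ _ _ _ ≫ h ▷ (M' ⊗ N') ≫
    _ ◁ (β_ _ _).hom ≫ tensorμ _ _ _ _ ≫ (Q ⊗ N') ◁ p.ε ≫ (ρ_ _).hom

theorem bend_id (p : Pairing M M') : bend p p (𝟙 (P ⊗ M)) = 𝟙 (P ⊗ M') := by
  refine Eq.trans ?_ (p.zag_context (𝟙 (P ⊗ M')) (𝟙 _) |>.trans (Category.comp_id _))
  have := gen p.η 0; have := gen p.ε 1
  dsimp only [bend]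
  exact solve

theorem bend_tensorHom (p : Pairing M M') (q : Pairing N N') (a : P ⟶ Q) (e : N ⟶ M) :
    bend p q (a ⊗ₘ e) = a ⊗ₘ mate p q e := by
  have := gen p.ε 0; have := gen q.η 1; have := gen a 2; have := gen e 3
  dsimp only [bend, mate]
  exact solve

/-- The composite of two arrows before its trace is taken. -/
def twist (h : P ⊗ N ⟶ Q ⊗ M) (k : Q ⊗ L ⟶ R ⊗ N) : (P ⊗ L) ⊗ N ⟶ (R ⊗ M) ⊗ N :=
  (mvIso _ _ _).hom ≫ h ▷ L ≫ (mvIso _ _ _).hom ≫ k ▷ M ≫ (mvIso _ _ _).hom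

/-- The unit of `q` from the first arrow and the counit of `q` from the second close a loop on `N`.
The two sides have the same wiring, without any zigzag identity. -/
theorem bend_comp (p : Pairing M M') (q : Pairing N N') (r : Pairing L L') (h : P ⊗ N ⟶ Q ⊗ M)
    (k : Q ⊗ L ⟶ R ⊗ N) : bend p q h ≫ bend q r k = bend p r (q.trace (twist h k)) := by
  have := gen p.ε 0; have := gen q.η 1; have := gen q.ε 2; have := gen r.η 3
  have := gen h 4; have := gen k 5
  dsimp only [bend, trace, twist]
  exact solve

/-- Bending is natural with respect to transposition. -/
theorem bend_natural {P₂ Q₂ M₂ N₂ M₂' N₂' : E} (p : Pairing M M') (q : Pairing N N')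
    (p₂ : Pairing M₂ M₂') (q₂ : Pairing N₂ N₂') {h : P ⊗ N ⟶ Q ⊗ M} {h₂ : P₂ ⊗ N₂ ⟶ Q₂ ⊗ M₂}
    {a : P ⟶ P₂} {b : Q ⟶ Q₂} {e : M₂ ⟶ M} {e' : N₂ ⟶ N}
    (w : a ▷ N₂ ≫ h₂ ≫ Q₂ ◁ e = P ◁ e' ≫ h ≫ b ▷ M) :
    (a ⊗ₘ mate p p₂ e) ≫ bend p₂ q₂ h₂ = bend p q h ≫ (b ⊗ₘ mate q q₂ e') := by
  refine Eq.trans (b := (ρ_ _).inv ≫ (P ⊗ M') ◁ (q₂.η ≫ (β_ _ _).hom) ≫ tensorμ _ _ _ _ ≫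
    (a ▷ N₂ ≫ h₂ ≫ Q₂ ◁ e) ▷ (M' ⊗ N₂') ≫
    _ ◁ (β_ _ _).hom ≫ tensorμ _ _ _ _ ≫ (Q₂ ⊗ N₂') ◁ p.ε ≫ (ρ_ _).hom) ?_ ?_
  · refine Eq.trans (b := (ρ_ _).inv ≫ (P ⊗ M') ◁ (q₂.η ≫ (β_ _ _).hom) ≫ tensorμ _ _ _ _ ≫
      (a ▷ N₂ ≫ h₂) ▷ (M' ⊗ N₂') ≫
      _ ◁ (β_ _ _).hom ≫ tensorμ _ _ _ _ ≫ (Q₂ ⊗ N₂') ◁ (M₂ ◁ mate p p₂ e ≫ p₂.ε) ≫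
      (ρ_ _).hom) ?_ ?_
    · have := gen p₂.ε 0; have := gen q₂.η 1; have := gen h₂ 2; have := gen a 3
      have := gen (mate p p₂ e) 4
      dsimp only [bend]
      exact solve
    · rw [mate_ε]
      have := gen p.ε 0; have := gen q₂.η 1; have := gen h₂ 2; have := gen a 3; have := gen e 4
      exact solve
  · rw [w]
    refine Eq.trans (b := (ρ_ _).inv ≫ (P ⊗ M') ◁ ((q₂.η ≫ N₂' ◁ e') ≫ (β_ _ _).hom) ≫
      tensorμ _ _ _ _ ≫ (h ≫ b ▷ M) ▷ (M' ⊗ N₂') ≫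
      _ ◁ (β_ _ _).hom ≫ tensorμ _ _ _ _ ≫ (Q₂ ⊗ N₂') ◁ p.ε ≫ (ρ_ _).hom) ?_ ?_
    · have := gen p.ε 0; have := gen q₂.η 1; have := gen h 2; have := gen b 3; have := gen e' 4
      exact solve
    · rw [← mate_η q q₂]
      have := gen p.ε 0; have := gen q.η 1; have := gen h 2; have := gen b 3
      have := gen (mate q q₂ e') 4
      dsimp only [bend]
      exact solve

/-- The tensor product of arrows, with the inner factors exchanged. -/
def cross (h : P ⊗ N ⟶ Q ⊗ M) (k : P' ⊗ N' ⟶ Q' ⊗ M') :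
    (P ⊗ P') ⊗ (N' ⊗ N) ⟶ (Q ⊗ Q') ⊗ (M' ⊗ M) :=
  _ ◁ (β_ _ _).hom ≫ tensorμ _ _ _ _ ≫ (h ⊗ₘ k) ≫ tensorμ _ _ _ _ ≫ _ ◁ (β_ _ _).hom

theorem bend_cross {M₂ N₂ M₂' N₂' : E} (p : Pairing M M') (q : Pairing N N')
    (p₂ : Pairing M₂ M₂') (q₂ : Pairing N₂ N₂') (h : P ⊗ N ⟶ Q ⊗ M) (k : P' ⊗ N₂ ⟶ Q' ⊗ M₂) :
    tensorμ P M' P' M₂' ≫ bend (p₂.tensor p) (q₂.tensor q) (cross h k) =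
      (bend p q h ⊗ₘ bend p₂ q₂ k) ≫ tensorμ Q N' Q' N₂' := by
  have := gen p.ε 0; have := gen q.η 1; have := gen p₂.ε 2; have := gen q₂.η 3
  have := gen h 4; have := gen k 5
  dsimp only [bend, tensor, cross]
  exact solve

/-- A crossing bends into a counit followed by a unit. This is why identities of `C`, read as units
and counits of the Int-construction, are sent to units and counits. -/
theorem bend_braiding (p : Pairing M M') (q : Pairing N N') :
    bend p q (β_ M N).hom = p.ε ≫ q.η ≫ (β_ _ _).hom := by
  have := gen p.ε 0; have := gen q.η 1
  dsimp only [bend]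
  exact solve

theorem tensor_mate {M₂ N₂ M₂' N₂' : E} (p : Pairing M M') (q : Pairing N N')
    (p₂ : Pairing M₂ M₂') (q₂ : Pairing N₂ N₂') (e : N ⟶ M) (e₂ : N₂ ⟶ M₂) :
    mate p q e ⊗ₘ mate p₂ q₂ e₂ = mate (p₂.tensor p) (q₂.tensor q) (e₂ ⊗ₘ e) := by
  have := gen p.ε 0; have := gen q.η 1; have := gen p₂.ε 2; have := gen q₂.η 3
  have := gen e 4; have := gen e₂ 5
  dsimp only [mate, tensor]
  exact solve

theorem mate_braiding (p : Pairing M M') (q : Pairing N N') :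
    mate (p.tensor q) (q.tensor p) (β_ _ _).hom = (β_ _ _).hom := by
  refine (eq_mate _ _ ?_).symm
  have := gen p.ε 0; have := gen q.ε 1
  dsimp only [tensor]
  exact solve

theorem mate_leftUnitor (p : Pairing M M') :
    mate p (unit.tensor p) (λ_ _).hom = (ρ_ _).inv := by
  refine (eq_mate _ _ ?_).symm
  have := gen p.ε 0
  dsimp only [tensor, unit]
  exact solve

theorem mate_rightUnitor (p : Pairing M M') :
    mate p (p.tensor unit) (ρ_ _).hom = (λ_ _).inv := by
  refine (eq_mate _ _ ?_).symm
  have := gen p.ε 0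
  dsimp only [tensor, unit]
  exact solve

/-- The transpose of a bent arrow. -/
theorem mate_bend {P' Q' : E} (p : Pairing M M') (q : Pairing N N') (r : Pairing P P')
    (s : Pairing Q Q') (h : P ⊗ N ⟶ Q ⊗ M) :
    mate (s.tensor q.swap) (r.tensor p.swap) (bend p q h) =
      bend s r ((β_ _ _).hom ≫ h ≫ (β_ _ _).hom) := by
  refine (eq_mate _ _ ?_).symm
  -- By uniqueness of transposes it suffices to compare pairings. Both reduce to the intermediate
  -- arrow, one by straightening a zigzag of `r`, the other by straightening one of `q`.
  refine Eq.trans (b := (α_ _ _ _).hom ≫ P ◁ (α_ _ _ _).inv ≫ P ◁ ((β_ _ _).hom ▷ _) ≫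
    P ◁ (α_ _ _ _).hom ≫ (α_ _ _ _).inv ≫ h ▷ (M' ⊗ Q') ≫ (α_ _ _ _).hom ≫
      Q ◁ ((α_ _ _ _).inv ≫ p.ε ▷ _ ≫ (λ_ _).hom) ≫ s.ε) ?_ ?_
  · refine Eq.trans ?_ (r.zig_context ((α_ _ _ _).hom ≫ P ◁ (α_ _ _ _).inv ≫
      P ◁ ((β_ _ _).hom ▷ _) ≫ P ◁ (α_ _ _ _).hom ≫ (β_ _ _).hom)
        ((β_ _ _).hom ≫ (α_ _ _ _).inv ≫ h ▷ (M' ⊗ Q') ≫ (α_ _ _ _).hom ≫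
      Q ◁ ((α_ _ _ _).inv ≫ p.ε ▷ _ ≫ (λ_ _).hom) ≫ s.ε) |>.trans ?_)
    · have := gen p.ε 0; have := gen r.η 1; have := gen r.ε 2; have := gen s.ε 3
      have := gen h 4
      dsimp only [tensor, swap, bend]
      exact solve
    · have := gen p.ε 0; have := gen s.ε 3; have := gen h 4
      exact solve
  · refine Eq.symm (Eq.trans ?_ (q.zig_context (_ ◁ (β_ _ _).hom ≫ (α_ _ _ _).inv)
      ((α_ _ _ _).hom ≫ _ ◁ (β_ _ _).hom ≫ tensorμ P M' N Q' ≫ h ▷ (M' ⊗ Q') ≫ (α_ _ _ _).hom ≫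
        Q ◁ ((α_ _ _ _).inv ≫ p.ε ▷ _ ≫ (λ_ _).hom) ≫ s.ε) |>.trans ?_))
    · have := gen p.ε 0; have := gen q.η 1; have := gen q.ε 2; have := gen s.ε 3
      have := gen h 4
      dsimp only [tensor, swap, bend]
      exact solve
    · have := gen p.ε 0; have := gen s.ε 3; have := gen h 4
      exact solve

end Pairing

end Para

namespace Para

open Wiring

/-! ### Images of diagrams under strong monoidal functors -/

namespace Lifting

open Functor.LaxMonoidal Functor.OplaxMonoidal Functor.Monoidal

variable {C : Type u} [Category.{v} C] [MonoidalCategory C] [SymmetricCategory C]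
  {E : Type u'} [Category.{v'} E] [MonoidalCategory E] [SymmetricCategory E]
  (G : C ⥤ E) [G.Braided]

/-- The isomorphism onto the image of a tensor product. -/
def ten {X Y : C} {X' Y' : E} (m : X' ≅ G.obj X) (n : Y' ≅ G.obj Y) :
    X' ⊗ Y' ≅ G.obj (X ⊗ Y) := (m ⊗ᵢ n) ≪≫ μIso G X Y

/-- `X'` is the tensor product of the images of the factors of `X`. -/
class LObj (X : C) (X' : outParam E) (m : outParam (X' ≅ G.obj X)) : Prop where
  intro : True

instance (priority := low) (X : C) : LObj G X (G.obj X) (Iso.refl _) := ⟨trivial⟩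
instance : LObj G (𝟙_ C) (𝟙_ E) (εIso G) := ⟨trivial⟩
instance (X Y : C) (X' Y' : E) (m : X' ≅ G.obj X) (n : Y' ≅ G.obj Y) [LObj G X X' m]
    [LObj G Y Y' n] : LObj G (X ⊗ Y) (X' ⊗ Y') (ten G m n) := ⟨trivial⟩

/-- The image of an arrow, conjugated with isomorphisms. -/
def hatOf {X Y : C} {X' Y' : E} (m : X' ≅ G.obj X) (n : Y' ≅ G.obj Y) (f : X ⟶ Y) : X' ⟶ Y' :=
  m.hom ≫ G.map f ≫ n.inv

/-- `f'` is the image of the diagram `f`. -/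
class Lift {X Y : C} (f : X ⟶ Y) {X' Y' : E} (m : X' ≅ G.obj X) (n : Y' ≅ G.obj Y)
    (f' : outParam (X' ⟶ Y')) : Prop where
  eq : m.hom ≫ G.map f = f' ≫ n.hom

variable {G}

theorem lift {X Y : C} (f : X ⟶ Y) {X' Y' : E} {m : X' ≅ G.obj X} {n : Y' ≅ G.obj Y}
    {f' : X' ⟶ Y'} [LObj G X X' m] [LObj G Y Y' n] [h : Lift G f m n f'] : hatOf G m n f = f' := by
  rw [hatOf, ← Category.assoc, h.eq, Category.assoc, Iso.hom_inv_id, Category.comp_id]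

variable {X Y Z W : C} {X' Y' Z' W' : E} {a : X' ≅ G.obj X} {b : Y' ≅ G.obj Y} {c : Z' ≅ G.obj Z}
  {d : W' ≅ G.obj W}

/-- The fallback for arrows that are not structural: they stay as generators of the image diagram.
-/
instance (priority := low) (f : X ⟶ Y) : Lift G f a b (hatOf G a b f) := ⟨by simp [hatOf]⟩

instance : Lift G (𝟙 X) a a (𝟙 X') := ⟨by simp⟩

instance (f : X ⟶ Y) (g : Y ⟶ Z) (f' : X' ⟶ Y') (g' : Y' ⟶ Z') [LObj G Y Y' b]
    [hf : Lift G f a b f'] [hg : Lift G g b c g'] : Lift G (f ≫ g) a c (f' ≫ g') :=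
  ⟨by rw [G.map_comp, ← Category.assoc, hf.eq, Category.assoc, hg.eq, Category.assoc]⟩

instance (f : X ⟶ Y) (g : Z ⟶ W) (f' : X' ⟶ Y') (g' : Z' ⟶ W') [hf : Lift G f a b f']
    [hg : Lift G g c d g'] : Lift G (f ⊗ₘ g) (ten G a c) (ten G b d) (f' ⊗ₘ g') :=
  ⟨by
    simp only [ten, Iso.trans_hom, tensorIso_hom, μIso_hom, Category.assoc]
    rw [← μ_natural, ← Category.assoc, ← Category.assoc, tensorHom_comp_tensorHom, hf.eq, hg.eq,
      tensorHom_comp_tensorHom]⟩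

instance (f : X ⟶ Y) (f' : X' ⟶ Y') [hf : Lift G f a b f'] :
    Lift G (f ▷ Z) (ten G a c) (ten G b c) (f' ▷ Z') :=
  ⟨by
    rw [← tensorHom_id, ← tensorHom_id]
    exact Lift.eq⟩

instance (f : X ⟶ Y) (f' : X' ⟶ Y') [hf : Lift G f a b f'] :
    Lift G (Z ◁ f) (ten G c a) (ten G c b) (Z' ◁ f') :=
  ⟨by
    rw [← id_tensorHom, ← id_tensorHom]
    exact Lift.eq⟩

instance lift_associator :
    Lift G (α_ X Y Z).hom (ten G (ten G a b) c) (ten G a (ten G b c)) (α_ X' Y' Z').hom :=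
  ⟨by
    simp only [ten, Iso.trans_hom, tensorIso_hom, μIso_hom, Category.assoc]
    have h1 : ((a.hom ⊗ₘ b.hom) ≫ μ G X Y) ⊗ₘ c.hom =
        ((a.hom ⊗ₘ b.hom) ⊗ₘ c.hom) ≫ μ G X Y ▷ _ := by
      have := gen a.hom 0; have := gen b.hom 1; have := gen c.hom 2; have := gen (μ G X Y) 3
      exact solve
    have h2 : a.hom ⊗ₘ ((b.hom ⊗ₘ c.hom) ≫ μ G Y Z) =
        (a.hom ⊗ₘ (b.hom ⊗ₘ c.hom)) ≫ _ ◁ μ G Y Z := by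
      have := gen a.hom 0; have := gen b.hom 1; have := gen c.hom 2; have := gen (μ G Y Z) 3
      exact solve
    rw [h1, h2, Category.assoc, Category.assoc, Functor.LaxMonoidal.associativity,
      associator_naturality_assoc]⟩

theorem Lift.inv {f : X ≅ Y} {f' : X' ≅ Y'} (h : Lift G f.hom a b f'.hom) :
    Lift G f.inv b a f'.inv :=
  ⟨by rw [Iso.eq_inv_comp, ← Category.assoc, ← h.eq, Category.assoc, ← G.map_comp, f.hom_inv_id,
    G.map_id, Category.comp_id]⟩

instance : Lift G (α_ X Y Z).inv (ten G a (ten G b c)) (ten G (ten G a b) c) (α_ X' Y' Z').inv :=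
  Lift.inv lift_associator

instance : Lift G (β_ X Y).hom (ten G a b) (ten G b a) (β_ X' Y').hom :=
  ⟨by
    simp only [ten, Iso.trans_hom, tensorIso_hom, μIso_hom, Category.assoc]
    rw [Functor.LaxBraided.braided, BraidedCategory.braiding_naturality_assoc]⟩

instance lift_leftUnitor : Lift G (λ_ X).hom (ten G (εIso G) a) a (λ_ X').hom :=
  ⟨by
    simp only [ten, Iso.trans_hom, tensorIso_hom, μIso_hom, εIso_hom, Category.assoc]
    rw [← leftUnitor_naturality, Functor.LaxMonoidal.left_unitality,
      MonoidalCategory.tensorHom_def', Category.assoc]⟩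

instance lift_rightUnitor : Lift G (ρ_ X).hom (ten G a (εIso G)) a (ρ_ X').hom :=
  ⟨by
    simp only [ten, Iso.trans_hom, tensorIso_hom, μIso_hom, εIso_hom, Category.assoc]
    rw [← rightUnitor_naturality, Functor.LaxMonoidal.right_unitality,
      MonoidalCategory.tensorHom_def, Category.assoc]⟩

instance : Lift G (λ_ X).inv a (ten G (εIso G) a) (λ_ X').inv := Lift.inv lift_leftUnitor

instance : Lift G (ρ_ X).inv a (ten G a (εIso G)) (ρ_ X').inv := Lift.inv lift_rightUnitor

/-- Replaces the image of the traced object by the tensor product of the images of its factors, at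
the cost of a conjugation that `trace_conj` removes. -/
theorem hatOf_ten_right {U : C} {U' : E} (n : U' ≅ G.obj U) (f : X ⊗ U ⟶ Y ⊗ U) :
    hatOf G (ten G a (Iso.refl _)) (ten G b (Iso.refl _)) f =
      _ ◁ n.inv ≫ hatOf G (ten G a n) (ten G b n) f ≫ _ ◁ n.hom := by
  have h : ∀ {X : C} {X' : E} (a : X' ≅ G.obj X),
      ten G a (Iso.refl _) = whiskerLeftIso X' n.symm ≪≫ ten G a n := by
    intro X X' a
    ext
    simp only [ten, Iso.trans_hom, tensorIso_hom, Iso.refl_hom, whiskerLeftIso_hom, Iso.symm_hom,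
      ← id_tensorHom, tensorHom_comp_tensorHom_assoc, Iso.inv_hom_id, Category.id_comp]
  rw [h, h]
  simp [hatOf]

end Lifting

/-! ### The functor on the Int-construction determined by a functor on the base -/

namespace IntP

open Functor.LaxMonoidal Functor.OplaxMonoidal Functor.Monoidal Lifting Pairing

variable {C : Type u} [Category.{v} C] [MonoidalCategory C] [SymmetricCategory C]
  {E : Type u'} [Category.{v'} E] [MonoidalCategory E] [SymmetricCategory E]
  (G : C ⥤ E) [G.Braided] {dl : E → E} (pr : ∀ X : E, Pairing X (dl X))

/-- The image of an arrow between tensor products. -/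
def hat {a y b x : C} (f : a ⊗ y ⟶ b ⊗ x) : G.obj a ⊗ G.obj y ⟶ G.obj b ⊗ G.obj x :=
  μ G a y ≫ G.map f ≫ δ G b x

theorem hatOf_refl {a y b x : C} (f : a ⊗ y ⟶ b ⊗ x) :
    hatOf G (ten G (Iso.refl _) (Iso.refl _)) (ten G (Iso.refl _) (Iso.refl _)) f = hat G f := by
  simp [hatOf, ten, hat]

/-- `A⁺ ⊗ (A⁻)*` -/
abbrev kObj (dl : E → E) (X : IntP C) : E := G.obj X.pos ⊗ dl (G.obj X.neg)

/-- The image of an arrow, bent along the pairings. -/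
def kMap {X Y : IntP C} (f : X ⟶ Y) : kObj G dl X ⟶ kObj G dl Y :=
  bend (pr (G.obj X.neg)) (pr (G.obj Y.neg)) (hat G (IntP.Hom.arr f))

/-- The composite of the images of the arrows of a path. -/
def kPath {X : IntP C} : ∀ {Y : IntP C}, Path X Y → (kObj G dl X ⟶ kObj G dl Y)
  | _, .nil => 𝟙 _
  | _, .cons p e => kPath p ≫ kMap G pr e

/-- The arrow whose trace is the composite of a path. -/
def loopArr {X Y : IntP C} (p : Path X Y) :
    (X.pos ⊗ Y.neg) ⊗ negs p ⟶ (Y.pos ⊗ X.neg) ⊗ negs p :=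
  (α_ _ _ _).hom ≫ X.pos ◁ (β_ _ _).hom ≫ pre p ≫ (α_ _ _ _).inv

/-- The image of the arrow whose trace is the composite of a path. -/
def hatLoop {X Y : IntP C} (p : Path X Y) :
    (G.obj X.pos ⊗ G.obj Y.neg) ⊗ G.obj (negs p) ⟶ (G.obj Y.pos ⊗ G.obj X.neg) ⊗ G.obj (negs p) :=
  hatOf G (ten G (ten G (Iso.refl _) (Iso.refl _)) (Iso.refl _))
    (ten G (ten G (Iso.refl _) (Iso.refl _)) (Iso.refl _)) (loopArr p)

/-- By `bend_comp` every further arrow adds a trace over one negative object. The nested traces form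
a trace for the tensor product pairing, and by `trace_conj` this agrees with the trace for the given
dual of the image of the tensor product. -/
theorem kPath_eq {X Y : IntP C} (p : Path X Y) :
    kPath G pr p = bend (pr (G.obj X.neg)) (pr (G.obj Y.neg))
      ((pr (G.obj (negs p))).trace (hatLoop G p)) := by
  induction p with
  | nil =>
    refine (bend_id _).symm.trans (congrArg (bend _ _) ?_)
    have h : hatOf G (ten G (ten G (Iso.refl _) (Iso.refl _)) (εIso G))
        (ten G (ten G (Iso.refl _) (Iso.refl _)) (εIso G))
          (loopArr (Path.nil : Path X X)) = 𝟙 _ := by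
      dsimp only [loopArr, pre, negs]
      exact (lift _).trans solve
    have h' : hatLoop G (Path.nil : Path X X) = _ := hatOf_ten_right (εIso G) _
    rw [h', h]
    refine Eq.trans ?_ (trace_conj Pairing.unit (pr (G.obj (𝟙_ C))) (εIso G) (𝟙 _)).symm
    dsimp only [Pairing.trace, Pairing.unit]
    exact solve
  | @cons Y Z p e ih =>
    change kPath G pr p ≫ kMap G pr e = _
    rw [ih, kMap, bend_comp]
    refine congrArg (bend _ _) ?_
    have h3 : μIso G (negs p) Y.neg = ten G (Iso.refl _) (Iso.refl _) := by
      ext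
      simp [ten]
    have h4 : hatLoop G (p.cons e) = _ := hatOf_ten_right (μIso G (negs p) Y.neg) _
    rw [← hatOf_refl, h4]
    refine Eq.trans ?_ (trace_conj ((pr (G.obj (negs p))).tensor (pr (G.obj Y.neg)))
      (pr (G.obj (negs p ⊗ Y.neg))) (μIso G _ _) _).symm
    rw [h3]
    dsimp only [hatLoop, loopArr, pre, negs]
    refine Eq.trans (congrArg (fun t => Pairing.trace _ (twist (Pairing.trace _ t) _)) (lift _)) ?_
    refine Eq.trans ?_ (congrArg (Pairing.trace _) (lift _).symm)
    -- The images of the arrows and the units and counits become opaque generators: the remaining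
    -- identity needs no zigzag.
    generalize hatOf G _ _ (pre p) = P
    generalize hatOf G _ _ (IntP.Hom.arr e) = e'
    generalize pr (G.obj (negs p)) = p₁
    generalize pr (G.obj Y.neg) = p₂
    have := gen P 0; have := gen e' 1; have := gen p₁.η 2; have := gen p₁.ε 3
    have := gen p₂.η 4; have := gen p₂.ε 5
    dsimp only [Pairing.trace, Pairing.tensor, Pairing.twist]
    exact solve

/-- Trace preservation turns the image of the composite into the canonical trace of the image of the
loop. The structure isomorphisms on the untraced factors slide out of that trace, and `kPath_eq`
applies. -/
theorem hat_trace [PartialTrace C]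
    (hT : ∀ {A B U : C} (f : A ⊗ U ⟶ B ⊗ U) (g : A ⟶ B), g ∈ PartialTrace.tr f →
      G.map g = (pr (G.obj U)).trace (hat G f)) {X Y : IntP C} {p : Path X Y} {f : X ⟶ Y}
    (h : f ∈ pcomp p) : kMap G pr f = kPath G pr p := by
  obtain ⟨g, hg, rfl⟩ := (Part.mem_map_iff _).1 h
  rw [kPath_eq, kMap]
  refine congrArg (bend _ _) ?_
  have h1 := hT _ _ hg
  dsimp only [hat] at h1 ⊢
  rw [h1]
  have h2 : hatLoop G p = μ G _ _ ▷ _ ≫ (μ G _ _ ≫ G.map (loopArr p) ≫ δ G _ _) ≫ δ G _ _ ▷ _ := by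
    simp [hatLoop, hatOf, ten]
  rw [h2]
  change _ ≫ Pairing.trace (pr (G.obj (negs p))) (μ G _ _ ≫ G.map (loopArr p) ≫ δ G _ _) ≫ _ = _
  generalize (μ G _ _ ≫ G.map (loopArr p) ≫ δ G _ _) = t
  generalize pr (G.obj (negs p)) = p₁
  generalize μ G _ _ = m
  generalize δ G _ _ = n
  have := gen t 0; have := gen m 1; have := gen p₁.η 2; have := gen p₁.ε 3; have := gen n 4
  dsimp only [Pairing.trace]
  exact solve

end IntP

end Para

/-! ### The structure isomorphisms of the extension -/

namespace Para

open Wiring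

namespace IntP

open Functor.LaxMonoidal Functor.OplaxMonoidal Functor.Monoidal Lifting Pairing

section structure_arrows

variable {C : Type u} [Category.{v} C] [MonoidalCategory C] [SymmetricCategory C]
  {E : Type u'} [Category.{v'} E] [MonoidalCategory E] [SymmetricCategory E]
  (G : C ⥤ E) [G.Braided] {dl : E → E} (pr : ∀ X : E, Pairing X (dl X))

/-- The dual of a tensor product. -/
def dualTen (x y : C) : dl (G.obj x) ⊗ dl (G.obj y) ≅ dl (G.obj (y ⊗ x)) :=
  mateIso ((pr (G.obj y)).tensor (pr (G.obj x))) (pr (G.obj (y ⊗ x))) (μIso G y x).symm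

theorem dualTen_hom (x y : C) : (dualTen G pr x y).hom =
    mate ((pr (G.obj y)).tensor (pr (G.obj x))) (pr (G.obj (y ⊗ x))) (δ G y x) := rfl

/-- The dual of the unit. -/
def dualUnit : 𝟙_ E ≅ dl (G.obj (𝟙_ C)) :=
  mateIso Pairing.unit (pr (G.obj (𝟙_ C))) (εIso G).symm

theorem dualUnit_hom : (dualUnit G pr).hom =
    mate Pairing.unit (pr (G.obj (𝟙_ C))) (η G) := rfl

/-- The structure isomorphism `KX ⊗ KY ≅ K(X ⊗ Y)`. -/
def kTen (a x b y : C) : (G.obj a ⊗ dl (G.obj x)) ⊗ (G.obj b ⊗ dl (G.obj y)) ≅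
    G.obj (a ⊗ b) ⊗ dl (G.obj (y ⊗ x)) where
  hom := tensorμ _ _ _ _ ≫ (μ G a b ⊗ₘ (dualTen G pr x y).hom)
  inv := (δ G a b ⊗ₘ (dualTen G pr x y).inv) ≫ tensorμ _ _ _ _
  hom_inv_id := by
    rw [Category.assoc, tensorHom_comp_tensorHom_assoc, μ_δ, Iso.hom_inv_id, id_tensorHom_id]
    exact solve
  inv_hom_id := by
    have h : tensorμ (G.obj a) (G.obj b) (dl (G.obj x)) (dl (G.obj y)) ≫
        tensorμ (G.obj a) (dl (G.obj x)) (G.obj b) (dl (G.obj y)) = 𝟙 _ := solve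
    rw [Category.assoc, reassoc_of% h, tensorHom_comp_tensorHom, δ_μ, Iso.inv_hom_id,
      id_tensorHom_id]

/-- The structure isomorphism `I ≅ KI`. -/
def kUnit : 𝟙_ E ≅ G.obj (𝟙_ C) ⊗ dl (G.obj (𝟙_ C)) :=
  (λ_ _).symm ≪≫ (εIso G ⊗ᵢ dualUnit G pr)

theorem kUnit_hom : (kUnit G pr).hom = (λ_ _).inv ≫ (ε G ⊗ₘ (dualUnit G pr).hom) := rfl

theorem hat_tensorHom {a y b x : C} (s : a ⟶ b) (t : y ⟶ x) :
    hat G (s ⊗ₘ t) = G.map s ⊗ₘ G.map t := by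
  rw [hat, ← μ_natural_assoc, μ_δ, Category.comp_id]

theorem bend_hat_tensorHom {a y b x : C} (s : a ⟶ b) (t : y ⟶ x) :
    bend (pr (G.obj x)) (pr (G.obj y)) (hat G (s ⊗ₘ t)) =
      G.map s ⊗ₘ mate (pr (G.obj x)) (pr (G.obj y)) (G.map t) := by
  rw [hat_tensorHom, bend_tensorHom]

theorem hat_cross {a a' b b' x x' y y' : C} (f : a ⊗ x' ⟶ a' ⊗ x) (g : b ⊗ y' ⟶ b' ⊗ y) :
    (μ G a b) ▷ G.obj (y' ⊗ x') ≫ hat G (cross f g) ≫ _ ◁ δ G y x =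
      _ ◁ δ G y' x' ≫ cross (hat G f) (hat G g) ≫ (μ G a' b') ▷ _ := by
  have h : hatOf G (ten G (ten G (Iso.refl _) (Iso.refl _)) (ten G (Iso.refl _) (Iso.refl _)))
      (ten G (ten G (Iso.refl _) (Iso.refl _)) (ten G (Iso.refl _) (Iso.refl _))) (cross f g) =
        cross (hat G f) (hat G g) := by
    rw [← hatOf_refl, ← hatOf_refl]
    dsimp only [cross, tensorμ]
    exact lift _
  rw [← h]
  simp only [hatOf, ten, hat, Iso.trans_hom, Iso.trans_inv, tensorIso_hom, tensorIso_inv,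
    Iso.refl_hom, Iso.refl_inv, id_tensorHom_id, Category.id_comp, Category.comp_id, μIso_hom,
    μIso_inv, Category.assoc]
  generalize G.map (cross f g) = t
  have h1 : δ G a' b' ▷ (G.obj y ⊗ G.obj x) ≫ μ G a' b' ▷ (G.obj y ⊗ G.obj x) = 𝟙 _ := by
    rw [← comp_whiskerRight, δ_μ, id_whiskerRight]
  have h2 : (G.obj a ⊗ G.obj b) ◁ δ G y' x' ≫ (G.obj a ⊗ G.obj b) ◁ μ G y' x' = 𝟙 _ := by
    rw [← MonoidalCategory.whiskerLeft_comp, δ_μ, MonoidalCategory.whiskerLeft_id]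
  simp only [MonoidalCategory.tensorHom_def, Category.assoc, h1, Category.comp_id,
    ← whisker_exchange]
  rw [reassoc_of% h2]

/-- Bending along tensor product pairings respects the crossed tensor product. Passing to the given
duals is naturality of bending with respect to transposition. -/
theorem kTen_natural {a a' b b' x x' y y' : C} (f : a ⊗ x' ⟶ a' ⊗ x) (g : b ⊗ y' ⟶ b' ⊗ y) :
    (bend (pr (G.obj x)) (pr (G.obj x')) (hat G f) ⊗ₘ bend (pr (G.obj y)) (pr (G.obj y')) (hat G g)) ≫
      (kTen G pr a' x' b' y').hom = (kTen G pr a x b y).hom ≫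
        bend (pr (G.obj (y ⊗ x))) (pr (G.obj (y' ⊗ x'))) (hat G (cross f g)) := by
  dsimp only [kTen]
  rw [← Category.assoc, ← bend_cross, Category.assoc, Category.assoc, dualTen_hom, dualTen_hom]
  refine congrArg (_ ≫ ·) ?_
  exact (bend_natural _ _ _ _ (hat_cross G f g)).symm

theorem mate_associator_hom {M M' N N' L L' : E} (p : Pairing M M') (q : Pairing N N')
    (r : Pairing L L') :
    mate (p.tensor (q.tensor r)) ((p.tensor q).tensor r) (α_ _ _ _).hom = (α_ _ _ _).hom := by
  refine (eq_mate _ _ ?_).symm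
  have := gen p.ε 0; have := gen q.ε 1; have := gen r.ε 2
  dsimp only [Pairing.tensor]
  exact solve

/-- Every arrow occurring here is a transpose, so the equation is the transpose of the
coassociativity of `G`. The later identities for duals of tensor products are reduced to `G` in the
same way. -/
theorem dualTen_assoc (x y z : C) :
    (dualTen G pr x y).hom ▷ _ ≫ (dualTen G pr (y ⊗ x) z).hom ≫
      mate (pr (G.obj (z ⊗ (y ⊗ x)))) (pr (G.obj ((z ⊗ y) ⊗ x))) (G.map (α_ z y x).hom) =
    (α_ _ _ _).hom ≫ _ ◁ (dualTen G pr y z).hom ≫ (dualTen G pr x (z ⊗ y)).hom := by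
  rw [← mate_associator_hom (pr (G.obj z)) (pr (G.obj y)) (pr (G.obj x)), ← tensorHom_id,
    ← id_tensorHom, ← mate_id (pr (G.obj x)), ← mate_id (pr (G.obj z))]
  simp only [dualTen_hom]
  rw [tensor_mate, tensor_mate, mate_comp, mate_comp, mate_comp, mate_comp]
  refine congrArg (mate _ _) ?_
  simp only [id_tensorHom, tensorHom_id, Category.assoc]
  exact (Functor.OplaxMonoidal.associativity (F := G) z y x).symm

theorem kTen_assoc (a x b y c z : C) :
    (kTen G pr a x b y).hom ▷ _ ≫ (kTen G pr (a ⊗ b) (y ⊗ x) c z).hom ≫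
      (G.map (α_ a b c).hom ⊗ₘ
        mate (pr (G.obj (z ⊗ (y ⊗ x)))) (pr (G.obj ((z ⊗ y) ⊗ x))) (G.map (α_ z y x).hom)) =
    (α_ _ _ _).hom ≫ _ ◁ (kTen G pr b y c z).hom ≫ (kTen G pr a x (b ⊗ c) (z ⊗ y)).hom := by
  refine Eq.trans (b := tensorμ _ _ _ _ ▷ _ ≫ tensorμ _ _ _ _ ≫
    ((μ G a b ▷ _ ≫ μ G (a ⊗ b) c ≫ G.map (α_ a b c).hom) ⊗ₘ ((dualTen G pr x y).hom ▷ _ ≫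
      (dualTen G pr (y ⊗ x) z).hom ≫
      mate (pr (G.obj (z ⊗ (y ⊗ x)))) (pr (G.obj ((z ⊗ y) ⊗ x))) (G.map (α_ z y x).hom)))) ?_ ?_
  · generalize mate (pr (G.obj (z ⊗ (y ⊗ x)))) (pr (G.obj ((z ⊗ y) ⊗ x)))
      (G.map (α_ z y x).hom) = t
    have := gen (μ G a b) 0; have := gen (μ G (a ⊗ b) c) 1; have := gen (G.map (α_ a b c).hom) 2
    have := gen (dualTen G pr x y).hom 3; have := gen (dualTen G pr (y ⊗ x) z).hom 4
    have := gen t 5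
    dsimp only [kTen]
    exact solve
  · rw [dualTen_assoc, Functor.LaxMonoidal.associativity]
    have := gen (μ G b c) 0; have := gen (μ G a (b ⊗ c)) 1
    have := gen (dualTen G pr y z).hom 3; have := gen (dualTen G pr x (z ⊗ y)).hom 4
    dsimp only [kTen]
    exact solve

theorem dualTen_unit_left (x : C) :
    (dualUnit G pr).hom ▷ _ ≫ (dualTen G pr (𝟙_ C) x).hom ≫
      mate (pr (G.obj (x ⊗ 𝟙_ C))) (pr (G.obj x)) (G.map (ρ_ x).inv) = (λ_ _).hom := by
  rw [← cancel_epi (λ_ _).inv, Iso.inv_hom_id, ← mate_rightUnitor (pr (G.obj x)), ← tensorHom_id,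
    ← mate_id (pr (G.obj x))]
  simp only [dualTen_hom, dualUnit_hom]
  rw [tensor_mate, mate_comp, mate_comp, mate_comp]
  refine congrArg (mate _ _) ?_
  simp only [id_tensorHom, Category.assoc]
  rw [← cancel_mono (ρ_ (G.obj x)).inv]
  simp

theorem dualTen_unit_right (x : C) :
    _ ◁ (dualUnit G pr).hom ≫ (dualTen G pr x (𝟙_ C)).hom ≫
      mate (pr (G.obj (𝟙_ C ⊗ x))) (pr (G.obj x)) (G.map (λ_ x).inv) = (ρ_ _).hom := by
  rw [← cancel_epi (ρ_ _).inv, Iso.inv_hom_id, ← mate_leftUnitor (pr (G.obj x)), ← id_tensorHom,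
    ← mate_id (pr (G.obj x))]
  simp only [dualTen_hom, dualUnit_hom]
  rw [tensor_mate, mate_comp, mate_comp, mate_comp]
  refine congrArg (mate _ _) ?_
  simp only [tensorHom_id, Category.assoc]
  rw [← cancel_mono (λ_ (G.obj x)).inv]
  simp

theorem kTen_left_unit (a x : C) :
    (kUnit G pr).hom ▷ _ ≫ (kTen G pr (𝟙_ C) (𝟙_ C) a x).hom ≫
      (G.map (λ_ a).hom ⊗ₘ mate (pr (G.obj (x ⊗ 𝟙_ C))) (pr (G.obj x)) (G.map (ρ_ x).inv)) =
    (λ_ _).hom := by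
  refine Eq.trans (b := (λ_ _).inv ▷ _ ≫ tensorμ _ _ _ _ ≫
    ((ε G ▷ _ ≫ μ G (𝟙_ C) a ≫ G.map (λ_ a).hom) ⊗ₘ ((dualUnit G pr).hom ▷ _ ≫
      (dualTen G pr (𝟙_ C) x).hom ≫
      mate (pr (G.obj (x ⊗ 𝟙_ C))) (pr (G.obj x)) (G.map (ρ_ x).inv)))) ?_ ?_
  · generalize mate (pr (G.obj (x ⊗ 𝟙_ C))) (pr (G.obj x)) (G.map (ρ_ x).inv) = t
    have := gen (ε G) 0; have := gen (μ G (𝟙_ C) a) 1; have := gen (G.map (λ_ a).hom) 2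
    have := gen (dualUnit G pr).hom 3; have := gen (dualTen G pr (𝟙_ C) x).hom 4
    have := gen t 5
    rw [kUnit_hom]
    dsimp only [kTen]
    exact solve
  · rw [dualTen_unit_left, ← Functor.LaxMonoidal.left_unitality]
    exact solve

theorem kTen_right_unit (a x : C) :
    _ ◁ (kUnit G pr).hom ≫ (kTen G pr a x (𝟙_ C) (𝟙_ C)).hom ≫
      (G.map (ρ_ a).hom ⊗ₘ mate (pr (G.obj (𝟙_ C ⊗ x))) (pr (G.obj x)) (G.map (λ_ x).inv)) =
    (ρ_ _).hom := by
  refine Eq.trans (b := _ ◁ (λ_ _).inv ≫ tensorμ _ _ _ _ ≫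
    ((_ ◁ ε G ≫ μ G a (𝟙_ C) ≫ G.map (ρ_ a).hom) ⊗ₘ (_ ◁ (dualUnit G pr).hom ≫
      (dualTen G pr x (𝟙_ C)).hom ≫
      mate (pr (G.obj (𝟙_ C ⊗ x))) (pr (G.obj x)) (G.map (λ_ x).inv)))) ?_ ?_
  · generalize mate (pr (G.obj (𝟙_ C ⊗ x))) (pr (G.obj x)) (G.map (λ_ x).inv) = t
    have := gen (ε G) 0; have := gen (μ G a (𝟙_ C)) 1; have := gen (G.map (ρ_ a).hom) 2
    have := gen (dualUnit G pr).hom 3; have := gen (dualTen G pr x (𝟙_ C)).hom 4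
    have := gen t 5
    rw [kUnit_hom]
    dsimp only [kTen]
    exact solve
  · rw [dualTen_unit_right, ← Functor.LaxMonoidal.right_unitality]
    exact solve

theorem dualTen_symm (x y : C) :
    (dualTen G pr x y).hom ≫ mate (pr (G.obj (y ⊗ x))) (pr (G.obj (x ⊗ y)))
      (G.map (β_ x y).hom) = (β_ _ _).hom ≫ (dualTen G pr y x).hom := by
  rw [← mate_braiding (pr (G.obj y)) (pr (G.obj x))]
  simp only [dualTen_hom]
  rw [mate_comp, mate_comp]
  refine congrArg (mate _ _) ?_
  simp

theorem kTen_symm (a x b y : C) :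
    (kTen G pr a x b y).hom ≫ (G.map (β_ a b).hom ⊗ₘ
      mate (pr (G.obj (y ⊗ x))) (pr (G.obj (x ⊗ y))) (G.map (β_ x y).hom)) =
    (β_ _ _).hom ≫ (kTen G pr b y a x).hom := by
  dsimp only [kTen]
  rw [Category.assoc, tensorHom_comp_tensorHom, dualTen_symm, Functor.LaxBraided.braided]
  have := gen (μ G b a) 0; have := gen (dualTen G pr y x).hom 1
  exact solve

theorem hat_braiding (a b : C) : hat G (β_ a b).hom = (β_ _ _).hom := by
  simp [hat]

theorem hat_braiding_conj {a b x y : C} (f : a ⊗ y ⟶ b ⊗ x) :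
    hat G ((β_ y a).hom ≫ f ≫ (β_ b x).hom) = (β_ _ _).hom ≫ hat G f ≫ (β_ _ _).hom := by
  rw [← hatOf_refl, ← hatOf_refl]
  exact lift _

/-- The pairing of `KX` with `KX*`. -/
def kPairing (a x : C) : Pairing (G.obj a ⊗ dl (G.obj x)) (G.obj x ⊗ dl (G.obj a)) :=
  (pr (G.obj a)).tensor (pr (G.obj x)).swap

/-- Sliding the unit isomorphism of `G` across the pairing shows that `kUnit` is the unit of the
dual of the image of `I`, in the form in which `bend_braiding` produces it. -/
theorem kUnit_eq : (kUnit G pr).hom = (pr (G.obj (𝟙_ C))).η ≫ (β_ _ _).hom := by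
  have h := mate_η Pairing.unit (pr (G.obj (𝟙_ C))) (η G)
  have h' : (pr (G.obj (𝟙_ C))).η = ((pr (G.obj (𝟙_ C))).η ≫ _ ◁ η G) ≫ _ ◁ ε G := by
    simp [← MonoidalCategory.whiskerLeft_comp]
  rw [h', ← h, kUnit_hom, dualUnit_hom]
  generalize mate Pairing.unit (pr (G.obj (𝟙_ C))) (η G) = w
  have := gen w 0; have := gen (ε G) 1
  dsimp only [Pairing.unit]
  exact solve

theorem kUnit_comp_ε : (kUnit G pr).hom ≫ (pr (G.obj (𝟙_ C))).ε = 𝟙 _ := by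
  have h := mate_ε Pairing.unit (pr (G.obj (𝟙_ C))) (η G)
  have h1 : (kUnit G pr).hom ≫ (pr (G.obj (𝟙_ C))).ε =
      (λ_ _).inv ≫ ε G ▷ _ ≫ _ ◁ (dualUnit G pr).hom ≫ (pr (G.obj (𝟙_ C))).ε := by
    rw [kUnit_hom, MonoidalCategory.tensorHom_def]
    simp
  rw [h1, dualUnit_hom, h, ← comp_whiskerRight_assoc, Functor.Monoidal.ε_η]
  simp [Pairing.unit]

theorem kTen_comp_ε (a x : C) :
    (kTen G pr a x x a).hom ≫ (pr (G.obj (a ⊗ x))).ε = (kPairing G pr a x).ε := by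
  have h := mate_ε ((pr (G.obj a)).tensor (pr (G.obj x))) (pr (G.obj (a ⊗ x))) (δ G a x)
  dsimp only [kTen]
  rw [MonoidalCategory.tensorHom_def, Category.assoc, Category.assoc, dualTen_hom, h,
    ← comp_whiskerRight_assoc, μ_δ, id_whiskerRight, Category.id_comp]
  dsimp only [kPairing]
  generalize pr (G.obj a) = p
  generalize pr (G.obj x) = q
  have := gen p.ε 0; have := gen q.ε 1
  dsimp only [Pairing.tensor, Pairing.swap]
  exact solve

/-- The counit of the Int-construction is, up to coherence, the symmetry with the unit object, so
its bend splits by `bend_braiding`. -/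
theorem kTen_eps (a x : C) :
    (kTen G pr a x x a).hom ≫ bend (pr (G.obj (a ⊗ x))) (pr (G.obj (𝟙_ C)))
      (hat G ((ρ_ _).hom ≫ (λ_ _).inv)) = (kPairing G pr a x).ε ≫ (kUnit G pr).hom := by
  have h : (ρ_ (a ⊗ x)).hom ≫ (λ_ (a ⊗ x)).inv = (β_ _ _).hom := solve
  rw [h, hat_braiding, bend_braiding, ← kUnit_eq, reassoc_of% kTen_comp_ε]

theorem kTen_eta (a x : C) :
    (kUnit G pr).hom ≫ bend (pr (G.obj (𝟙_ C))) (pr (G.obj (x ⊗ a)))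
      (hat G ((λ_ _).hom ≫ (ρ_ _).inv)) = (kPairing G pr a x).η ≫ (kTen G pr x a a x).hom := by
  have h : (λ_ (x ⊗ a)).hom ≫ (ρ_ (x ⊗ a)).inv = (β_ _ _).hom := solve
  have h' := mate_η ((pr (G.obj x)).tensor (pr (G.obj a))) (pr (G.obj (x ⊗ a))) (δ G x a)
  have h'' : (pr (G.obj (x ⊗ a))).η = ((pr (G.obj (x ⊗ a))).η ≫ _ ◁ δ G x a) ≫ _ ◁ μ G x a := by
    simp [← MonoidalCategory.whiskerLeft_comp]
  rw [h, hat_braiding, bend_braiding, reassoc_of% kUnit_comp_ε, h'', ← h']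
  dsimp only [kTen, kPairing]
  rw [dualTen_hom]
  generalize mate ((pr (G.obj x)).tensor (pr (G.obj a))) (pr (G.obj (x ⊗ a))) (δ G x a) = w
  generalize pr (G.obj a) = p at *
  generalize pr (G.obj x) = q at *
  have := gen p.η 0; have := gen q.η 1; have := gen (μ G x a) 2; have := gen w 3
  dsimp only [Pairing.tensor, Pairing.swap]
  exact solve

theorem bend_dual {a b x y : C} (f : a ⊗ y ⟶ b ⊗ x) :
    bend (pr (G.obj b)) (pr (G.obj a)) (hat G ((β_ y a).hom ≫ f ≫ (β_ b x).hom)) =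
      mate (kPairing G pr b y) (kPairing G pr a x)
        (bend (pr (G.obj x)) (pr (G.obj y)) (hat G f)) := by
  rw [hat_braiding_conj, kPairing, kPairing, mate_bend]

/-- The isomorphism `K(NA) ≅ GA`. -/
def kTheta (a : C) : G.obj a ⊗ dl (G.obj (𝟙_ C)) ≅ G.obj a :=
  whiskerLeftIso _ (dualUnit G pr).symm ≪≫ ρ_ _

theorem kTheta_hom (a : C) : (kTheta G pr a).hom = _ ◁ (dualUnit G pr).inv ≫ (ρ_ _).hom := rfl

theorem kTheta_natural {a b : C} (f : a ⟶ b) :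
    (G.map f ⊗ₘ mate (pr (G.obj (𝟙_ C))) (pr (G.obj (𝟙_ C))) (G.map (𝟙 _))) ≫ (kTheta G pr b).hom =
      (kTheta G pr a).hom ≫ G.map f := by
  rw [G.map_id, mate_id, tensorHom_id, kTheta_hom, kTheta_hom]
  have := gen (G.map f) 0; have := gen (dualUnit G pr).inv 1
  exact solve

theorem tensor_unit_aux {A B D X Y : E} (m : A ⊗ B ⟶ D) (u : X ⟶ 𝟙_ E) (v : Y ⟶ 𝟙_ E) :
    ((A ◁ u ≫ (ρ_ _).hom) ⊗ₘ (B ◁ v ≫ (ρ_ _).hom)) ≫ m =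
      tensorμ _ _ _ _ ≫ (m ⊗ₘ (u ▷ Y ≫ (λ_ _).hom)) ≫ D ◁ v ≫ (ρ_ _).hom := by
  have := gen m 0; have := gen u 1; have := gen v 2
  exact solve

theorem kTheta_monoidal (a b : C) :
    ((kTheta G pr a).hom ⊗ₘ (kTheta G pr b).hom) ≫ μ G a b =
      (kTen G pr a (𝟙_ C) b (𝟙_ C)).hom ≫ (G.map (𝟙 (a ⊗ b)) ⊗ₘ
        mate (pr (G.obj (𝟙_ C ⊗ 𝟙_ C))) (pr (G.obj (𝟙_ C))) (G.map (ρ_ (𝟙_ C)).inv)) ≫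
          (kTheta G pr (a ⊗ b)).hom := by
  have h := dualTen_unit_left G pr (𝟙_ C)
  have h' : (dualTen G pr (𝟙_ C) (𝟙_ C)).hom ≫
      mate (pr (G.obj (𝟙_ C ⊗ 𝟙_ C))) (pr (G.obj (𝟙_ C))) (G.map (ρ_ (𝟙_ C)).inv) =
        (dualUnit G pr).inv ▷ _ ≫ (λ_ _).hom := by
    rw [← h, ← comp_whiskerRight_assoc, Iso.inv_hom_id, id_whiskerRight, Category.id_comp]
  dsimp only [kTen]
  rw [Category.assoc, tensorHom_comp_tensorHom_assoc, h', G.map_id, Category.comp_id]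
  simp only [kTheta_hom]
  exact tensor_unit_aux _ _ _

theorem kTheta_unit :
    (kUnit G pr).hom ≫ (G.map (𝟙 (𝟙_ C)) ⊗ₘ
      mate (pr (G.obj (𝟙_ C))) (pr (G.obj (𝟙_ C))) (G.map (𝟙 _))) ≫ (kTheta G pr (𝟙_ C)).hom =
        ε G := by
  rw [G.map_id, mate_id, id_tensorHom_id, Category.id_comp, kUnit_hom, kTheta_hom]
  rw [Category.assoc, ← id_tensorHom, tensorHom_comp_tensorHom_assoc, Iso.hom_inv_id]
  have := gen (ε G) 0
  exact solve

end structure_arrows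

end IntP

end Para

/-! ### Functors of symmetric monoidal paracategories as functors between envelopes -/

namespace Para

open ParacategoryStruct MonoidalParaStruct Env

namespace IsTotalIso

variable {D : Type u} [MonoidalParaStruct.{v} D] [IsSymmMonoidalParacategory D] {A B : D}
  {m : A ⟶ B} {n : B ⟶ A}

/-- A total isomorphism is an isomorphism of the envelope. -/
def iso (h : IsTotalIso m n) : Env.of A ≅ Env.of B where
  hom := ι m
  inv := ι n
  hom_inv_id := (comp_eq_some.1 h.hom_inv).trans (ι_one A)
  inv_hom_id := (comp_eq_some.1 h.inv_hom).trans (ι_one B)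

theorem tot_hom (h : IsTotalIso m n) : Tot (ι m) where
  comp_left := by
    rintro Z W _ ⟨f, rfl⟩
    exact rep_mk (h.hom_total_left (E := Z.obj) f)
  comp_right := by
    rintro Z W _ ⟨f, rfl⟩
    exact rep_mk (h.hom_total_right (E := Z.obj) f)

theorem tot_inv (h : IsTotalIso m n) : Tot (ι n) where
  comp_left := by
    rintro Z W _ ⟨f, rfl⟩
    exact rep_mk (h.inv_total_left (E := Z.obj) f)
  comp_right := by
    rintro Z W _ ⟨f, rfl⟩
    exact rep_mk (h.inv_total_right (E := Z.obj) f)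

theorem of_iso (e : Env.of A ≅ Env.of B) (he : e.hom = ι m) (he' : e.inv = ι n) (hm : Tot e.hom)
    (hn : Tot e.inv) : IsTotalIso m n where
  hom_inv := comp_eq_some.2 ((ι_one A).symm ▸ (he ▸ he' ▸ e.hom_inv_id : ι m ≫ ι n = 𝟙 _))
  inv_hom := comp_eq_some.2 ((ι_one B).symm ▸ (he ▸ he' ▸ e.inv_hom_id : ι n ≫ ι m = 𝟙 _))
  hom_total_left f := dom_of_rep ((he ▸ hm).comp_left (Z := .of _) (rep_ι f))
  hom_total_right f := dom_of_rep ((he ▸ hm).comp_right (Z := .of _) (rep_ι f))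
  inv_total_left f := dom_of_rep ((he' ▸ hn).comp_left (Z := .of _) (rep_ι f))
  inv_total_right f := dom_of_rep ((he' ▸ hn).comp_right (Z := .of _) (rep_ι f))

end IsTotalIso

namespace MonoidalFunctorData.IsSymmMonoidal

section equations

variable {C : Type u} [MonoidalParaStruct.{v} C] {D : Type u'} [MonoidalParaStruct.{v'} D]
  [IsSymmMonoidalParacategory D] {F : MonoidalFunctorData C D}

theorem tot_m (hF : F.IsSymmMonoidal) (A B : C) : Tot (ι (F.m A B)) := (hF.m_total A B).tot_hom

theorem ι_map_of_mem (hF : F.IsSymmMonoidal) {A B : C} {p : Path A B} {f : A ⟶ B} (h : f ∈ comp p) :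
    ι (F.map f) = Env.mk (F.mapPath p) :=
  (mk_eq_ι (hF.functor p _ (Part.mem_map _ h))).symm

theorem m_naturality (hF : F.IsSymmMonoidal) {A A' B B' : C} (f : A ⟶ A') (g : B ⟶ B') :
    (ι (F.map f) ⊗ₘ ι (F.map g)) ≫ ι (F.m A' B') = ι (F.m A B) ≫ ι (F.map (f ⊠ₘ g)) := by
  rw [← ι_tHom]
  exact mk_eq_mk (hF.m_natural f g) (dom_of_rep ((hF.tot_m _ _).comp_rep (rep_ι _)))

theorem m_associativity (hF : F.IsSymmMonoidal) (A B E : C) :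
    ι (F.m A B) ▷ Env.of (F.obj E) ≫ ι (F.m (A ⊠ B) E) ≫ ι (F.map (asc A B E)) =
      (α_ (Env.of (F.obj A)) (Env.of (F.obj B)) (Env.of (F.obj E))).hom ≫
        Env.of (F.obj A) ◁ ι (F.m B E) ≫ ι (F.m A (B ⊠ E)) := by
  have h := mk_eq_mk (hF.m_assoc A B E) (dom_of_rep (((hF.tot_m _ _).whiskerRight _).rep_comp
    ((hF.tot_m _ _).rep_comp (rep_ι (F.map (asc A B E))))))
  simp only [mk_cons, mk_nil, Category.id_comp, Category.assoc, ι_asc] at h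
  exact h

theorem m_left_unitality (hF : F.IsSymmMonoidal) (A : C) :
    (λ_ (Env.of (F.obj A))).hom = ι F.mI ▷ Env.of (F.obj A) ≫ ι (F.m unit A) ≫ ι (F.map (lun A)) := by
  have h := comp_eq_some.1 (hF.m_left_unit A)
  simp only [mk_cons, mk_nil, Category.id_comp, Category.assoc, ι_lun] at h
  exact h.symm

theorem m_right_unitality (hF : F.IsSymmMonoidal) (A : C) :
    (ρ_ (Env.of (F.obj A))).hom = Env.of (F.obj A) ◁ ι F.mI ≫ ι (F.m A unit) ≫ ι (F.map (run A)) := by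
  have h := comp_eq_some.1 (hF.m_right_unit A)
  simp only [mk_cons, mk_nil, Category.id_comp, Category.assoc, ι_run] at h
  exact h.symm

theorem m_braided (hF : F.IsSymmMonoidal) (A B : C) :
    ι (F.m A B) ≫ ι (F.map (symm A B)) =
      (β_ (Env.of (F.obj A)) (Env.of (F.obj B))).hom ≫ ι (F.m B A) :=
  mk_eq_mk (hF.m_symm A B) (dom_of_rep ((hF.tot_m _ _).rep_comp (rep_ι _)))

end equations

section envelope

variable {C : Type u} [MonoidalParaStruct.{v} C] [IsSymmMonoidalParacategory C] {D : Type u'}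
  [MonoidalParaStruct.{v'} D] [IsSymmMonoidalParacategory D] {F : MonoidalFunctorData C D}
  (hF : F.IsSymmMonoidal)

/-- The functor between envelopes. -/
def env : Env C ⥤ Env D := Env.map F.toPrefunctor hF.functor

theorem env_map_ι {A B : C} (f : A ⟶ B) : hF.env.map (ι f) = ι (F.map f) := rfl

theorem ι_map_one (hF : F.IsSymmMonoidal) (A : C) : ι (F.map (one A)) = 𝟙 _ :=
  hF.ι_map_of_mem (Part.eq_some_iff.1 (IsParacategory.comp_nil A))

/-- The functor between envelopes is strong monoidal. -/
def envCore : hF.env.CoreMonoidal where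
  εIso := hF.mI_total.iso
  μIso X Y := (hF.m_total X.obj Y.obj).iso
  μIso_hom_natural_left {X Y} x Z := by
    induction x using hom_induction with
    | nil X => simp
    | @cons X Y x B f ih =>
      simp only [Functor.map_comp, comp_whiskerRight, Category.assoc]
      have h := hF.m_naturality f (one Z.obj)
      rw [hF.ι_map_one, tensorHom_id] at h
      rw [← reassoc_of% ih]
      exact congrArg (_ ≫ ·) h
  μIso_hom_natural_right {X Y} Z x := by
    induction x using hom_induction with
    | nil X => simp
    | @cons X Y x B f ih =>
      simp only [Functor.map_comp, MonoidalCategory.whiskerLeft_comp, Category.assoc]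
      have h := hF.m_naturality (one Z.obj) f
      rw [hF.ι_map_one, id_tensorHom] at h
      rw [← reassoc_of% ih]
      exact congrArg (_ ≫ ·) h
  associativity X Y Z := by
    refine Eq.trans ?_ (hF.m_associativity X.obj Y.obj Z.obj)
    rw [← env_map_ι, ι_asc]
    rfl
  left_unitality X := by
    refine (hF.m_left_unitality X.obj).trans ?_
    rw [← env_map_ι, ι_lun]
    rfl
  right_unitality X := by
    refine (hF.m_right_unitality X.obj).trans ?_
    rw [← env_map_ι, ι_run]
    rfl

instance env_braided : hF.env.Braided where
  toMonoidal := hF.envCore.toMonoidal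
  braided X Y := hF.m_braided X.obj Y.obj

end envelope

section base

variable {C : Type u} [Category.{v} C] [MonoidalCategory C] [SymmetricCategory C]
  [IsStrictMonoidal C] [PartialTrace C] {D : Type u'}
  [MonoidalParaStruct.{v'} D] [IsSymmMonoidalParacategory D] {F : MonoidalFunctorData C D}
  (hF : F.IsSymmMonoidal)

/-- The functor from a category to the envelope. -/
def base : C ⥤ Env D where
  obj A := .of (F.obj A)
  map f := ι (F.map f)
  map_id A := hF.ι_map_of_mem (p := Path.nil) (Part.mem_some _)
  map_comp f g := hF.ι_map_of_mem (p := Path.nil ▹ f ▹ g)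
    (Part.eq_some_iff.1 (congrArg Part.some (by simp [composePath])))

/-- The functor from a category to the envelope is strong monoidal. -/
def baseCore : hF.base.CoreMonoidal where
  εIso := hF.mI_total.iso
  μIso X Y := (hF.m_total X Y).iso
  μIso_hom_natural_left {X Y} f Z := by
    rw [← tensorHom_id, ← tensorHom_id, ← hF.base.map_id]
    exact hF.m_naturality f (𝟙 Z)
  μIso_hom_natural_right {X Y} Z f := by
    rw [← id_tensorHom, ← id_tensorHom, ← hF.base.map_id]
    exact hF.m_naturality (𝟙 Z) f
  associativity X Y Z := by
    rw [← IntP.asc_base]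
    exact hF.m_associativity X Y Z
  left_unitality X := by
    rw [← IntP.lun_base X]
    exact hF.m_left_unitality X
  right_unitality X := by
    rw [← IntP.run_base X]
    exact hF.m_right_unitality X

instance base_braided : hF.base.Braided where
  toMonoidal := hF.baseCore.toMonoidal
  braided X Y := hF.m_braided X Y

end base

end MonoidalFunctorData.IsSymmMonoidal

section trace

open CompactClosedParaStruct

variable {D : Type u} [CompactClosedParaStruct.{v} D] [IsCompactClosedParacategory D]

theorem mem_ccTrace {A B U : D} {f : A ⊠ U ⟶ B ⊠ U} {g : A ⟶ B} :
    g ∈ ccTrace f ↔ (duPairing (.of U)).trace (A := .of A) (B := .of B) (ι f) = ι g := by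
  rw [ccTrace, mem_comp]
  simp only [mk_cons, mk_nil, Category.id_comp, Category.assoc, ι_asc, ι_ascInv, ι_run, ι_runInv]
  dsimp only [Pairing.trace]
  rw [MonoidalCategory.whiskerLeft_comp]
  simp only [Category.assoc]
  rfl

theorem mem_dualArrow {A B : D} {f : A ⟶ B} {d : dual B ⟶ dual A} :
    d ∈ dualArrow f ↔ Pairing.mate (duPairing (.of B)) (duPairing (.of A)) (ι f) = ι d := by
  rw [dualArrow, mem_comp]
  simp only [mk_cons, mk_nil, Category.id_comp, Category.assoc, ι_asc, ι_run, ι_lunInv]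
  dsimp only [Pairing.mate]
  rw [MonoidalCategory.whiskerLeft_comp]
  simp only [Category.assoc]
  rfl

variable {C : Type u'} [Category.{v'} C] [MonoidalCategory C] [SymmetricCategory C]
  [IsStrictMonoidal C] [PartialTrace C] {G : MonoidalFunctorData C D}

theorem IsTracePreserving.map_eq (hT : IsTracePreserving G) (hG : G.IsSymmMonoidal) {A B U : C}
    (f : A ⊗ U ⟶ B ⊗ U) (g : A ⟶ B) (h : g ∈ PartialTrace.tr f) :
    hG.base.map g = (duPairing (hG.base.obj U)).trace (IntP.hat hG.base f) := by
  obtain ⟨k, hk, hg⟩ := Part.mem_bind_iff.1 (hT f g h)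
  have hk' : IntP.hat hG.base f = ι k := by
    rw [← mem_comp.1 hk]
    exact (Category.assoc _ _ _).symm
  rw [hk']
  exact (mem_ccTrace.1 hg).symm

end trace

end Para

namespace Para

open Wiring ParacategoryStruct MonoidalParaStruct CompactClosedParaStruct Env

/-! ### The envelope of the Int-construction -/

namespace IntP

variable {C : Type u} [Category.{v} C] [MonoidalCategory C] [SymmetricCategory C]
  [IsStrictMonoidal C] [PartialTrace C]

theorem ι_str_comp {X Y Z : IntP C} (s : X.pos ⟶ Y.pos) (t : Y.neg ⟶ X.neg) (f : Y ⟶ Z) :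
    ι (str s t) ≫ ι f = ι (IntP.Hom.mk (s ▷ _ ≫ IntP.Hom.arr f ≫ _ ◁ t) : X ⟶ Z) :=
  comp_eq_some.1 (comp_str_left s t f)

theorem ι_comp_str {X Y Z : IntP C} (f : X ⟶ Y) (s : Y.pos ⟶ Z.pos) (t : Z.neg ⟶ Y.neg) :
    ι f ≫ ι (str s t) = ι (IntP.Hom.mk (_ ◁ t ≫ IntP.Hom.arr f ≫ s ▷ _) : X ⟶ Z) :=
  comp_eq_some.1 (comp_str_right f s t)

theorem ι_str_comp_str {X Y Z : IntP C} (s : X.pos ⟶ Y.pos) (t : Y.neg ⟶ X.neg)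
    (s' : Y.pos ⟶ Z.pos) (t' : Z.neg ⟶ Y.neg) :
    ι (str s t) ≫ ι (str s' t') = ι (str (s ≫ s') (t' ≫ t)) :=
  comp_eq_some.1 (str_comp_str s t s' t')

theorem ι_str_tensor {X X' Y Y' : IntP C} (s : X.pos ⟶ X'.pos) (t : X'.neg ⟶ X.neg)
    (s' : Y.pos ⟶ Y'.pos) (t' : Y'.neg ⟶ Y.neg) :
    ι (str s t) ⊗ₘ ι (str s' t') = ι (str (s ⊗ₘ s') (t' ⊗ₘ t) : X ⊠ Y ⟶ X' ⊠ Y') := by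
  rw [← ι_tHom, tHom_str]

theorem whiskerRight_comp_unit {E : Type u'} [Category.{v'} E] [MonoidalCategory E]
    [SymmetricCategory E] {A B V : E} (f : A ⟶ B) (e : B ⊗ V ⟶ 𝟙_ E) :
    f ▷ V ≫ e = (((f ≫ (λ_ _).inv) ▷ V ≫ (α_ _ _ _).hom) ≫ _ ◁ e) ≫ (λ_ _).hom := by
  have := gen f 0; have := gen e 1
  exact solve

/-- The totality of counits concerns arrows into a tensor product, so a unit object is inserted in
front of `B`. The result merges two arrows in the path of a transpose, which then has the shape
treated by `comp_eta_left`. -/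
theorem ι_whiskerRight_eps {A B : IntP C} (f : A ⟶ B) :
    ι f ▷ du (.of B) ≫ ι (eps B) =
      ι (IntP.Hom.mk ((ρ_ _).hom ≫ IntP.Hom.arr f ≫ (λ_ _).inv) : A ⊠ dual B ⟶ unit) := by
  have h := comp_eq_some.1 (comp_eps_right (B := unit)
    (IntP.Hom.mk (_ ◁ (ρ_ _).hom ≫ IntP.Hom.arr f ≫ (λ_ _).inv ▷ _) : A ⟶ unit ⊠ B))
  rw [mk_cons, mk_cons, mk_cons, mk_nil, Category.id_comp, ι_tHom_one, ι_one_tHom, ι_asc,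
    ← ι_comp_str, ← lunInv_eq, ι_lunInv] at h
  have h' : ι f ▷ du (.of B) ≫ ι (eps B) = (((ι f ≫ (λ_ _).inv) ▷ du (.of B) ≫ (α_ _ _ _).hom) ≫
      _ ◁ ι (eps B)) ≫ ι (lun unit) := by
    rw [ι_lun]
    exact whiskerRight_comp_unit (ι f) (ι (eps B))
  rw [h']
  refine (congrArg (· ≫ ι (lun unit)) h).trans ?_
  rw [lun_eq, ι_comp_str]
  refine congrArg ι (IntP.Hom.ext ?_)
  have := gen (IntP.Hom.arr f) 0
  dsimp only [tObj, dual, unit]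
  exact solve

theorem dualArrow_eq {A B : IntP C} (f : A ⟶ B) : dualArrow f =
    Part.some (IntP.Hom.mk ((β_ _ _).hom ≫ IntP.Hom.arr f ≫ (β_ _ _).hom) : dual B ⟶ dual A) := by
  let g : A ⊠ dual B ⟶ unit := IntP.Hom.mk ((ρ_ _).hom ≫ IntP.Hom.arr f ≫ (λ_ _).inv)
  have h : comp (Path.nil ▹ (eta A ⊠ₘ one (dual B)) ▹ asc (dual A) A (dual B) ▹
      (one (dual A) ⊠ₘ (f ⊠ₘ one (dual B))) ▹ (one (dual A) ⊠ₘ eps B)) =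
      comp (Path.nil ▹ (eta A ⊠ₘ one (dual B)) ▹ asc (dual A) A (dual B) ▹
        (one (dual A) ⊠ₘ g)) := by
    refine comp_congr ?_
    rw [mk_cons, mk_cons, mk_cons _ (one (dual A) ⊠ₘ g), Category.assoc]
    refine congrArg (_ ≫ ·) ?_
    exact (MonoidalCategory.whiskerLeft_comp _ _ _).symm.trans
      (congrArg (Env.of (dual A) ◁ ·) (ι_whiskerRight_eps f))
  rw [dualArrow, lunInv_eq, run_eq]
  refine (comp_between_str (h.trans (comp_eta_left g)) _ _ _ _).trans (congrArg Part.some (IntP.Hom.ext ?_))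
  have := gen (IntP.Hom.arr f) 0
  dsimp only [g, tObj, dual, unit]
  exact solve

theorem mate_ι {A B : IntP C} (f : A ⟶ B) :
    Pairing.mate (duPairing (.of B)) (duPairing (.of A)) (ι f) =
      ι (IntP.Hom.mk ((β_ _ _).hom ≫ IntP.Hom.arr f ≫ (β_ _ _).hom) : dual B ⟶ dual A) :=
  mem_dualArrow.1 (Part.eq_some_iff.1 (dualArrow_eq f))

end IntP

/-! ### Representability of transposed and bent arrows -/

namespace Env

variable {D : Type u} [MonoidalParaStruct.{v} D] [IsSymmMonoidalParacategory D]

/-- The arrow that represents an arrow of the envelope. -/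
noncomputable def Rep.arr {X Y : Env D} {x : X ⟶ Y} (h : Rep x) : X.obj ⟶ Y.obj := h.choose

theorem Rep.ι_arr {X Y : Env D} {x : X ⟶ Y} (h : Rep x) : ι h.arr = x := h.choose_spec.symm

/-- Here `e` need not be total, so the transpose is only representable. -/
theorem TotPairing.rep_mate {U V U' V' : Env D} {p : Pairing U V} {q : Pairing U' V'}
    (hp : TotPairing p) (hq : TotPairing q) {e : U' ⟶ U} (he : Rep e) : Rep (p.mate q e) := by
  have h := hq.η_left ((tot_leftUnitor_hom _).comp_rep
    (hp.ε_right ((tot_leftUnitor_inv U).comp_rep he)))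
  refine ((tot_leftUnitor_inv V).rep_comp ((tot_rightUnitor_hom V').comp_rep h)).congr ?_
  have := gen q.η 0; have := gen p.ε 1; have := gen e 2
  dsimp only [Pairing.mate]
  exact solve

theorem TotPairing.rep_bend {M M' N N' P Q : Env D} {p : Pairing M M'} {q : Pairing N N'}
    (hp : TotPairing p) (hq : TotPairing q) {h : P ⊗ N ⟶ Q ⊗ M} (hh : Rep h) :
    Rep (p.bend q h) := by
  have h' := hq.η_left (((tot_associator_inv N P M').comp
    ((tot_braiding N P).whiskerRight M')).rep_comp (hp.ε_right hh))
  refine ((tot_leftUnitor_inv _).rep_comp ((tot_braiding _ _).comp_rep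
    (((tot_rightUnitor_hom Q).whiskerLeft N').comp_rep h'))).congr ?_
  have := gen q.η 0; have := gen p.ε 1; have := gen h 2
  dsimp only [Pairing.bend]
  exact solve

end Env

end Para

namespace Para

open Wiring ParacategoryStruct MonoidalParaStruct CompactClosedParaStruct Env

/-! ### Extension of a functor to the Int-construction -/

namespace IntP

open Pairing

variable {C : Type u} [Category.{v} C] [MonoidalCategory C] [SymmetricCategory C]
  [IsStrictMonoidal C] [PartialTrace C] {D : Type u'} [CompactClosedParaStruct.{v'} D]
  [IsCompactClosedParacategory D] {G : MonoidalFunctorData C D} (hG : G.IsSymmMonoidal)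

theorem tot_μ (a b : C) : Tot (Functor.LaxMonoidal.μ hG.base a b) := (hG.m_total a b).tot_hom

theorem tot_δ (a b : C) : Tot (Functor.OplaxMonoidal.δ hG.base a b) := (hG.m_total a b).tot_inv

theorem tot_ε : Tot (Functor.LaxMonoidal.ε hG.base) := hG.mI_total.tot_hom

theorem tot_η : Tot (Functor.OplaxMonoidal.η hG.base) := hG.mI_total.tot_inv

theorem tot_dualTen_hom (x y : C) : Tot (dualTen hG.base duPairing x y).hom :=
  ((tot_duPairing _).tensor (tot_duPairing _)).tot_mate (tot_duPairing _) (tot_δ hG y x)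

theorem tot_dualTen_inv (x y : C) : Tot (dualTen hG.base duPairing x y).inv :=
  (tot_duPairing _).tot_mate ((tot_duPairing _).tensor (tot_duPairing _)) (tot_μ hG y x)

theorem tot_dualUnit_hom : Tot (dualUnit hG.base duPairing).hom :=
  TotPairing.unit.tot_mate (tot_duPairing _) (tot_η hG)

theorem tot_dualUnit_inv : Tot (dualUnit hG.base duPairing).inv :=
  (tot_duPairing _).tot_mate TotPairing.unit (tot_ε hG)

theorem tot_kTen_hom (a x b y : C) : Tot (kTen hG.base duPairing a x b y).hom :=
  (tot_tensorμ _ _ _ _).comp ((tot_μ hG a b).tensor (tot_dualTen_hom hG x y))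

theorem tot_kTen_inv (a x b y : C) : Tot (kTen hG.base duPairing a x b y).inv :=
  ((tot_δ hG a b).tensor (tot_dualTen_inv hG x y)).comp (tot_tensorμ _ _ _ _)

theorem tot_kUnit_hom : Tot (kUnit hG.base duPairing).hom :=
  (tot_leftUnitor_inv _).comp ((tot_ε hG).tensor (tot_dualUnit_hom hG))

theorem tot_kUnit_inv : Tot (kUnit hG.base duPairing).inv :=
  ((tot_η hG).tensor (tot_dualUnit_inv hG)).comp (tot_leftUnitor_hom _)

theorem tot_kPairing (a x : C) : TotPairing (kPairing hG.base duPairing a x) :=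
  (tot_duPairing _).tensor (tot_duPairing _).swap

/-- The comparison of duals. -/
def kDual (a x : C) : du (hG.base.obj a ⊗ du (hG.base.obj x)) ≅
    hG.base.obj x ⊗ du (hG.base.obj a) :=
  mateIso (duPairing _) (kPairing hG.base duPairing a x) (Iso.refl _)

theorem tot_kDual_hom (a x : C) : Tot (kDual hG a x).hom :=
  (tot_duPairing _).tot_mate (tot_kPairing hG a x) (tot_id _)

theorem tot_kDual_inv (a x : C) : Tot (kDual hG a x).inv :=
  (tot_kPairing hG a x).tot_mate (tot_duPairing _) (tot_id _)

theorem tot_kTheta_hom (a : C) : Tot (kTheta hG.base duPairing a).hom :=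
  ((tot_dualUnit_inv hG).whiskerLeft _).comp (tot_rightUnitor_hom _)

theorem tot_kTheta_inv (a : C) : Tot (kTheta hG.base duPairing a).inv :=
  (tot_rightUnitor_inv _).comp ((tot_dualUnit_hom hG).whiskerLeft _)

theorem rep_kMap {X Y : IntP C} (f : X ⟶ Y) : Rep (kMap hG.base duPairing f) :=
  (tot_duPairing _).rep_bend (tot_duPairing _)
    ((tot_μ hG _ _).rep_comp ((tot_δ hG _ _).comp_rep (rep_ι _)))

/-- The extension of a functor to the Int-construction. -/
noncomputable def extend : CompactClosedFunctorData (IntP C) D where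
  obj X := G.obj X.pos ⊠ dual (G.obj X.neg)
  map f := (rep_kMap hG f).arr
  m X Y := (tot_kTen_hom hG X.pos X.neg Y.pos Y.neg).rep.arr
  mInv X Y := (tot_kTen_inv hG X.pos X.neg Y.pos Y.neg).rep.arr
  mI := (tot_kUnit_hom hG).rep.arr
  mIInv := (tot_kUnit_inv hG).rep.arr
  mD X := (tot_kDual_hom hG X.pos X.neg).rep.arr
  mDInv X := (tot_kDual_inv hG X.pos X.neg).rep.arr

theorem ι_extend_map {X Y : IntP C} (f : X ⟶ Y) :
    ι ((extend hG).map f) = kMap hG.base duPairing f := Rep.ι_arr _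

theorem ι_extend_m (X Y : IntP C) :
    ι ((extend hG).m X Y) = (kTen hG.base duPairing X.pos X.neg Y.pos Y.neg).hom := Rep.ι_arr _

theorem ι_extend_mI : ι (extend hG).mI = (kUnit hG.base duPairing).hom := Rep.ι_arr _

theorem ι_extend_mD (X : IntP C) : ι ((extend hG).mD X) = (kDual hG X.pos X.neg).hom :=
  Rep.ι_arr _

theorem ι_extend_map_str {X Y : IntP C} {f : X ⟶ Y} {s : X.pos ⟶ Y.pos} {t : Y.neg ⟶ X.neg}
    (h : f = str s t) : ι ((extend hG).map f) = hG.base.map s ⊗ₘ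
      mate (duPairing (hG.base.obj X.neg)) (duPairing (hG.base.obj Y.neg)) (hG.base.map t) := by
  rw [ι_extend_map, h]
  exact bend_hat_tensorHom _ _ _ _

theorem mk_extend_mapPath {X Y : IntP C} (p : Path X Y) :
    Env.mk ((extend hG).mapPath p) = kPath hG.base duPairing p := by
  induction p with
  | nil => rfl
  | cons p f ih =>
    rw [Prefunctor.mapPath_cons, mk_cons, ih]
    exact congrArg (_ ≫ ·) (ι_extend_map hG f)

theorem extend_functor (hT : IsTracePreserving G) :
    IsParaFunctor (extend hG).toPrefunctor := by
  intro X Y p g hg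
  obtain ⟨f, hf, rfl⟩ := (Part.mem_map_iff _).1 hg
  refine mem_comp.2 ((mk_extend_mapPath hG p).trans ?_)
  exact (hat_trace hG.base duPairing (fun f g h => hT.map_eq hG f g h) hf).symm.trans
    (ι_extend_map hG f).symm

theorem extend_isSymmMonoidal (hT : IsTracePreserving G) :
    (extend hG).toMonoidalFunctorData.IsSymmMonoidal where
  functor := extend_functor hG hT
  m_total X Y := IsTotalIso.of_iso (kTen hG.base duPairing X.pos X.neg Y.pos Y.neg)
    (Rep.ι_arr _).symm (Rep.ι_arr _).symm (tot_kTen_hom hG _ _ _ _) (tot_kTen_inv hG _ _ _ _)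
  mI_total := IsTotalIso.of_iso (kUnit hG.base duPairing)
    (Rep.ι_arr _).symm (Rep.ι_arr _).symm (tot_kUnit_hom hG) (tot_kUnit_inv hG)
  m_natural {X X' Y Y'} f g := by
    refine comp_congr ?_
    simp only [mk_cons, mk_nil, Category.id_comp, ι_tHom]
    rw [ι_extend_map, ι_extend_map, ι_extend_map, ι_extend_m, ι_extend_m]
    exact kTen_natural hG.base duPairing (IntP.Hom.arr f) (IntP.Hom.arr g)
  m_assoc X Y Z := by
    refine comp_congr ?_
    simp only [mk_cons, mk_nil, Category.id_comp, ι_tHom_one, ι_one_tHom, ι_asc, Category.assoc]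
    rw [ι_extend_map_str hG (asc_eq X Y Z), ι_extend_m, ι_extend_m, ι_extend_m, ι_extend_m]
    exact kTen_assoc hG.base duPairing _ _ _ _ _ _
  m_left_unit X := by
    refine comp_eq_some.2 ?_
    simp only [mk_cons, mk_nil, Category.id_comp, ι_tHom_one, ι_lun, Category.assoc]
    rw [ι_extend_map_str hG (lun_eq X), ι_extend_m, ι_extend_mI]
    exact kTen_left_unit hG.base duPairing _ _
  m_right_unit X := by
    refine comp_eq_some.2 ?_
    simp only [mk_cons, mk_nil, Category.id_comp, ι_one_tHom, ι_run, Category.assoc]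
    rw [ι_extend_map_str hG (run_eq X), ι_extend_m, ι_extend_mI]
    exact kTen_right_unit hG.base duPairing _ _
  m_symm X Y := by
    refine comp_congr ?_
    simp only [mk_cons, mk_nil, Category.id_comp, ι_symm]
    rw [ι_extend_map_str hG (symm_eq X Y), ι_extend_m, ι_extend_m]
    exact kTen_symm hG.base duPairing _ _ _ _

theorem dualArrow_extend {X Y : IntP C} (f : X ⟶ Y) :
    ∃ d, dualArrow ((extend hG).map f) = Part.some d ∧
      ι d = mate (duPairing _) (duPairing _) (kMap hG.base duPairing f) := by
  obtain ⟨d, hd⟩ := (tot_duPairing (.of ((extend hG).obj Y))).rep_mate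
    (tot_duPairing (.of ((extend hG).obj X))) (rep_ι ((extend hG).map f))
  refine ⟨d, Part.eq_some_iff.2 (mem_dualArrow.2 hd), ?_⟩
  exact hd.symm.trans (congrArg (mate _ _) (ι_extend_map hG f))

theorem extend_isCompactClosed (hT : IsTracePreserving G) : (extend hG).IsCompactClosed where
  toIsSymmMonoidal := extend_isSymmMonoidal hG hT
  mD_total X := IsTotalIso.of_iso (kDual hG X.pos X.neg)
    (Rep.ι_arr _).symm (Rep.ι_arr _).symm (tot_kDual_hom hG _ _) (tot_kDual_inv hG _ _)
  mD_natural {X Y} f := by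
    obtain ⟨d, hd, hd'⟩ := dualArrow_extend hG f
    rw [hd, dualArrow_eq, Part.bind_some, Part.bind_some]
    refine comp_congr ?_
    simp only [mk_cons, mk_nil, Category.id_comp]
    rw [hd', ι_extend_mD, ι_extend_mD, ι_extend_map]
    refine Eq.trans ?_ (congrArg (_ ≫ ·)
      (bend_dual hG.base duPairing (IntP.Hom.arr f)).symm)
    -- Both sides are composites of transposes. They agree because the comparison of duals is the
    -- transpose of an identity.
    refine (mate_comp _ _ _ _ _).trans ((mate_comp _ _ _ _ _).trans ?_).symm
    exact congrArg (mate _ _) ((Category.comp_id _).trans (Category.id_comp _).symm)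
  mD_eta X := by
    refine comp_congr ?_
    simp only [mk_cons, mk_nil, Category.id_comp, ι_tHom_one]
    rw [ι_extend_m, ι_extend_mI, ι_extend_mD, ι_extend_map]
    refine (kTen_eta hG.base duPairing X.pos X.neg).trans (congrArg (· ≫ _) ?_)
    refine ((mate_η (duPairing _) (kPairing hG.base duPairing X.pos X.neg) (𝟙 _)).trans ?_).symm
    rw [MonoidalCategory.whiskerLeft_id, Category.comp_id]
  mD_eps X := by
    refine comp_congr ?_
    simp only [mk_cons, mk_nil, Category.id_comp, ι_one_tHom, Category.assoc]
    rw [ι_extend_m, ι_extend_mI, ι_extend_mD, ι_extend_map]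
    refine (congrArg (_ ≫ ·) (kTen_eps hG.base duPairing X.pos X.neg)).trans ?_
    refine (Category.assoc _ _ _).symm.trans (congrArg (· ≫ _) ?_)
    refine (mate_ε (duPairing _) (kPairing hG.base duPairing X.pos X.neg) (𝟙 _)).trans ?_
    rw [id_whiskerRight, Category.id_comp]
    rfl

/-- The isomorphism between a functor and the restriction of its extension. -/
noncomputable def extendTheta (a : C) : (extend hG).obj ((embed C).obj a) ⟶ G.obj a :=
  (tot_kTheta_hom hG a).rep.arr

theorem ι_extendTheta (a : C) : ι (extendTheta hG a) = (kTheta hG.base duPairing a).hom :=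
  Rep.ι_arr _

theorem extend_isCompIso :
    IsCompIso (embed C) (extend hG).toMonoidalFunctorData G (extendTheta hG) where
  total a := ⟨(tot_kTheta_inv hG a).rep.arr, IsTotalIso.of_iso (kTheta hG.base duPairing a)
    (Rep.ι_arr _).symm (Rep.ι_arr _).symm (tot_kTheta_hom hG a) (tot_kTheta_inv hG a)⟩
  natural {a b} f := by
    refine comp_congr ?_
    simp only [mk_cons, mk_nil, Category.id_comp]
    rw [ι_extend_map_str hG (embed_map f), ι_extendTheta, ι_extendTheta]
    exact kTheta_natural hG.base duPairing f
  monoidal a b := by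
    refine comp_congr ?_
    simp only [mk_cons, mk_nil, Category.id_comp, ι_tHom, Category.assoc]
    rw [ι_extend_map_str hG (embed_m a b), ι_extendTheta, ι_extendTheta, ι_extend_m]
    refine (kTheta_monoidal hG.base duPairing a b).trans ?_
    rw [← ι_extendTheta]
    rfl
  monoidal_unit := by
    refine comp_eq_some.2 ?_
    simp only [mk_cons, mk_nil, Category.id_comp, Category.assoc]
    rw [ι_extend_map_str hG embed_mI, ι_extend_mI]
    refine Eq.trans ?_ (kTheta_unit hG.base duPairing)
    rw [← ι_extendTheta]
    rfl

end IntP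

end Para

universe w z

namespace Para

open Wiring

/-! ### Arrows compatible with comparisons of two functors -/

section comparison

open Functor.LaxMonoidal Functor.OplaxMonoidal Functor.Monoidal

variable {E : Type u} [Category.{v} E] [MonoidalCategory E] [SymmetricCategory E]
  {E' : Type u'} [Category.{v'} E'] [MonoidalCategory E'] [SymmetricCategory E']
  {K L : E ⥤ E'} [K.Braided] [L.Braided]

/-- `x` is compatible with the comparisons `τ` and `σ` of two functors. -/
def Compat {U V : E} (τ : K.obj U ⟶ L.obj U) (σ : K.obj V ⟶ L.obj V) (x : U ⟶ V) : Prop :=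
  K.map x ≫ σ = τ ≫ L.map x

/-- The comparison on a tensor product. -/
def tTen {U V : E} (τ : K.obj U ⟶ L.obj U) (σ : K.obj V ⟶ L.obj V) :
    K.obj (U ⊗ V) ⟶ L.obj (U ⊗ V) := δ K U V ≫ (τ ⊗ₘ σ) ≫ μ L U V

variable (K L) in
/-- The comparison on the unit object. -/
def tUnit : K.obj (𝟙_ E) ⟶ L.obj (𝟙_ E) := η K ≫ ε L

namespace Compat

variable {U V W U' V' W' : E} {τ : K.obj U ⟶ L.obj U} {σ : K.obj V ⟶ L.obj V}
  {ρ : K.obj W ⟶ L.obj W} {τ' : K.obj U' ⟶ L.obj U'} {σ' : K.obj V' ⟶ L.obj V'}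

theorem id (τ : K.obj U ⟶ L.obj U) : Compat τ τ (𝟙 U) := by
  simp [Compat]

theorem comp {x : U ⟶ V} {y : V ⟶ W} (hx : Compat τ σ x) (hy : Compat σ ρ y) :
    Compat τ ρ (x ≫ y) := by
  dsimp only [Compat] at *
  rw [K.map_comp, L.map_comp, Category.assoc, hy, reassoc_of% hx]

theorem inv {x : U ≅ V} (hx : Compat τ σ x.hom) : Compat σ τ x.inv := by
  dsimp only [Compat] at *
  rw [← cancel_epi (K.map x.hom), ← K.map_comp_assoc, Iso.hom_inv_id, K.map_id, reassoc_of% hx,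
    ← L.map_comp, Iso.hom_inv_id, L.map_id, Category.comp_id, Category.id_comp]

theorem tensor {x : U ⟶ V} {y : U' ⟶ V'} (hx : Compat τ σ x) (hy : Compat τ' σ' y) :
    Compat (tTen τ τ') (tTen σ σ') (x ⊗ₘ y) := by
  dsimp only [Compat, tTen] at *
  rw [← δ_natural_assoc, Category.assoc, Category.assoc, ← μ_natural,
    tensorHom_comp_tensorHom_assoc, tensorHom_comp_tensorHom_assoc, hx, hy]

theorem whiskerRight {x : U ⟶ V} (hx : Compat τ σ x) (ρ : K.obj W ⟶ L.obj W) :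
    Compat (tTen τ ρ) (tTen σ ρ) (x ▷ W) :=
  tensorHom_id x W ▸ hx.tensor (.id ρ)

theorem whiskerLeft {x : U ⟶ V} (ρ : K.obj W ⟶ L.obj W) (hx : Compat τ σ x) :
    Compat (tTen ρ τ) (tTen ρ σ) (W ◁ x) :=
  id_tensorHom W x ▸ Compat.tensor (.id ρ) hx

theorem associator (τ : K.obj U ⟶ L.obj U) (σ : K.obj V ⟶ L.obj V) (ρ : K.obj W ⟶ L.obj W) :
    Compat (tTen (tTen τ σ) ρ) (tTen τ (tTen σ ρ)) (α_ U V W).hom := by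
  have h1 : tTen (tTen τ σ) ρ = (δ K _ _ ≫ δ K U V ▷ _) ≫ ((τ ⊗ₘ σ) ⊗ₘ ρ) ≫
      (μ L U V ▷ _ ≫ μ L _ _) := by
    have := gen (δ K (U ⊗ V) W) 0; have := gen (δ K U V) 1; have := gen τ 2; have := gen σ 3
    have := gen ρ 4; have := gen (μ L U V) 5; have := gen (μ L (U ⊗ V) W) 6
    dsimp only [tTen]
    exact solve
  have h2 : tTen τ (tTen σ ρ) = (δ K _ _ ≫ _ ◁ δ K V W) ≫ (τ ⊗ₘ (σ ⊗ₘ ρ)) ≫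
      (_ ◁ μ L V W ≫ μ L _ _) := by
    have := gen (δ K U (V ⊗ W)) 0; have := gen (δ K V W) 1; have := gen τ 2; have := gen σ 3
    have := gen ρ 4; have := gen (μ L V W) 5; have := gen (μ L U (V ⊗ W)) 6
    dsimp only [tTen]
    exact solve
  dsimp only [Compat]
  rw [h1, h2]
  have h3 := Functor.OplaxMonoidal.associativity (F := K) U V W
  have h4 := Functor.LaxMonoidal.associativity (F := L) U V W
  simp only [Category.assoc]
  rw [h4, associator_naturality_assoc, reassoc_of% h3]

theorem leftUnitor (τ : K.obj U ⟶ L.obj U) : Compat (tTen (tUnit K L) τ) τ (λ_ U).hom := by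
  have h1 : tTen (tUnit K L) τ = δ K _ _ ≫ η K ▷ _ ≫ (𝟙_ E' ◁ τ) ≫ ε L ▷ _ ≫ μ L _ _ := by
    have := gen (δ K (𝟙_ E) U) 0; have := gen (η K) 1; have := gen τ 2; have := gen (ε L) 3
    have := gen (μ L (𝟙_ E) U) 4
    dsimp only [tTen, tUnit]
    exact solve
  dsimp only [Compat]
  rw [h1]
  simp only [Category.assoc]
  rw [← Functor.LaxMonoidal.left_unitality, leftUnitor_naturality,
    ← cancel_epi (K.map (λ_ U).inv), ← K.map_comp_assoc, Iso.inv_hom_id, K.map_id,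
    Category.id_comp]
  simp

theorem rightUnitor (τ : K.obj U ⟶ L.obj U) : Compat (tTen τ (tUnit K L)) τ (ρ_ U).hom := by
  have h1 : tTen τ (tUnit K L) = δ K _ _ ≫ _ ◁ η K ≫ (τ ▷ 𝟙_ E') ≫ _ ◁ ε L ≫ μ L _ _ := by
    have := gen (δ K U (𝟙_ E)) 0; have := gen (η K) 1; have := gen τ 2; have := gen (ε L) 3
    have := gen (μ L U (𝟙_ E)) 4
    dsimp only [tTen, tUnit]
    exact solve
  dsimp only [Compat]
  rw [h1]
  simp only [Category.assoc]
  rw [← Functor.LaxMonoidal.right_unitality, rightUnitor_naturality,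
    ← cancel_epi (K.map (ρ_ U).inv), ← K.map_comp_assoc, Iso.inv_hom_id, K.map_id,
    Category.id_comp]
  simp

theorem braiding (τ : K.obj U ⟶ L.obj U) (σ : K.obj V ⟶ L.obj V) :
    Compat (tTen τ σ) (tTen σ τ) (β_ U V).hom := by
  dsimp only [Compat, tTen]
  simp

theorem associator_inv (τ : K.obj U ⟶ L.obj U) (σ : K.obj V ⟶ L.obj V) (ρ : K.obj W ⟶ L.obj W) :
    Compat (tTen τ (tTen σ ρ)) (tTen (tTen τ σ) ρ) (α_ U V W).inv := (associator τ σ ρ).inv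

theorem leftUnitor_inv (τ : K.obj U ⟶ L.obj U) : Compat τ (tTen (tUnit K L) τ) (λ_ U).inv :=
  (leftUnitor τ).inv

theorem rightUnitor_inv (τ : K.obj U ⟶ L.obj U) : Compat τ (tTen τ (tUnit K L)) (ρ_ U).inv :=
  (rightUnitor τ).inv

theorem tensorμ (τ : K.obj U ⟶ L.obj U) (σ : K.obj V ⟶ L.obj V) (τ' : K.obj U' ⟶ L.obj U')
    (σ' : K.obj V' ⟶ L.obj V') :
    Compat (tTen (tTen τ σ) (tTen τ' σ')) (tTen (tTen τ τ') (tTen σ σ'))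
      (MonoidalCategory.tensorμ U V U' V') :=
  (associator _ _ _).comp (.comp (.whiskerLeft _ (associator_inv _ _ _)) (.comp
    (.whiskerLeft _ (.whiskerRight (braiding _ _) _)) (.comp (.whiskerLeft _ (associator _ _ _))
      (associator_inv _ _ _))))

/-- A pairing compatible with two comparisons. -/
structure OfPairing (p : Pairing U V) (τ : K.obj U ⟶ L.obj U) (σ : K.obj V ⟶ L.obj V) : Prop where
  ε : Compat (tTen τ σ) (tUnit K L) p.ε
  η : Compat (tUnit K L) (tTen σ τ) p.η

theorem OfPairing.tensor {p : Pairing U V} {q : Pairing U' V'} (hp : OfPairing p τ σ)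
    (hq : OfPairing q τ' σ') : OfPairing (p.tensor q) (tTen τ τ') (tTen σ' σ) where
  ε := .comp (associator _ _ _) (.comp (.whiskerLeft _ (.comp (associator_inv _ _ _)
    (.comp (.whiskerRight hq.ε _) (leftUnitor _)))) hp.ε)
  η := .comp hq.η (.comp (.whiskerLeft _ (.comp (leftUnitor_inv _) (.whiskerRight hp.η _)))
    (.comp (.whiskerLeft _ (associator _ _ _)) (associator_inv _ _ _)))

theorem OfPairing.unit : OfPairing (Pairing.unit : Pairing (𝟙_ E) (𝟙_ E)) (tUnit K L)
    (tUnit K L) where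
  ε := leftUnitor _
  η := leftUnitor_inv _

theorem mate {p : Pairing U V} {q : Pairing U' V'} (hp : OfPairing p τ σ)
    (hq : OfPairing q τ' σ') {e : U' ⟶ U} (he : Compat τ' τ e) :
    Compat σ σ' (Pairing.mate p q e) :=
  .comp (leftUnitor_inv _) (.comp (.whiskerRight hq.η _) (.comp (associator _ _ _)
    (.comp (.whiskerLeft _ (.comp (.whiskerRight he _) hp.ε)) (rightUnitor _))))

/-- A bent arrow is composed of structural arrows, a unit, a counit and `h`, each of which is
compatible with the comparisons. -/
theorem bend {M M' N N' P Q : E} {m : K.obj M ⟶ L.obj M} {m' : K.obj M' ⟶ L.obj M'}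
    {n : K.obj N ⟶ L.obj N} {n' : K.obj N' ⟶ L.obj N'} {a : K.obj P ⟶ L.obj P}
    {b : K.obj Q ⟶ L.obj Q} {p : Pairing M M'} {q : Pairing N N'} (hp : OfPairing p m m')
    (hq : OfPairing q n n') {h : P ⊗ N ⟶ Q ⊗ M} (hh : Compat (tTen a n) (tTen b m) h) :
    Compat (tTen a m') (tTen b n') (Pairing.bend p q h) :=
  .comp (rightUnitor_inv _) (.comp (.whiskerLeft _ (.comp hq.η (braiding _ _)))
    (.comp (tensorμ _ _ _ _) (.comp (.whiskerRight hh _) (.comp (.whiskerLeft _ (braiding _ _))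
      (.comp (tensorμ _ _ _ _) (.comp (.whiskerLeft _ hp.ε) (rightUnitor _)))))))

end Compat

/-- The image of a pairing under a functor. -/
def Pairing.map (F : E ⥤ E') [F.Braided] {U V : E} (p : Pairing U V) : Pairing (F.obj U) (F.obj V) where
  η := Functor.LaxMonoidal.ε F ≫ F.map p.η ≫ δ F _ _
  ε := μ F _ _ ≫ F.map p.ε ≫ Functor.OplaxMonoidal.η F
  zig := by
    have h := congrArg (Lifting.hatOf F (Iso.refl _) (Iso.refl _)) p.zig
    have h' : Lifting.hatOf F (Iso.refl _) (Iso.refl _) (𝟙 U) = 𝟙 _ := by simp [Lifting.hatOf]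
    rw [h', Lifting.lift] at h
    simpa [Lifting.hatOf, Lifting.ten] using h
  zag := by
    have h := congrArg (Lifting.hatOf F (Iso.refl _) (Iso.refl _)) p.zag
    have h' : Lifting.hatOf F (Iso.refl _) (Iso.refl _) (𝟙 V) = 𝟙 _ := by simp [Lifting.hatOf]
    rw [h', Lifting.lift] at h
    simpa [Lifting.hatOf, Lifting.ten] using h

namespace Compat

variable {U V : E} (p : Pairing U V)

theorem ofPairing_mate (τ : K.obj U ≅ L.obj U) :
    OfPairing p τ.hom (Pairing.mate (p.map K) (p.map L) τ.inv) where
  ε := by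
    have h := Pairing.mate_ε (p.map K) (p.map L) τ.inv
    have h' : (τ.hom ⊗ₘ Pairing.mate (p.map K) (p.map L) τ.inv) ≫ (p.map L).ε = (p.map K).ε := by
      rw [MonoidalCategory.tensorHom_def, Category.assoc, h, ← comp_whiskerRight_assoc, Iso.hom_inv_id,
        id_whiskerRight, Category.id_comp]
    dsimp only [Compat, tTen, tUnit]
    rw [← cancel_mono (η L), ← cancel_epi (μ K U V)]
    simp only [Category.assoc, μ_δ_assoc, ε_η, Category.comp_id]
    exact h'.symm
  η := by
    have h := Pairing.mate_η (p.map K) (p.map L) τ.inv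
    have h' : (p.map K).η ≫ (Pairing.mate (p.map K) (p.map L) τ.inv ⊗ₘ τ.hom) = (p.map L).η := by
      rw [MonoidalCategory.tensorHom_def, reassoc_of% h, ← MonoidalCategory.whiskerLeft_comp, Iso.inv_hom_id,
        MonoidalCategory.whiskerLeft_id, Category.comp_id]
    dsimp only [Compat, tTen, tUnit]
    rw [← cancel_mono (δ L V U), ← cancel_epi (ε K)]
    simp only [Category.assoc, μ_δ, ε_η_assoc, Category.comp_id]
    exact (by simpa [Pairing.map] using h')

/-- Compatibility with the counit alone forces the comparison on a dual, since arrows into a dual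
are determined by their pairing. -/
theorem eq_mate_of_compat_ε {p : Pairing U V} {τ : K.obj U ≅ L.obj U} {σ : K.obj V ⟶ L.obj V}
    (h : Compat (tTen τ.hom σ) (tUnit K L) p.ε) : σ = Pairing.mate (p.map K) (p.map L) τ.inv := by
  refine Pairing.eq_mate _ _ ?_
  dsimp only [Compat, tTen, tUnit] at h
  rw [← cancel_mono (η L), ← cancel_epi (μ K U V)] at h
  simp only [Category.assoc, μ_δ_assoc, ε_η, Category.comp_id] at h
  have h' : (p.map K).ε = (τ.hom ⊗ₘ σ) ≫ (p.map L).ε := h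
  rw [h', MonoidalCategory.tensorHom_def, Category.assoc, ← comp_whiskerRight_assoc, Iso.inv_hom_id,
    id_whiskerRight, Category.id_comp]

end Compat

end comparison

namespace IntP

open Functor.LaxMonoidal Functor.OplaxMonoidal Functor.Monoidal

variable {C : Type w} [Category.{z} C] [MonoidalCategory C] [SymmetricCategory C]
  {E : Type u} [Category.{v} E] [MonoidalCategory E] [SymmetricCategory E]
  {E' : Type u'} [Category.{v'} E'] [MonoidalCategory E'] [SymmetricCategory E']
  (K L : E ⥤ E') [K.Braided] [L.Braided] (N : C ⥤ E) [N.Braided]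

/-- A comparison of the restrictions of two functors. -/
structure Comparison where
  app : ∀ a : C, K.obj (N.obj a) ≅ L.obj (N.obj a)
  natural : ∀ {a b : C} (f : a ⟶ b), Compat (app a).hom (app b).hom (N.map f)
  tensor : ∀ a b : C, Compat (tTen (app a).hom (app b).hom) (app (a ⊗ b)).hom (μ N a b)
  unit : Compat (tUnit K L) (app (𝟙_ C)).hom (ε N)

namespace Comparison

variable {K L N} (t : Comparison K L N) {dl : E → E} (pr : ∀ X : E, Pairing X (dl X))

/-- The comparison on a dual. -/
def onDual (x : C) : K.obj (dl (N.obj x)) ≅ L.obj (dl (N.obj x)) :=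
  Pairing.mateIso ((pr _).map K) ((pr _).map L) (t.app x).symm

/-- The comparison on `A⁺ ⊗ (A⁻)*`. -/
def onK (a x : C) : K.obj (N.obj a ⊗ dl (N.obj x)) ≅ L.obj (N.obj a ⊗ dl (N.obj x)) :=
  (μIso K _ _).symm ≪≫ (t.app a ⊗ᵢ t.onDual pr x) ≪≫ μIso L _ _

theorem ofPairing (x : C) :
    Compat.OfPairing (pr (N.obj x)) (t.app x).hom (t.onDual pr x).hom :=
  Compat.ofPairing_mate _ _

theorem tensor_δ (a b : C) :
    Compat (t.app (a ⊗ b)).hom (tTen (t.app a).hom (t.app b).hom) (δ N a b) :=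
  Compat.inv (x := μIso N a b) (t.tensor a b)

theorem unit_η : Compat (t.app (𝟙_ C)).hom (tUnit K L) (η N) :=
  Compat.inv (x := εIso N) t.unit

theorem compat_kMap {X Y : IntP C} (f : X ⟶ Y) :
    Compat (t.onK pr X.pos X.neg).hom (t.onK pr Y.pos Y.neg).hom (kMap N pr f) :=
  Compat.bend (t.ofPairing pr _) (t.ofPairing pr _)
    ((t.tensor _ _).comp ((t.natural _).comp (t.tensor_δ _ _)))

theorem compat_kTen (a x b y : C) :
    Compat (tTen (t.onK pr a x).hom (t.onK pr b y).hom) (t.onK pr (a ⊗ b) (y ⊗ x)).hom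
      (kTen N pr a x b y).hom :=
  (Compat.tensorμ _ _ _ _).comp ((t.tensor a b).tensor
    (.mate ((t.ofPairing pr y).tensor (t.ofPairing pr x)) (t.ofPairing pr _) (t.tensor_δ y x)))

theorem compat_dualUnit : Compat (tUnit K L) (t.onDual pr (𝟙_ C)).hom (dualUnit N pr).hom :=
  .mate .unit (t.ofPairing pr _) t.unit_η

theorem compat_kUnit :
    Compat (tUnit K L) (t.onK pr (𝟙_ C) (𝟙_ C)).hom (kUnit N pr).hom :=
  (Compat.leftUnitor_inv _).comp (t.unit.tensor (t.compat_dualUnit pr))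

theorem compat_kTheta_inv (a : C) :
    Compat (t.app a).hom (t.onK pr a (𝟙_ C)).hom (kTheta N pr a).inv :=
  (Compat.rightUnitor_inv _).comp ((t.compat_dualUnit pr).whiskerLeft _)

end Comparison

end IntP

end Para

namespace Para

open Wiring ParacategoryStruct MonoidalParaStruct CompactClosedParaStruct Env

namespace IntP

variable {C : Type u} [Category.{v} C] [MonoidalCategory C] [SymmetricCategory C]
  [IsStrictMonoidal C] [PartialTrace C]

/-! ### Objects of the Int-construction as tensor products -/

/-- `x` is given by an arrow of positive parts and an arrow of negative parts. -/
def IsStr {X Y : Env (IntP C)} (x : X ⟶ Y) (s : X.obj.pos ⟶ Y.obj.pos)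
    (t : Y.obj.neg ⟶ X.obj.neg) : Prop := x = ι (str s t)

namespace IsStr

variable {X Y Z W : Env (IntP C)} {x : X ⟶ Y} {s : X.obj.pos ⟶ Y.obj.pos}
  {t : Y.obj.neg ⟶ X.obj.neg}

theorem ext (h : IsStr x s t) {y : X ⟶ Y} {s' : X.obj.pos ⟶ Y.obj.pos}
    {t' : Y.obj.neg ⟶ X.obj.neg} (h' : IsStr y s' t') (hs : s = s') (ht : t = t') : x = y := by
  rw [h, h', hs, ht]

theorem of_eq (h : IsStr x s t) {s' : X.obj.pos ⟶ Y.obj.pos}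
    {t' : Y.obj.neg ⟶ X.obj.neg} (hs : s = s') (ht : t = t') : IsStr x s' t' := by
  rw [← hs, ← ht]
  exact h

theorem id (X : Env (IntP C)) : IsStr (𝟙 X) (𝟙 _) (𝟙 _) :=
  (ι_one X.obj).symm.trans (congrArg ι (one_eq X.obj))

theorem comp {y : Y ⟶ Z} {s' : Y.obj.pos ⟶ Z.obj.pos} {t' : Z.obj.neg ⟶ Y.obj.neg}
    (h : IsStr x s t) (h' : IsStr y s' t') : IsStr (x ≫ y) (s ≫ s') (t' ≫ t) := by
  dsimp only [IsStr] at *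
  rw [h, h']
  exact ι_str_comp_str s t s' t'

theorem tensor {y : Z ⟶ W} {s' : Z.obj.pos ⟶ W.obj.pos} {t' : W.obj.neg ⟶ Z.obj.neg}
    (h : IsStr x s t) (h' : IsStr y s' t') :
    IsStr (x ⊗ₘ y) (s ⊗ₘ s' : X.obj.pos ⊗ Z.obj.pos ⟶ Y.obj.pos ⊗ W.obj.pos)
      (t' ⊗ₘ t : W.obj.neg ⊗ Y.obj.neg ⟶ Z.obj.neg ⊗ X.obj.neg) := by
  dsimp only [IsStr] at *
  rw [h, h']
  exact ι_str_tensor s t s' t'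

theorem whiskerRight (h : IsStr x s t) (Z : Env (IntP C)) :
    IsStr (x ▷ Z) (s ▷ Z.obj.pos : X.obj.pos ⊗ Z.obj.pos ⟶ Y.obj.pos ⊗ Z.obj.pos)
      (Z.obj.neg ◁ t : Z.obj.neg ⊗ Y.obj.neg ⟶ Z.obj.neg ⊗ X.obj.neg) := by
  have := h.tensor (.id Z)
  rwa [tensorHom_id, tensorHom_id, id_tensorHom] at this

theorem whiskerLeft (Z : Env (IntP C)) (h : IsStr x s t) :
    IsStr (Z ◁ x) (Z.obj.pos ◁ s : Z.obj.pos ⊗ X.obj.pos ⟶ Z.obj.pos ⊗ Y.obj.pos)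
      (t ▷ Z.obj.neg : Y.obj.neg ⊗ Z.obj.neg ⟶ X.obj.neg ⊗ Z.obj.neg) := by
  have := (IsStr.id Z).tensor h
  rwa [tensorHom_id, id_tensorHom, id_tensorHom] at this

theorem associator (X Y Z : Env (IntP C)) : IsStr (α_ X Y Z).hom
    (α_ X.obj.pos Y.obj.pos Z.obj.pos).hom (α_ Z.obj.neg Y.obj.neg X.obj.neg).hom :=
  (ι_asc X.obj Y.obj Z.obj).symm.trans (congrArg ι (asc_eq _ _ _))

theorem associator_inv (X Y Z : Env (IntP C)) : IsStr (α_ X Y Z).inv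
    (α_ X.obj.pos Y.obj.pos Z.obj.pos).inv (α_ Z.obj.neg Y.obj.neg X.obj.neg).inv :=
  (ι_ascInv X.obj Y.obj Z.obj).symm.trans (congrArg ι (ascInv_eq _ _ _))

theorem leftUnitor_inv (X : Env (IntP C)) :
    IsStr (λ_ X).inv (λ_ X.obj.pos).inv (ρ_ X.obj.neg).hom :=
  (ι_lunInv X.obj).symm.trans (congrArg ι (lunInv_eq _))

theorem rightUnitor (X : Env (IntP C)) :
    IsStr (ρ_ X).hom (ρ_ X.obj.pos).hom (λ_ X.obj.neg).inv :=
  (ι_run X.obj).symm.trans (congrArg ι (run_eq _))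

theorem rightUnitor_inv (X : Env (IntP C)) :
    IsStr (ρ_ X).inv (ρ_ X.obj.pos).inv (λ_ X.obj.neg).hom :=
  (ι_runInv X.obj).symm.trans (congrArg ι (runInv_eq _))

theorem leftUnitor (X : Env (IntP C)) :
    IsStr (λ_ X).hom (λ_ X.obj.pos).hom (ρ_ X.obj.neg).inv :=
  (ι_lun X.obj).symm.trans (congrArg ι (lun_eq _))

theorem braiding (X Y : Env (IntP C)) : IsStr (β_ X Y).hom
    (β_ X.obj.pos Y.obj.pos).hom (β_ X.obj.neg Y.obj.neg).hom := rfl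

theorem tensorμ (X Y Z W : Env (IntP C)) : IsStr (MonoidalCategory.tensorμ X Y Z W)
    (MonoidalCategory.tensorμ X.obj.pos Y.obj.pos Z.obj.pos W.obj.pos)
    (MonoidalCategory.tensorμ W.obj.neg Y.obj.neg Z.obj.neg X.obj.neg) := by
  refine ((associator _ _ _).comp ((whiskerLeft _ (associator_inv _ _ _)).comp
    ((whiskerLeft _ ((braiding _ _).whiskerRight _)).comp ((whiskerLeft _ (associator _ _ _)).comp
      (associator_inv _ _ _))))).of_eq rfl ?_
  dsimp only [MonoidalCategoryStruct.tensorObj, tObj]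
  exact solve

end IsStr

theorem IsStr.comp_ι {X : Env (IntP C)} {Y Z : IntP C} {x : X ⟶ .of Y} {s : X.obj.pos ⟶ Y.pos}
    {t : Y.neg ⟶ X.obj.neg} (h : IsStr x s t) (f : Y ⟶ Z) :
    x ≫ ι f = ι (IntP.Hom.mk (s ▷ _ ≫ IntP.Hom.arr f ≫ _ ◁ t) : X.obj ⟶ Z) := by
  dsimp only [IsStr] at h
  rw [h]
  exact ι_str_comp s t f

theorem ι_comp_isStr {X Y : IntP C} {Z : Env (IntP C)} {y : .of Y ⟶ Z} {s : Y.pos ⟶ Z.obj.pos}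
    {t : Z.obj.neg ⟶ Y.neg} (f : X ⟶ Y) (h : IsStr y s t) :
    ι f ≫ y = ι (IntP.Hom.mk (_ ◁ t ≫ IntP.Hom.arr f ≫ s ▷ _) : X ⟶ Z.obj) := by
  dsimp only [IsStr] at h
  rw [h]
  exact ι_comp_str f s t

/-- The bend is regrouped into stages whose values in the Int-construction are known: first the
composite with a counit, then that with a unit, separated by structural arrows. -/
theorem bend_eq {E : Type u'} [Category.{v'} E] [MonoidalCategory E] [SymmetricCategory E]
    {M M' N N' P Q : E} (p : Pairing M M') (q : Pairing N N') (h : P ⊗ N ⟶ Q ⊗ M) :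
    Pairing.bend p q h = ((λ_ _).inv ≫ (q.η ▷ (P ⊗ M') ≫ (α_ _ _ _).hom ≫ N' ◁ (((α_ _ _ _).inv ≫
      (β_ _ _).hom ▷ M') ≫ (h ▷ M' ≫ (α_ _ _ _).hom ≫ Q ◁ p.ε)))) ≫
        (N' ◁ (ρ_ _).hom ≫ (β_ _ _).hom) := by
  have := gen p.ε 0; have := gen q.η 1; have := gen h 2
  dsimp only [Pairing.bend]
  exact solve

theorem bend_ι {P N Q M : IntP C} (h : P ⊠ N ⟶ Q ⊠ M) :
    Pairing.bend (P := .of P) (Q := .of Q) (duPairing (.of M)) (duPairing (.of N)) (ι h) =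
      ι (IntP.Hom.mk (tensorμ _ _ _ _ ≫ IntP.Hom.arr h ≫ tensorμ _ _ _ _) :
        P ⊠ dual M ⟶ Q ⊠ dual N) := by
  rw [bend_eq]
  have h1 := comp_eq_some.1 (comp_eps_right h)
  rw [mk_cons, mk_cons, mk_cons, mk_nil, Category.id_comp, ι_asc, Category.assoc] at h1
  have h2 := ((IsStr.associator_inv (.of N) (.of P) (.of (dual M))).comp
    ((IsStr.braiding (.of N) (.of P)).whiskerRight (.of (dual M)))).comp_ι
      (IntP.Hom.mk (((α_ _ _ _).hom ≫ _ ◁ _ ◁ (λ_ _).hom) ≫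
        (IntP.Hom.arr h ≫ (mvIso _ _ _).hom) ≫ (α_ _ _ _).hom ≫ ((ρ_ _).inv ⊗ₘ (β_ _ _).hom)) :
          (P ⊠ N) ⊠ dual M ⟶ Q ⊠ unit)
  have h3 := comp_eq_some.1 (comp_eta_left (A := N) (B := P ⊠ dual M) (E := Q ⊠ unit)
    (IntP.Hom.mk (((α_ _ _ _).inv ≫ (β_ _ _).hom ▷ _) ▷ _ ≫ (((α_ _ _ _).hom ≫ _ ◁ _ ◁ (λ_ _).hom) ≫
        (IntP.Hom.arr h ≫ (mvIso _ _ _).hom) ≫ (α_ _ _ _).hom ≫ ((ρ_ _).inv ⊗ₘ (β_ _ _).hom)) ≫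
          _ ◁ (_ ◁ (β_ _ _).hom ≫ (α_ _ _ _).inv))))
  rw [mk_cons, mk_cons, mk_cons, mk_nil, Category.id_comp, ι_asc, Category.assoc] at h3
  have h4 := (congrArg (_ ≫ ·) h1).trans h2
  have h5 := (congrArg (fun x => ι (eta N) ▷ _ ≫ (α_ _ _ _).hom ≫ .of (dual N) ◁ x) h4).trans h3
  have h6 := (congrArg (_ ≫ ·) h5).trans ((IsStr.leftUnitor_inv (.of (P ⊠ dual M))).comp_ι _)
  refine ((congrArg (· ≫ _) h6).trans (ι_comp_isStr _ ((IsStr.whiskerLeft (.of (dual N))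
    (IsStr.rightUnitor (.of Q))).comp (IsStr.braiding (.of (dual N)) (.of Q))))).trans ?_
  refine congrArg ι (IntP.Hom.ext ?_)
  have := gen (IntP.Hom.arr h) 0
  dsimp only [MonoidalCategoryStruct.tensorObj, tObj, dual, unit]
  exact solve

theorem whiskerLeft_comp_unit {E : Type u'} [Category.{v'} E] [MonoidalCategory E]
    [SymmetricCategory E] {A B V : E} (g : A ⟶ B) (e : V ⊗ B ⟶ 𝟙_ E) :
    V ◁ g ≫ e = (V ◁ (g ≫ (ρ_ _).inv) ≫ (α_ _ _ _).inv ≫ e ▷ _) ≫ (ρ_ _).hom := by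
  have := gen g 0; have := gen e 1
  exact solve

theorem ι_whiskerLeft_eps {A Z : IntP C} (g : Z ⟶ dual A) :
    .of A ◁ ι g ≫ ι (eps A) = ι (IntP.Hom.mk ((ρ_ _).hom ≫ (β_ _ _).hom ≫ IntP.Hom.arr g ≫
      (β_ _ _).hom ≫ (λ_ _).inv) : A ⊠ Z ⟶ unit) := by
  have h1 := ι_comp_isStr g (IsStr.rightUnitor_inv (.of (dual A)))
  have h2 := comp_eq_some.1 (comp_eps_left (A := A) (E := unit) (IntP.Hom.mk
    (_ ◁ (λ_ _).hom ≫ IntP.Hom.arr g ≫ (ρ_ _).inv ▷ _) : Z ⟶ dual A ⊠ unit))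
  rw [mk_cons, mk_cons, mk_cons, mk_nil, Category.id_comp, ι_ascInv, Category.assoc] at h2
  have h3 := (congrArg (fun x => .of A ◁ x ≫ (α_ _ _ _).inv ≫ ι (eps A) ▷ _) h1).trans h2
  refine (whiskerLeft_comp_unit (ι g) (ι (eps A))).trans ?_
  refine ((congrArg (· ≫ _) h3).trans (ι_comp_isStr _ (IsStr.rightUnitor (.of unit)))).trans ?_
  refine congrArg ι (IntP.Hom.ext ?_)
  have := gen (IntP.Hom.arr g) 0
  dsimp only [tObj, dual, unit]
  exact solve

/-- The given dual of a tensor product is the tensor product of the given duals in reverse order,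
with the expected counit; this makes the comparison of the two pairings an identity. -/
theorem tensor_ε (A B : IntP C) :
    ((duPairing (.of A)).tensor (duPairing (.of B))).ε = ι (eps (A ⊠ B)) := by
  have h2 := (IsStr.associator_inv (.of B) (.of (dual B)) (.of (dual A))).comp_ι
    (eps B ⊠ₘ one (dual A))
  have h4 := (Category.assoc _ _ _).symm.trans ((congrArg (· ≫ _) h2).trans
    (ι_comp_isStr _ (IsStr.leftUnitor (.of (dual A)))))
  have h5 := (congrArg (fun x => .of A ◁ x ≫ ι (eps A)) h4).trans (ι_whiskerLeft_eps _)
  refine ((congrArg (_ ≫ ·) h5).trans ((IsStr.associator (.of A) (.of B)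
    (.of (dual B) ⊗ .of (dual A))).comp_ι _)).trans ?_
  refine congrArg ι (IntP.Hom.ext ?_)
  change _ ▷ _ ≫ (_ ≫ _ ≫ (_ ◁ _ ≫ (_ ▷ _ ≫ tensorArr (X := ⟨_, _⟩) (X' := ⟨_, _⟩)
    ⟨(ρ_ _).hom ≫ (λ_ _).inv⟩ (Y := ⟨_, _⟩) (Y' := ⟨_, _⟩) ⟨𝟙 _⟩ ≫ _ ◁ _) ≫ _ ▷ _) ≫ _ ≫ _) ≫ _ ◁ _ =
      (ρ_ _).hom ≫ (λ_ _).inv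
  dsimp only [tensorArr, MonoidalCategoryStruct.tensorObj, tObj, dual, unit]
  exact solve

theorem embed_tensor_dual (X : IntP C) :
    (embed C).obj X.pos ⊠ dual ((embed C).obj X.neg) = X :=
  IntP.ext (IsStrictMonoidal.tensor_unit _) (IsStrictMonoidal.tensor_unit _)

variable (C) in
/-- The embedding as a functor to the envelope. -/
abbrev embedEnv : C ⥤ Env (IntP C) := (embed_isSymmMonoidal (C := C)).base

/-- An object is a tensor product of an object of the base and a dual. -/
def objIso (X : IntP C) : kObj (embedEnv C) du X ≅ .of X :=
  eqToIso (congrArg Env.of (embed_tensor_dual X))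

theorem isStr_objIso (X : IntP C) : IsStr (objIso X).hom (ρ_ X.pos).hom (ρ_ X.neg).inv := by
  refine (ι_eqArrow (embed_tensor_dual X)).symm.trans (congrArg ι ?_)
  rw [eqArrow_eq, IsStrictMonoidal.rightUnitor_eq,
    ← eqToHom_tensor_unit_symm (h := (IsStrictMonoidal.tensor_unit X.neg).symm)]
  rfl

theorem isStr_μ (a b : C) : IsStr (Functor.LaxMonoidal.μ (embedEnv C) a b) (𝟙 (a ⊗ b))
    (ρ_ (𝟙_ C)).inv := congrArg ι (embed_m a b)

theorem isStr_δ (a b : C) : IsStr (Functor.OplaxMonoidal.δ (embedEnv C) a b) (𝟙 (a ⊗ b))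
    (ρ_ (𝟙_ C)).hom := congrArg ι (embed_mInv a b)

theorem isStr_ε : IsStr (Functor.LaxMonoidal.ε (embedEnv C)) (𝟙 (𝟙_ C)) (𝟙 (𝟙_ C)) :=
  congrArg ι embed_mI

theorem isStr_η : IsStr (Functor.OplaxMonoidal.η (embedEnv C)) (𝟙 (𝟙_ C)) (𝟙 (𝟙_ C)) :=
  congrArg ι embed_mIInv

theorem isStr_map {a b : C} (f : a ⟶ b) : IsStr ((embedEnv C).map f) f (𝟙 (𝟙_ C)) :=
  congrArg ι (embed_map f)

theorem isStr_hat {a y b x : C} (f : a ⊗ y ⟶ b ⊗ x) :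
    IsStr (hat (embedEnv C) f) f (𝟙 (𝟙_ C ⊗ 𝟙_ C)) :=
  ((isStr_μ a y).comp ((isStr_map f).comp (isStr_δ b x))).of_eq
    ((Category.id_comp _).trans (Category.comp_id _)) (by
      change ((ρ_ (𝟙_ C)).hom ≫ 𝟙 _) ≫ (ρ_ (𝟙_ C)).inv = 𝟙 _
      rw [Category.comp_id, Iso.hom_inv_id])

/-- Every arrow of the Int-construction is a bent arrow of the base, up to the identification of
objects. A comparison that respects the base and the pairings is therefore natural. -/
theorem kMap_embed {X Y : IntP C} (f : X ⟶ Y) :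
    kMap (embedEnv C) duPairing f ≫ (objIso Y).hom = (objIso X).hom ≫ ι f := by
  have h := (congrArg (Pairing.bend _ _) (isStr_hat (IntP.Hom.arr f))).trans (bend_ι
    (P := (embed C).obj X.pos) (N := (embed C).obj Y.neg) (Q := (embed C).obj Y.pos)
      (M := (embed C).obj X.neg) (str (IntP.Hom.arr f) (𝟙 _)))
  refine ((congrArg (· ≫ _) h).trans (ι_comp_isStr _ (isStr_objIso Y))).trans
    (Eq.trans ?_ ((isStr_objIso X).comp_ι f).symm)
  refine congrArg ι (IntP.Hom.ext ?_)
  have := gen (IntP.Hom.arr f) 0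
  dsimp only [MonoidalCategoryStruct.tensorObj, str, kObj, tObj, dual, unit, embed, du,
    embedEnv, MonoidalFunctorData.IsSymmMonoidal.base]
  exact solve

theorem isStr_mate {A B : IntP C} {x : Env.of A ⟶ Env.of B} {s : A.pos ⟶ B.pos}
    {t : B.neg ⟶ A.neg} (h : IsStr x s t) :
    IsStr (Pairing.mate (duPairing (.of B)) (duPairing (.of A)) x) t s := by
  dsimp only [IsStr] at h ⊢
  rw [h, mate_ι]
  refine congrArg ι (IntP.Hom.ext ?_)
  have := gen s 0; have := gen t 1
  dsimp only [str, dual, du]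
  exact solve

theorem mate_tensor_id (A B : IntP C) :
    Pairing.mate ((duPairing (.of A)).tensor (duPairing (.of B))) (duPairing (.of (A ⊠ B)))
      (𝟙 (Env.of (A ⊠ B))) = 𝟙 (Env.of (dual (A ⊠ B))) := by
  refine (Pairing.eq_mate _ _ ?_).symm
  refine (congrArg (· ≫ _) (MonoidalCategory.whiskerLeft_id _ _)).trans ?_
  refine Eq.trans ?_ (congrArg (· ≫ _) (MonoidalCategory.id_whiskerRight _ _)).symm
  exact (Category.id_comp _).trans ((tensor_ε A B).symm.trans (Category.id_comp _).symm)

theorem isStr_dualTen (x y : C) : IsStr (dualTen (embedEnv C) duPairing x y).hom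
    (ρ_ (𝟙_ C)).hom (𝟙 (y ⊗ x)) := by
  rw [dualTen_hom]
  have h := Pairing.mate_comp ((duPairing ((embedEnv C).obj y)).tensor (duPairing ((embedEnv C).obj x)))
    (duPairing ((embedEnv C).obj y ⊗ (embedEnv C).obj x)) (duPairing ((embedEnv C).obj (y ⊗ x)))
    (𝟙 _) (Functor.OplaxMonoidal.δ (embedEnv C) y x)
  rw [Category.comp_id] at h
  rw [← h]
  refine ((congrArg (· ≫ _) (mate_tensor_id ((embed C).obj y) ((embed C).obj x))).trans
    (Category.id_comp _)).trans ?_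
  exact isStr_mate (isStr_δ y x)

theorem isStr_dualUnit : IsStr (dualUnit (embedEnv C) duPairing).hom (𝟙 (𝟙_ C)) (𝟙 (𝟙_ C)) := by
  have h : Pairing.mate (Pairing.unit : Pairing (𝟙_ (Env (IntP C))) _)
      (duPairing (𝟙_ (Env (IntP C)))) (𝟙 _) = 𝟙 (𝟙_ (Env (IntP C))) := by
    refine (Pairing.eq_mate _ _ ?_).symm
    refine (congrArg (· ≫ _) (MonoidalCategory.whiskerLeft_id _ _)).trans ?_
    refine Eq.trans ?_ (congrArg (· ≫ _) (MonoidalCategory.id_whiskerRight _ _)).symm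
    refine (Category.id_comp _).trans (Eq.trans ?_ (Category.id_comp _).symm)
    refine Eq.trans (congrArg ι (IntP.Hom.ext ?_)) (IsStr.leftUnitor (𝟙_ (Env (IntP C)))).symm
    change (ρ_ (𝟙_ C ⊗ 𝟙_ C)).hom ≫ (λ_ (𝟙_ C ⊗ 𝟙_ C)).inv = (λ_ (𝟙_ C)).hom ⊗ₘ (ρ_ (𝟙_ C)).inv
    exact solve
  have h' := Pairing.mate_comp (Pairing.unit : Pairing (𝟙_ (Env (IntP C))) _)
    (duPairing (𝟙_ (Env (IntP C)))) (duPairing ((embedEnv C).obj (𝟙_ C)))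
    (𝟙 _) (Functor.OplaxMonoidal.η (embedEnv C))
  rw [Category.comp_id, h] at h'
  exact h'.symm.trans ((Category.id_comp _).trans (isStr_mate isStr_η))

theorem kTen_embed (X Y : IntP C) :
    (kTen (embedEnv C) duPairing X.pos X.neg Y.pos Y.neg).hom ≫ (objIso (X ⊠ Y)).hom =
      (objIso X).hom ⊗ₘ (objIso Y).hom := by
  refine IsStr.ext (((IsStr.tensorμ _ _ _ _).comp ((isStr_μ _ _).tensor (isStr_dualTen _ _))).comp
    (isStr_objIso (X ⊠ Y))) ((isStr_objIso X).tensor (isStr_objIso Y)) ?_ ?_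
  · dsimp only [MonoidalCategoryStruct.tensorObj, kObj, tObj, dual, unit, embed, du,
      embedEnv, MonoidalFunctorData.IsSymmMonoidal.base]
    exact solve
  · dsimp only [MonoidalCategoryStruct.tensorObj, kObj, tObj, dual, unit, embed, du,
      embedEnv, MonoidalFunctorData.IsSymmMonoidal.base]
    exact solve

theorem kUnit_embed : (kUnit (embedEnv C) duPairing).hom ≫ (objIso unit).hom = 𝟙 _ := by
  refine IsStr.ext (((IsStr.leftUnitor_inv _).comp (isStr_ε.tensor isStr_dualUnit)).comp
    (isStr_objIso unit)) (.id _) ?_ ?_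
  · dsimp only [MonoidalCategoryStruct.tensorUnit, tObj, dual, unit, embed, du,
      embedEnv, MonoidalFunctorData.IsSymmMonoidal.base]
    exact solve
  · dsimp only [MonoidalCategoryStruct.tensorUnit, tObj, dual, unit, embed, du,
      embedEnv, MonoidalFunctorData.IsSymmMonoidal.base]
    exact solve

theorem kTheta_embed (a : C) :
    (kTheta (embedEnv C) duPairing a).inv ≫ (objIso ((embed C).obj a)).hom = 𝟙 _ := by
  refine IsStr.ext (((IsStr.rightUnitor_inv _).comp (isStr_dualUnit.whiskerLeft _)).comp
    (isStr_objIso ((embed C).obj a))) (.id _) ?_ ?_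
  · dsimp only [MonoidalCategoryStruct.tensorUnit, tObj, dual, unit, embed, du,
      embedEnv, MonoidalFunctorData.IsSymmMonoidal.base]
    exact solve
  · dsimp only [MonoidalCategoryStruct.tensorUnit, tObj, dual, unit, embed, du,
      embedEnv, MonoidalFunctorData.IsSymmMonoidal.base]
    exact solve

end IntP

end Para

namespace Para

open Wiring ParacategoryStruct MonoidalParaStruct CompactClosedParaStruct Env

/-! ### Uniqueness of extensions -/

section comparison

open Functor.LaxMonoidal Functor.OplaxMonoidal Functor.Monoidal

variable {C : Type w} [Category.{z} C] [MonoidalCategory C] [SymmetricCategory C]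
  {E : Type u} [Category.{v} E] [MonoidalCategory E] [SymmetricCategory E]
  {E' : Type u'} [Category.{v'} E'] [MonoidalCategory E'] [SymmetricCategory E']
  {K L : E ⥤ E'} [K.Braided] [L.Braided] {N : C ⥤ E} [N.Braided] {G : C ⥤ E'} [G.Braided]

/-- Equations between comparisons are obtained by exhibiting both as compatible with the same
isomorphism. -/
theorem Compat.right_unique {U V : E} {τ : K.obj U ⟶ L.obj U} {σ σ' : K.obj V ⟶ L.obj V}
    {x : U ≅ V} (h : Compat τ σ x.hom) (h' : Compat τ σ' x.hom) : σ = σ' :=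
  (cancel_epi (K.map x.hom)).1 (Eq.trans h (Eq.symm h'))

variable (K N G) in
/-- A monoidal isomorphism from the restriction of `K` along `N` to `G`. -/
structure RestrictionIso where
  app : ∀ a : C, K.obj (N.obj a) ≅ G.obj a
  natural : ∀ {a b : C} (f : a ⟶ b), K.map (N.map f) ≫ (app b).hom = (app a).hom ≫ G.map f
  tensor : ∀ a b : C, ((app a).hom ⊗ₘ (app b).hom) ≫ μ G a b =
    μ K _ _ ≫ K.map (μ N a b) ≫ (app (a ⊗ b)).hom
  unit : ε K ≫ K.map (ε N) ≫ (app (𝟙_ C)).hom = ε G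

/-- The comparison determined by two restriction isomorphisms. -/
def IntP.Comparison.ofRestrictionIso (θ : RestrictionIso K N G) (ψ : RestrictionIso L N G) :
    IntP.Comparison K L N where
  app a := θ.app a ≪≫ (ψ.app a).symm
  natural {a b} f := by
    dsimp only [Compat, Iso.trans_hom, Iso.symm_hom]
    have h : G.map f ≫ (ψ.app b).inv = (ψ.app a).inv ≫ L.map (N.map f) := by
      rw [Iso.eq_inv_comp, ← reassoc_of% ψ.natural f, Iso.hom_inv_id, Category.comp_id]
    rw [reassoc_of% θ.natural f, Category.assoc, h]
  tensor a b := by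
    dsimp only [Compat, tTen, Iso.trans_hom, Iso.symm_hom]
    rw [← cancel_epi (μ K (N.obj a) (N.obj b)), ← cancel_mono (ψ.app (a ⊗ b)).hom]
    simp only [Category.assoc, Iso.inv_hom_id, Category.comp_id, μ_δ_assoc]
    rw [← θ.tensor, ← ψ.tensor, tensorHom_comp_tensorHom_assoc]
    simp
  unit := by
    dsimp only [Compat, tUnit, Iso.trans_hom, Iso.symm_hom]
    rw [← cancel_epi (ε K), ← cancel_mono (ψ.app (𝟙_ C)).hom]
    simp only [Category.assoc, Iso.inv_hom_id, Category.comp_id, ε_η_assoc]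
    rw [θ.unit, ψ.unit]

end comparison

theorem Pairing.transport_refl_ε {E : Type u} [Category.{v} E] [MonoidalCategory E]
    [SymmetricCategory E] {U V V' : E} {p : Pairing U V} {q : Pairing U V'} {f : V ≅ V'}
    (h : U ◁ f.hom ≫ q.ε = p.ε) : (p.transport (Iso.refl U) f).ε = q.ε := by
  dsimp only [transport, Iso.refl_inv]
  rw [id_tensorHom, ← h, ← whiskerLeft_comp_assoc, f.inv_hom_id,
    MonoidalCategory.whiskerLeft_id, Category.id_comp]

theorem Env.TotPairing.congr {D : Type u} [MonoidalParaStruct.{v} D]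
    [IsSymmMonoidalParacategory D] {U V : Env D} {p q : Pairing U V} (hp : TotPairing p)
    (h : p.ε = q.ε) : TotPairing q := by
  have h' := Pairing.ext_of_ε p q h
  obtain ⟨_, _, _, _⟩ := p
  obtain ⟨_, _, _, _⟩ := q
  subst h h'
  exact hp

namespace CompactClosedFunctorData.IsCompactClosed

variable {A : Type u} [CompactClosedParaStruct.{v} A] [IsCompactClosedParacategory A]
  {D : Type u'} [CompactClosedParaStruct.{v'} D] [IsCompactClosedParacategory D]
  {F : CompactClosedFunctorData A D} (hF : F.IsCompactClosed)

theorem mD_ε (X : A) :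
    Env.of (F.obj X) ◁ ι (F.mD X) ≫ ((duPairing (.of X)).map hF.toIsSymmMonoidal.env).ε =
      (duPairing (.of (F.obj X))).ε := by
  have h := mk_eq_mk (hF.mD_eps X).symm (dom_of_rep (hF.mI_total.tot_hom.comp_rep (rep_ι _)))
  simp only [mk_cons, mk_nil, Category.id_comp, ι_one_tHom, Category.assoc] at h
  have h' := congrArg (· ≫ ι F.mIInv) h
  have h'' : ι F.mI ≫ ι F.mIInv = 𝟙 _ := hF.mI_total.iso.hom_inv_id
  simp only [Category.assoc, h''] at h'
  exact h'.symm.trans (Category.comp_id _)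

/-- The structure arrow on duals is no independent datum: compatibility with the counit makes it the
canonical comparison of two pairings. -/
theorem ι_mD (X : A) : ι (F.mD X) = Pairing.mate (duPairing (.of (F.obj X)))
    ((duPairing (.of X)).map hF.toIsSymmMonoidal.env) (𝟙 (Env.of (F.obj X))) := by
  refine Pairing.eq_mate _ _ ((hF.mD_ε X).trans ?_)
  exact ((congrArg (· ≫ _) (MonoidalCategory.id_whiskerRight _ _)).trans (Category.id_comp _)).symm

/-- The image pairing is the given pairing transported along the total isomorphism `mD`: the counits
agree, and a counit determines its unit. -/
theorem tot_map_duPairing (X : A) :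
    TotPairing ((duPairing (.of X)).map hF.toIsSymmMonoidal.env) := by
  refine ((tot_duPairing (.of (F.obj X))).transport (e := Iso.refl _)
    (f := (hF.mD_total X).iso) (tot_id _) (tot_id _)
    (hF.mD_total X).tot_hom (hF.mD_total X).tot_inv).congr (Pairing.transport_refl_ε (hF.mD_ε X))

end CompactClosedFunctorData.IsCompactClosed

section functorIso

variable {A : Type u} [CompactClosedParaStruct.{v} A] [IsCompactClosedParacategory A]
  {D : Type u'} [CompactClosedParaStruct.{v'} D] [IsCompactClosedParacategory D]
  {K L : CompactClosedFunctorData A D} (hK : K.IsCompactClosed) (hL : L.IsCompactClosed)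

/-- A total monoidal natural isomorphism, as a family of isomorphisms of the envelope. -/
structure EnvIso (e : ∀ X : A, Env.of (K.obj X) ≅ Env.of (L.obj X)) : Prop where
  tot_hom : ∀ X, Tot (e X).hom
  tot_inv : ∀ X, Tot (e X).inv
  natural : ∀ {X Y : A} (f : X ⟶ Y), Compat (K := hK.toIsSymmMonoidal.env)
    (L := hL.toIsSymmMonoidal.env) (U := .of X) (V := .of Y) (e X).hom (e Y).hom (ι f)
  tensor : ∀ X Y : A, tTen (K := hK.toIsSymmMonoidal.env) (L := hL.toIsSymmMonoidal.env)
    (U := .of X) (V := .of Y) (e X).hom (e Y).hom = (e (X ⊠ Y)).hom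
  unit : tUnit hK.toIsSymmMonoidal.env hL.toIsSymmMonoidal.env = (e unit).hom

variable {hK hL}

/-- Naturality at the counit together with monoidality determines the component at a dual, so
compatibility with duals need not be required of an `EnvIso`. -/
theorem EnvIso.dual {e : ∀ X : A, Env.of (K.obj X) ≅ Env.of (L.obj X)} (h : EnvIso hK hL e)
    (X : A) : (e (dual X)).hom = Pairing.mate ((duPairing (.of X)).map hK.toIsSymmMonoidal.env)
      ((duPairing (.of X)).map hL.toIsSymmMonoidal.env) (e X).inv := by
  refine Compat.eq_mate_of_compat_ε (K := hK.toIsSymmMonoidal.env)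
    (L := hL.toIsSymmMonoidal.env) (U := .of X) (V := .of (CompactClosedParaStruct.dual X))
    (τ := e X) (p := duPairing (.of X)) ?_
  rw [h.tensor, h.unit]
  exact h.natural (eps X)

theorem EnvIso.isFunctorIso {e : ∀ X : A, Env.of (K.obj X) ≅ Env.of (L.obj X)}
    (h : EnvIso hK hL e) {φ : ∀ X : A, K.obj X ⟶ L.obj X} (hφ : ∀ X, ι (φ X) = (e X).hom) :
    IsFunctorIso K L φ where
  total X := ⟨(h.tot_inv X).rep.arr, IsTotalIso.of_iso (e X) (hφ X).symm (Rep.ι_arr _).symm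
    (h.tot_hom X) (h.tot_inv X)⟩
  natural {X Y} f := by
    refine comp_congr ?_
    simp only [mk_cons, mk_nil, Category.id_comp, hφ]
    exact h.natural f
  monoidal X Y := by
    refine comp_congr ?_
    simp only [mk_cons, mk_nil, Category.id_comp, ι_tHom, hφ, ← h.tensor]
    exact (Functor.Monoidal.μ_δ_assoc hK.toIsSymmMonoidal.env (.of X) (.of Y) _).symm
  monoidal_unit := by
    refine comp_eq_some.2 ?_
    simp only [mk_cons, mk_nil, Category.id_comp, hφ, ← h.unit]
    exact Functor.Monoidal.ε_η_assoc hK.toIsSymmMonoidal.env _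
  dual X := by
    obtain ⟨d, hd⟩ : ∃ d : CompactClosedParaStruct.dual (L.obj X) ⟶
        CompactClosedParaStruct.dual (K.obj X), Pairing.mate (duPairing (.of (L.obj X)))
          (duPairing (.of (K.obj X))) (ι (φ X)) = ι d := (tot_duPairing (.of (L.obj X))).rep_mate (tot_duPairing (.of (K.obj X)))
      (rep_ι (φ X))
    rw [Part.eq_some_iff.2 (mem_dualArrow.2 hd), Part.bind_some]
    refine comp_eq_some.2 ?_
    simp only [mk_cons, mk_nil, Category.id_comp, Category.assoc]
    rw [← hd, hK.ι_mD, hL.ι_mD, hφ, hφ, h.dual]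
    refine (congrArg (_ ≫ ·) (Pairing.mate_comp _ _ _ _ _)).trans
      ((Pairing.mate_comp _ _ _ _ _).trans (congrArg (Pairing.mate _ _) ?_))
    exact (congrArg (· ≫ _) (Category.comp_id _)).trans (e X).inv_hom_id

/-- The isomorphisms of the envelope given by an isomorphism of functors. -/
noncomputable def IsFunctorIso.iso {φ : ∀ X : A, K.obj X ⟶ L.obj X} (h : IsFunctorIso K L φ)
    (X : A) : Env.of (K.obj X) ≅ Env.of (L.obj X) := (h.total X).choose_spec.iso

theorem IsFunctorIso.envIso {φ : ∀ X : A, K.obj X ⟶ L.obj X} (h : IsFunctorIso K L φ) :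
    EnvIso hK hL h.iso where
  tot_hom X := (h.total X).choose_spec.tot_hom
  tot_inv X := (h.total X).choose_spec.tot_inv
  natural {X Y} f := mk_eq_mk (h.natural f)
    (dom_of_rep ((h.total Y).choose_spec.tot_hom.comp_rep (rep_ι _)))
  tensor X Y := by
    have h' := mk_eq_mk (h.monoidal X Y) (dom_of_rep ((hL.m_total X Y).tot_hom.comp_rep (rep_ι _)))
    simp only [mk_cons, mk_nil, Category.id_comp, ι_tHom] at h'
    exact (congrArg (_ ≫ ·) h').trans
      (Functor.Monoidal.δ_μ_assoc hK.toIsSymmMonoidal.env (.of X) (.of Y) _)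
  unit := by
    have h' := comp_eq_some.1 h.monoidal_unit
    simp only [mk_cons, mk_nil, Category.id_comp] at h'
    exact (congrArg (_ ≫ ·) h'.symm).trans
      (Functor.Monoidal.η_ε_assoc hK.toIsSymmMonoidal.env _)

end functorIso

namespace IntP

variable {C : Type u} [Category.{v} C] [MonoidalCategory C] [SymmetricCategory C]
  [IsStrictMonoidal C] [PartialTrace C] {D : Type u'} [CompactClosedParaStruct.{v'} D]
  [IsCompactClosedParacategory D] {K L : CompactClosedFunctorData (IntP C) D}
  {hK : K.IsCompactClosed} {hL : L.IsCompactClosed}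

/-- Each object is a tensor product of an embedded object and the dual of one, and the components
there are forced by monoidality and by `EnvIso.dual`. -/
theorem envIso_unique {e e' : ∀ X : IntP C, Env.of (K.obj X) ≅ Env.of (L.obj X)}
    (h : EnvIso hK hL e) (h' : EnvIso hK hL e')
    (w : ∀ a, (e ((embed C).obj a)).hom = (e' ((embed C).obj a)).hom) (X : IntP C) :
    (e X).hom = (e' X).hom := by
  have h1 := h.natural (eqArrow (embed_tensor_dual X))
  have h2 := h'.natural (eqArrow (embed_tensor_dual X))
  rw [ι_eqArrow] at h1 h2
  have h3 : ∀ a, e ((embed C).obj a) = e' ((embed C).obj a) := fun a => Iso.ext (w a)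
  rw [← h.tensor, h.dual, h3, h3] at h1
  rw [← h'.tensor, h'.dual] at h2
  exact Compat.right_unique (x := objIso X) h1 h2

section extension

variable (hK hL) (t : Comparison hK.toIsSymmMonoidal.env hL.toIsSymmMonoidal.env (embedEnv C))

/-- The extension of a comparison. -/
def extendIso (X : IntP C) : hK.toIsSymmMonoidal.env.obj (.of X) ≅
    hL.toIsSymmMonoidal.env.obj (.of X) :=
  hK.toIsSymmMonoidal.env.mapIso (objIso X).symm ≪≫ t.onK duPairing X.pos X.neg ≪≫
    hL.toIsSymmMonoidal.env.mapIso (objIso X)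

theorem compat_objIso (X : IntP C) : Compat (K := hK.toIsSymmMonoidal.env)
    (L := hL.toIsSymmMonoidal.env) (t.onK duPairing X.pos X.neg).hom (extendIso hK hL t X).hom
      (objIso X).hom := by
  dsimp only [Compat, extendIso, Iso.trans_hom, Functor.mapIso_hom, Iso.symm_hom]
  rw [← Functor.map_comp_assoc, Iso.hom_inv_id, CategoryTheory.Functor.map_id, Category.id_comp]

theorem tot_onDual_hom (ht : ∀ a, Tot (t.app a).inv) (a : C) :
    Tot (t.onDual duPairing a).hom :=
  (hK.tot_map_duPairing _).tot_mate (hL.tot_map_duPairing _) (ht a)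

theorem tot_onDual_inv (ht : ∀ a, Tot (t.app a).hom) (a : C) :
    Tot (t.onDual duPairing a).inv :=
  (hL.tot_map_duPairing _).tot_mate (hK.tot_map_duPairing _) (ht a)

theorem tot_map_objIso (X : IntP C) : Tot (hK.toIsSymmMonoidal.env.map (objIso X).hom) := by
  rw [objIso, eqToIso.hom, eqToHom_map]
  exact tot_eqToHom _

theorem tot_map_objIso_inv (X : IntP C) : Tot (hK.toIsSymmMonoidal.env.map (objIso X).inv) := by
  rw [objIso, eqToIso.inv, eqToHom_map]
  exact tot_eqToHom _

theorem extendIso_envIso (ht : ∀ a, Tot (t.app a).hom) (ht' : ∀ a, Tot (t.app a).inv) :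
    EnvIso hK hL (extendIso hK hL t) where
  tot_hom X := (tot_map_objIso_inv hK X).comp ((((hK.m_total _ _).tot_inv).comp
    (((ht _).tensor (tot_onDual_hom hK hL t ht' _)).comp (hL.m_total _ _).tot_hom)).comp
      (tot_map_objIso hL X))
  tot_inv X := Tot.comp (Tot.comp (tot_map_objIso_inv hL X) (((hL.m_total _ _).tot_inv.comp
    ((ht' _).tensor (tot_onDual_inv hK hL t ht _))).comp (hK.m_total _ _).tot_hom)) (tot_map_objIso hK X)
  natural {X Y} f := by
    have h : ι f = (objIso X).inv ≫ kMap (embedEnv C) duPairing f ≫ (objIso Y).hom := by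
      rw [kMap_embed, Iso.inv_hom_id_assoc]
    rw [h]
    exact (compat_objIso hK hL t X).inv.comp ((t.compat_kMap duPairing f).comp (compat_objIso hK hL t Y))
  tensor X Y := by
    have h := (t.compat_kTen duPairing X.pos X.neg Y.pos Y.neg).comp (compat_objIso hK hL t (X ⊠ Y))
    rw [kTen_embed] at h
    exact Compat.right_unique (x := objIso X ⊗ᵢ objIso Y)
      ((compat_objIso hK hL t X).tensor (compat_objIso hK hL t Y)) h
  unit := by
    have h := (t.compat_kUnit duPairing).comp (compat_objIso hK hL t unit)
    rw [kUnit_embed] at h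
    exact Compat.right_unique (x := Iso.refl _) (.id _) h

theorem extendIso_embed (a : C) : (extendIso hK hL t ((embed C).obj a)).hom = (t.app a).hom := by
  have h := (t.compat_kTheta_inv duPairing a).comp (compat_objIso hK hL t ((embed C).obj a))
  rw [kTheta_embed] at h
  exact Compat.right_unique (x := Iso.refl _) h (.id _)

end extension

variable {G : MonoidalFunctorData C D} {θ : ∀ A : C, K.obj ((embed C).obj A) ⟶ G.obj A}

/-- An isomorphism of functors as an isomorphism of functors to the envelope. -/
noncomputable def restrictionIso (hK : K.IsCompactClosed) (hG : G.IsSymmMonoidal)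
    (h : IsCompIso (embed C) K.toMonoidalFunctorData G θ) :
    RestrictionIso hK.toIsSymmMonoidal.env (embedEnv C) hG.base where
  app a := (h.total a).choose_spec.iso
  natural {a b} f := mk_eq_mk (h.natural f)
    (dom_of_rep ((h.total b).choose_spec.tot_hom.comp_rep (rep_ι _)))
  tensor a b := by
    have h' := mk_eq_mk (h.monoidal a b) (dom_of_rep ((hG.m_total a b).tot_hom.comp_rep (rep_ι _)))
    simp only [mk_cons, mk_nil, Category.id_comp, ι_tHom, Category.assoc] at h'
    exact h'
  unit := by
    have h' := comp_eq_some.1 h.monoidal_unit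
    simp only [mk_cons, mk_nil, Category.id_comp, Category.assoc] at h'
    exact h'

/-- On embedded objects the required isomorphism must be `θ` followed by the inverse of `ψ`. This
comparison extends along the decomposition of objects, and `envIso_unique` leaves no other choice.
-/
theorem existsUnique_functorIso (hK : K.IsCompactClosed) (hL : L.IsCompactClosed)
    (hG : G.IsSymmMonoidal) (hθ : IsCompIso (embed C) K.toMonoidalFunctorData G θ)
    {ψ : ∀ A : C, L.obj ((embed C).obj A) ⟶ G.obj A}
    (hψ : IsCompIso (embed C) L.toMonoidalFunctorData G ψ) :
    ∃! φ : ∀ X : IntP C, K.obj X ⟶ L.obj X, IsFunctorIso K L φ ∧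
      ∀ A : C, comp (Path.nil ▹ φ ((embed C).obj A) ▹ ψ A) = Part.some (θ A) := by
  let t := Comparison.ofRestrictionIso (restrictionIso hK hG hθ) (restrictionIso hL hG hψ)
  have ht : ∀ a, Tot (t.app a).hom := fun a =>
    (hθ.total a).choose_spec.tot_hom.comp (hψ.total a).choose_spec.tot_inv
  have ht' : ∀ a, Tot (t.app a).inv := fun a =>
    (hψ.total a).choose_spec.tot_hom.comp (hθ.total a).choose_spec.tot_inv
  have he := extendIso_envIso hK hL t ht ht'
  have hφ : ∀ X, ι (he.tot_hom X).rep.arr = (extendIso hK hL t X).hom := fun X => Rep.ι_arr _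
  refine ⟨fun X => (he.tot_hom X).rep.arr, ⟨he.isFunctorIso hφ, fun a => comp_eq_some.2 ?_⟩, ?_⟩
  · simp only [mk_cons, mk_nil, Category.id_comp]
    rw [hφ, extendIso_embed]
    exact (Iso.eq_comp_inv (hψ.total a).choose_spec.iso).1 rfl
  · rintro φ ⟨h, w⟩
    funext X
    refine ι_injective (Eq.trans ?_ (hφ X).symm)
    refine envIso_unique (h.envIso (hK := hK) (hL := hL)) he (fun a => ?_) X
    rw [extendIso_embed]
    have h' := comp_eq_some.1 (w a)
    simp only [mk_cons, mk_nil, Category.id_comp] at h'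
    exact (Iso.eq_comp_inv (hψ.total a).choose_spec.iso).2 h'

end IntP

end Para

theorem mainTheorem9 (C : Type u) [Category.{v} C] [MonoidalCategory C] [SymmetricCategory C]
    [IsStrictMonoidal C] [PartialTrace C] :
    -- `IntP C` is a compact closed paracategory and `N = IntP.embed C` is a trace-preserving
    -- (strict) functor of symmetric monoidal paracategories
    IsCompactClosedParacategory (IntP C) ∧
    (IntP.embed C).IsSymmMonoidal ∧ IsTracePreserving (IntP.embed C) ∧
    -- and it is universal with these properties
    ∀ (D : Type u') [CompactClosedParaStruct.{v'} D] [IsCompactClosedParacategory D]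
      (G : MonoidalFunctorData C D), G.IsSymmMonoidal → IsTracePreserving G →
      -- existence of `K` with `K ∘ N ≅ G`
      (∃ K : CompactClosedFunctorData (IntP C) D, K.IsCompactClosed ∧
        ∃ θ, IsCompIso (IntP.embed C) K.toMonoidalFunctorData G θ) ∧
      -- essential uniqueness
      (∀ K L : CompactClosedFunctorData (IntP C) D, K.IsCompactClosed → L.IsCompactClosed →
        ∀ θ ψ, IsCompIso (IntP.embed C) K.toMonoidalFunctorData G θ →
          IsCompIso (IntP.embed C) L.toMonoidalFunctorData G ψ →
          ∃! φ : ∀ X : IntP C, K.obj X ⟶ L.obj X, IsFunctorIso K L φ ∧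
            ∀ A : C, ParacategoryStruct.comp
              (Path.nil ▹ φ ((IntP.embed C).obj A) ▹ ψ A) = Part.some (θ A)) := by
  refine ⟨inferInstance, IntP.embed_isSymmMonoidal, IntP.embed_isTracePreserving, ?_⟩
  intro D _ _ G hG hT
  exact ⟨⟨IntP.extend hG, IntP.extend_isCompactClosed hG hT, _, IntP.extend_isCompIso hG⟩,
    fun K L hK hL θ ψ hθ hψ => IntP.existsUnique_functorIso hK hL hG hθ hψ⟩
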